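/- Write $L^2=L^2([0,1])$ for the real Hilbert space of square-integrable functions, $(f\otimes g)(v)=\langle f,v\rangle g$ for the tensor product, and $\|T\|_{HS}=(\sum_i\|T e_i\|^2)^{1/2}$ ($(e_i)$ an orthonormal basis of $L^2$) for the Hilbert–Schmidt norm. Let $(\Omega,\mathcal A,P)$ be a probability space and let $X=(X_t)_{t\in\mathbb Z}$ be $L^2$-valued random elements such that: (a) almost surely $X_t=f(\delta_t,\delta_{t-1},\delta_{t-2},\dots)$ for every $t\in\mathbb Z$, where $(\delta_t)_{t\in\mathbb Z}$ are i.i.d. random elements of a measurable space $S$ and $f:S^{\infty}\to L^2$ is measurable (so that $X$ is strictly stationary); $E\|X_0\|^2<\infty$ and $E X_t=0$; (b) with $X_{t,m}=f(\delta_t,\dots,\delta_{t-m+1},\delta'_{t-m},\delta'_{t-m-1},\dots)$, where $(\delta'_s)_{s\in\mathbb Z}$ is an independent copy of $(\delta_s)_{s\in\mathbb Z}$, $$\sum_{m\ge1}\sqrt{E\|X_t-X_{t,m}\|^2}<\infty\qquad\text{and}\qquad \lim_{m\to\infty} m\sqrt{E\|X_t-X_{t,m}\|^2}=0 .$$ Moving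 block bootstrap: for $n=kb$ with integers $k,b\ge1$, put $N=n-b+1$, let $I_1,\dots,I_k$ be i.i.d. uniform on $\{1,\dots,N\}$ and independent of the data, and let $X^*_{(i-1)b+j}=X_{I_i+j-1}$ for $1\le i\le k$, $1\le j\le b$. Let $\overline X^*_n=n^{-1}\sum_{t=1}^nX^*_t$, $\overline X_n=n^{-1}\sum_{t=1}^nX_t$, and let $E^*$ and $\mathcal L(\,\cdot\mid \mathbf X_n)$ denote expectation and law over $I_1,\dots,I_k$ conditionally on $\mathbf X_n=(X_1,\dots,X_n)$. Let $n\to\infty$ along a sequence of sample sizes $n=kb$ with block lengths satisfying $b\to\infty$ and $b/\sqrt n\to0$. Then: (i) for every metric $d$ on the Borel probability measures on $L^2$ that metrizes weak convergence, $$d\big(\mathcal L(\sqrt n(\overline X^*_n-E^*\overline X^*_n)\mid\mathbf X_n),\ \mathcal L(\sqrt n\,\overline X_n)\big)\to0\quad\text{in probability};$$ (ii) with $\widehat C_n=n\,E^*\big[(\overline X^*_n-E^*\overline X^*_n)\otimes(\overline X^*_n-E^*\overline X^*_n)\big]$, $$\big\|\widehat C_n-n\,E(\overline X_n\otimes\overline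 X_n)\big\|_{HS}\to0\quad\text{in probability};$$ (iii) the series $\sum_{h\in\mathbb Z}C_h$ of autocovariance operators $C_h=E(X_0\otimes X_h)$ converges unconditionally in operator norm, and with $2\pi\mathcal F_0=\sum_{h\in\mathbb Z}C_h$ (the long-run covariance operator), $$\big\|\widehat C_n-2\pi\mathcal F_0\big\|_{HS}\to0\quad\text{in probability}.$$ -/

import Mathlib

open MeasureTheory ProbabilityTheory Filter Topology
open scoped ENNReal

noncomputable section

/-- The real Hilbert space `L²([0,1])` with respect to Lebesgue measure. -/
abbrev L2 : Type := Lp ℝ 2 (volume.restrict (Set.Icc (0 : ℝ) 1))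

instance instMeasurableSpaceL2 : MeasurableSpace L2 := borel L2

instance instBorelSpaceL2 : BorelSpace L2 := ⟨rfl⟩

instance instSecondCountableTopologyL2 : SecondCountableTopology L2 :=
  haveI : Fact ((2 : ℝ≥0∞) ≠ ∞) := ⟨by norm_num⟩
  Lp.SecondCountableTopology

section Approximability

variable {Ω S E : Type*} [MeasurableSpace Ω] [MeasurableSpace S]
  [NormedAddCommGroup E] [InnerProductSpace ℝ E] [MeasurableSpace E]

/-- The coupled variable `X_{t,m} = f(δ_t, …, δ_{t-m+1}, δ'_{t-m}, δ'_{t-m-1}, …)`, realised on the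
product space `Ω × Ω`: under `P ⊗ P` the first coordinate carries the process `δ`, and
`δ'_s (ω, ω') = δ_s ω'` is an independent copy of it. -/
def coupled (δ : ℤ → Ω → S) (f : (ℕ → S) → E) (t : ℤ) (m : ℕ) (p : Ω × Ω) : E :=
  f fun j => if j < m then δ (t - j) p.1 else δ (t - j) p.2

/-- The quantity `√(E ‖X_t - X_{t,m}‖²)`. -/
def couplingError (P : Measure Ω) (X : ℤ → Ω → E) (δ : ℤ → Ω → S) (f : (ℕ → S) → E)
    (t : ℤ) (m : ℕ) : ℝ :=
  Real.sqrt (∫ p, ‖X t p.1 - coupled δ f t m p‖ ^ 2 ∂(P.prod P))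

/-- `X` is `L²`-`m`-approximable, with innovations `δ` and representing function `f`. -/
structure IsL2mApproximable (P : Measure Ω) (X : ℤ → Ω → E) (δ : ℤ → Ω → S)
    (f : (ℕ → S) → E) : Prop where
  measurable_innovation : ∀ t, Measurable (δ t)
  iIndep_innovation : iIndepFun δ P
  identDistrib_innovation : ∀ t, IdentDistrib (δ t) (δ 0) P P
  measurable_fun : Measurable f
  representation : ∀ t, X t =ᵐ[P] fun ω => f fun j => δ (t - j) ω
  memLp : MemLp (X 0) 2 P
  summable_couplingError : ∀ t, Summable fun m : ℕ => couplingError P X δ f t (m + 1)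

/-- `L²`-`m`-approximability together with `m √(E ‖X_t - X_{t,m}‖²) → 0`. -/
structure IsStronglyL2mApproximable (P : Measure Ω) (X : ℤ → Ω → E) (δ : ℤ → Ω → S)
    (f : (ℕ → S) → E) : Prop extends IsL2mApproximable P X δ f where
  tendsto_couplingError :
    ∀ t, Tendsto (fun m : ℕ => (m : ℝ) * couplingError P X δ f t m) atTop (𝓝 0)

end Approximability

section Covariance

variable {Ω E ι : Type*} [MeasurableSpace Ω] [NormedAddCommGroup E] [InnerProductSpace ℝ E]

/-- The operator `E (Y ⊗ Z)`, where `(y ⊗ z) v = ⟪y, v⟫ z`. -/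
def expTensor (P : Measure Ω) (Y Z : Ω → E) : E →L[ℝ] E :=
  ∫ ω, InnerProductSpace.rankOne ℝ (Z ω) (Y ω) ∂P

/-- The lag `h` autocovariance operator `C_h = E (X_0 ⊗ X_h)` of a mean zero stationary process. -/
def autocovOp (P : Measure Ω) (X : ℤ → Ω → E) (h : ℤ) : E →L[ℝ] E :=
  expTensor P (X 0) (X h)

/-- The spectral density operator at frequency zero, `F_0 = (2π)⁻¹ ∑_{h ∈ ℤ} C_h`. -/
def spectralDensityOpZero (P : Measure Ω) (X : ℤ → Ω → E) : E →L[ℝ] E :=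
  (2 * Real.pi)⁻¹ • ∑' h : ℤ, autocovOp P X h

/-- The Hilbert-Schmidt norm `(∑ ‖T e_i‖²)^{1/2}`, computed in the orthonormal basis `e`, with
value `∞` if `T` is not a Hilbert-Schmidt operator. -/
def hsNorm (e : HilbertBasis ι ℝ E) (T : E →L[ℝ] E) : ℝ≥0∞ :=
  (∑' i, ‖T (e i)‖ₑ ^ 2) ^ (1 / 2 : ℝ)

end Covariance

section Metric

variable {E : Type*} [TopologicalSpace E] [MeasurableSpace E] [OpensMeasurableSpace E]

/-- `d` is a metric on the Borel probability measures on `E` which metrizes weak convergence. -/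
structure MetrizesWeakConvergence
    (d : ProbabilityMeasure E → ProbabilityMeasure E → ℝ) : Prop where
  eq_zero_iff : ∀ μ ν, d μ ν = 0 ↔ μ = ν
  symm : ∀ μ ν, d μ ν = d ν μ
  triangle : ∀ μ ν ρ, d μ ρ ≤ d μ ν + d ν ρ
  tendsto_iff : ∀ (μs : ℕ → ProbabilityMeasure E) (μ : ProbabilityMeasure E),
    Tendsto μs atTop (𝓝 μ) ↔ Tendsto (fun i => d (μs i) μ) atTop (𝓝 0)

end Metric

section Bootstrap

variable {Ω E : Type*} [MeasurableSpace Ω] [NormedAddCommGroup E] [InnerProductSpace ℝ E]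

/-- The sample mean `n⁻¹ ∑_{t=1}^n x_t`. -/
def sampleMean (n : ℕ) (x : ℤ → E) : E :=
  (n : ℝ)⁻¹ • ∑ t ∈ Finset.range n, x (t + 1)

/-- The number `N = n - b + 1` of blocks of length `b` in a stretch of length `n = k b`. -/
abbrev numBlocks (k b : ℕ) : ℕ := k * b - b + 1

/-- The law of `k` i.i.d. block indices, uniform on the `N` possible blocks; the element `i` of
`Fin N` stands for the block `x_{i+1}, …, x_{i+b}`. -/
def blockIndexLaw (k b : ℕ) : Measure (Fin k → Fin (numBlocks k b)) :=
  Measure.pi fun _ => (PMF.uniformOfFintype (Fin (numBlocks k b))).toMeasure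

instance instIsProbabilityMeasureBlockIndexLaw (k b : ℕ) :
    IsProbabilityMeasure (blockIndexLaw k b) := by
  unfold blockIndexLaw; infer_instance

/-- The moving block bootstrap pseudo observations obtained from the data `x_1, …, x_{kb}` and the
block indices `I`. Positions are counted from zero: position `t` is the entry `t % b` of the
selected block number `t / b`. -/
def pseudoObs (k b : ℕ) (x : ℤ → E) (I : Fin k → Fin (numBlocks k b)) (t : Fin (k * b)) : E :=
  x (((I t.divNat : ℕ) : ℤ) + 1 + ((t.modNat : ℕ) : ℤ))

/-- The bootstrap sample mean. -/
def bootMean (k b : ℕ) (x : ℤ → E) (I : Fin k → Fin (numBlocks k b)) : E :=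
  ((k * b : ℕ) : ℝ)⁻¹ • ∑ t, pseudoObs k b x I t

/-- The bootstrap sample mean minus its expectation with respect to the resampling, the data `x`
being held fixed. -/
def bootCentered (k b : ℕ) (x : ℤ → E) (I : Fin k → Fin (numBlocks k b)) : E :=
  bootMean k b x I - ∫ J, bootMean k b x J ∂(blockIndexLaw k b)

/-- `n` times the covariance operator of the bootstrap sample mean given the data `x`. -/
def bootCovOp (k b : ℕ) (x : ℤ → E) : E →L[ℝ] E :=
  ((k * b : ℕ) : ℝ) • expTensor (blockIndexLaw k b) (bootCentered k b x) (bootCentered k b x)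

variable [MeasurableSpace E]

/-- The conditional law, given the data `x`, of `√n` times the centered bootstrap sample mean. -/
def bootLaw (k b : ℕ) (x : ℤ → E) : ProbabilityMeasure E :=
  ⟨(blockIndexLaw k b).map fun I => Real.sqrt ((k * b : ℕ) : ℝ) • bootCentered k b x I,
    Measure.isProbabilityMeasure_map (measurable_of_finite _).aemeasurable⟩

/-- The law of `√n` times the sample mean of `X_1, …, X_n`. -/
def meanLaw [BorelSpace E] [SecondCountableTopology E] (P : Measure Ω) [IsProbabilityMeasure P]
    (X : ℤ → Ω → E) (hX : ∀ t, Measurable (X t)) (n : ℕ) : ProbabilityMeasure E :=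
  ⟨P.map fun ω => Real.sqrt (n : ℝ) • sampleMean n fun t => X t ω,
    Measure.isProbabilityMeasure_map (by
      refine Measurable.aemeasurable (Measurable.const_smul (Measurable.const_smul ?_ _) _)
      exact Finset.measurable_sum _ fun t _ => hX _)⟩

/-- `n` times the covariance operator `E (X̄_n ⊗ X̄_n)` of the sample mean of a mean zero process. -/
def meanCovOp (P : Measure Ω) (X : ℤ → Ω → E) (n : ℕ) : E →L[ℝ] E :=
  (n : ℝ) • expTensor P (fun ω => sampleMean n fun t => X t ω)
    (fun ω => sampleMean n fun t => X t ω)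

end Bootstrap

end

/-! Everything rests on one second-moment estimate. By Fubini, the independent copy of the
innovations in the coupling can be frozen at a single sequence without increasing the error
(`exists_spliced`). So the variable at time `t` is within the lag-`h` coupling error of a function
of the innovations in `(t - h, t]`. That function is independent of everything up to time `t - h`,
so covariances at lag `h` are bounded by a constant times a summable sequence. Hence, for every
continuous linear `L`, the second moment of a sum of `L X_t` over a finite set `A` is at most `κ_L
|A|`, with `κ_L` proportional to `‖L‖` and to the root mean square of `L X_0`
(`integral_norm_sum_clm_sq_le`).

This has two uses. If `L` projects onto the orthogonal complement of a suitable finite-dimensional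
subspace, `κ_L` is as small as desired, uniformly in the sample size; this gives tightness and
disposes of Hilbert-Schmidt tails. For a scalar projection, `m` times the coupling error being small
produces a bounded, centred, `m`-dependent process whose difference from the projection again has an
arbitrarily small `κ` (`exists_bddMDependent`). Scalar limit theorems then need only be proved for
bounded `m`-dependent data, the error being controlled uniformly in `k` and `b`.

For bounded data the conditional characteristic function of the bootstrap is a product of `k` equal
factors, each the characteristic function of a variable of size `O(b / √n)`. It is therefore close
to a Gaussian one with variance `bootVar`. That variance concentrates at the long-run variance,
because squared block sums at distance at least `b + m` are independent and `b² / N → 0`. The sample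
mean is treated by big and small blocks with the same `b`. In direction `u` both characteristic
functions tend to `exp (-v / 2)` with `v = ⟪C u, u⟫`, where `C` is the sum of the autocovariances
and, by a Cesàro argument, the limit of `n E (X̄_n ⊗ X̄_n)`.

Part (i): tightness and pointwise limits of characteristic functions give a weak limit `γ` of the
laws of the sample mean. The bootstrap laws converge to `γ` in probability, because a compact set of
measures with a neighbourhood of `γ` removed is excluded by finitely many characteristic function
conditions (`tendsto_measure_notMem_of_charFun`). Parts (ii) and (iii): after compression to a
finite-dimensional subspace the matrix entries are, by polarization, scalar bootstrap variances, and
the remainder is controlled by the small `κ_L` (`tendsto_measure_le_hsNorm`). -/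

/-! ### Root mean square calculus. -/

section RootMeanSquare

variable {Ω E F : Type*} [MeasurableSpace Ω] [NormedAddCommGroup E] [NormedAddCommGroup F]

/-- The root mean square `√(E ‖Z‖²)`. -/
noncomputable def rms (P : Measure Ω) (Z : Ω → E) : ℝ := Real.sqrt (∫ ω, ‖Z ω‖ ^ 2 ∂P)

variable {P : Measure Ω}

lemma rms_nonneg (Z : Ω → E) : 0 ≤ rms P Z := Real.sqrt_nonneg _

lemma rms_sq (Z : Ω → E) : rms P Z ^ 2 = ∫ ω, ‖Z ω‖ ^ 2 ∂P :=
  Real.sq_sqrt (integral_nonneg fun _ => by positivity)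

lemma rms_le_of_integral_le {Z : Ω → E} {c : ℝ} (hc : 0 ≤ c) (h : ∫ ω, ‖Z ω‖ ^ 2 ∂P ≤ c ^ 2) :
    rms P Z ≤ c := by
  rw [rms]; exact (Real.sqrt_le_sqrt h).trans_eq (Real.sqrt_sq hc)

lemma rms_le_sqrt {Z : Ω → E} {c : ℝ} (h : ∫ ω, ‖Z ω‖ ^ 2 ∂P ≤ c) :
    rms P Z ≤ Real.sqrt c := Real.sqrt_le_sqrt h

lemma rms_neg (Z : Ω → E) : rms P (fun ω => -Z ω) = rms P Z := by simp [rms]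

lemma MemLp.integrable_norm_sq {Z : Ω → E} (hZ : MemLp Z 2 P) :
    Integrable (fun ω => ‖Z ω‖ ^ 2) P := hZ.norm.integrable_sq

lemma MemLp.integrable_norm_mul {Y : Ω → E} {Z : Ω → F} (hY : MemLp Y 2 P) (hZ : MemLp Z 2 P) :
    Integrable (fun ω => ‖Y ω‖ * ‖Z ω‖) P := hY.norm.integrable_mul hZ.norm

lemma integral_norm_mul_le {Y : Ω → E} {Z : Ω → F} (hY : MemLp Y 2 P) (hZ : MemLp Z 2 P) :
    ∫ ω, ‖Y ω‖ * ‖Z ω‖ ∂P ≤ rms P Y * rms P Z := by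
  have h := integral_mul_le_Lp_mul_Lq_of_nonneg (μ := P) (p := 2) (q := 2)
    Real.HolderConjugate.two_two
    (f := fun ω => ‖Y ω‖) (g := fun ω => ‖Z ω‖) (ae_of_all _ fun _ => norm_nonneg _)
    (ae_of_all _ fun _ => norm_nonneg _) (by simpa using hY.norm) (by simpa using hZ.norm)
  simpa [rms, Real.sqrt_eq_rpow] using h

lemma rms_add_le {Y Z : Ω → E} (hY : MemLp Y 2 P) (hZ : MemLp Z 2 P) :
    rms P (fun ω => Y ω + Z ω) ≤ rms P Y + rms P Z := by
  apply rms_le_of_integral_le (add_nonneg (rms_nonneg _) (rms_nonneg _))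
  have h1 : ∫ ω, ‖Y ω + Z ω‖ ^ 2 ∂P
      ≤ ∫ ω, (‖Y ω‖ ^ 2 + 2 * (‖Y ω‖ * ‖Z ω‖) + ‖Z ω‖ ^ 2) ∂P := by
    refine integral_mono (MemLp.integrable_norm_sq (hY.add hZ)) ?_ fun ω => ?_
    · exact ((MemLp.integrable_norm_sq hY).add
        ((MemLp.integrable_norm_mul hY hZ).const_mul 2)).add (MemLp.integrable_norm_sq hZ)
    · have := norm_add_le (Y ω) (Z ω)
      have h0 := norm_nonneg (Y ω + Z ω)
      dsimp only
      nlinarith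
  have h2 : ∫ ω, (‖Y ω‖ ^ 2 + 2 * (‖Y ω‖ * ‖Z ω‖) + ‖Z ω‖ ^ 2) ∂P
      = rms P Y ^ 2 + 2 * ∫ ω, ‖Y ω‖ * ‖Z ω‖ ∂P + rms P Z ^ 2 := by
    have i1 := MemLp.integrable_norm_sq hY
    have i2 := (MemLp.integrable_norm_mul hY hZ).const_mul 2
    have i12 : Integrable (fun ω => ‖Y ω‖ ^ 2 + 2 * (‖Y ω‖ * ‖Z ω‖)) P := i1.add i2
    rw [integral_add i12 (MemLp.integrable_norm_sq hZ), integral_add i1 i2,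
      integral_const_mul, ← rms_sq, ← rms_sq]
  nlinarith [integral_norm_mul_le hY hZ]

lemma rms_sub_le {Y Z : Ω → E} (hY : MemLp Y 2 P) (hZ : MemLp Z 2 P) :
    rms P (fun ω => Y ω - Z ω) ≤ rms P Y + rms P Z := by
  simpa only [sub_eq_add_neg, rms_neg] using rms_add_le hY (Z := fun ω => -Z ω) hZ.neg

lemma rms_const_smul [NormedSpace ℝ E] (c : ℝ) (Z : Ω → E) :
    rms P (fun ω => c • Z ω) = |c| * rms P Z := by
  simp only [rms, norm_smul, mul_pow, integral_const_mul, Real.norm_eq_abs]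
  rw [Real.sqrt_mul (by positivity), Real.sqrt_sq (abs_nonneg c)]

lemma rms_mono {Y : Ω → E} {Z : Ω → F} (hZ : MemLp Z 2 P)
    (h : ∀ᵐ ω ∂P, ‖Y ω‖ ≤ ‖Z ω‖) : rms P Y ≤ rms P Z := by
  refine Real.sqrt_le_sqrt (integral_mono_of_nonneg (ae_of_all _ fun _ => by positivity)
    (MemLp.integrable_norm_sq hZ) ?_)
  filter_upwards [h] with ω hω
  exact pow_le_pow_left₀ (norm_nonneg _) hω 2

lemma rms_clm_le [NormedSpace ℝ E] [NormedSpace ℝ F] (L : E →L[ℝ] F) {Z : Ω → E}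
    (hZ : MemLp Z 2 P) : rms P (fun ω => L (Z ω)) ≤ ‖L‖ * rms P Z := by
  have h : rms P (fun ω => ‖L‖ • Z ω) = ‖L‖ * rms P Z := by
    rw [rms_const_smul, abs_of_nonneg (norm_nonneg _)]
  rw [← h]
  refine rms_mono (hZ.const_smul ‖L‖) (ae_of_all _ fun ω => ?_)
  simpa [norm_smul] using L.le_opNorm (Z ω)

lemma abs_integral_inner_le [InnerProductSpace ℝ E] {Y Z : Ω → E} (hY : MemLp Y 2 P)
    (hZ : MemLp Z 2 P) : |∫ ω, inner ℝ (Y ω) (Z ω) ∂P| ≤ rms P Y * rms P Z := by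
  refine (abs_integral_le_integral_abs.trans ?_).trans (integral_norm_mul_le hY hZ)
  exact integral_mono_of_nonneg (ae_of_all _ fun _ => abs_nonneg _)
    (MemLp.integrable_norm_mul hY hZ) (ae_of_all _ fun ω => abs_real_inner_le_norm _ _)

lemma MemLp.integrable_inner_real [InnerProductSpace ℝ E] {Y Z : Ω → E} (hY : MemLp Y 2 P)
    (hZ : MemLp Z 2 P) : Integrable (fun ω => inner ℝ (Y ω) (Z ω)) P :=
  (MemLp.integrable_norm_mul hY hZ).mono (hY.1.inner hZ.1)
    (ae_of_all _ fun ω => by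
      simpa using abs_real_inner_le_norm (Y ω) (Z ω))

variable [IsProbabilityMeasure P]

lemma integral_norm_le_rms {Z : Ω → E} (hZ : MemLp Z 2 P) : ∫ ω, ‖Z ω‖ ∂P ≤ rms P Z := by
  have := integral_norm_mul_le hZ (memLp_const (μ := P) (p := 2) (1 : ℝ))
  simpa [rms] using this

end RootMeanSquare

/-! ### Linear growth of second moments from summable covariances. -/

section CovarianceBound

variable {Ω E : Type*} [MeasurableSpace Ω] [NormedAddCommGroup E] [InnerProductSpace ℝ E]
  {P : Measure Ω}

/-- If the covariances of `Z` are dominated by a summable function of the lag, the second moment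
of a partial sum grows at most linearly with the number of summands. -/
lemma integral_norm_sum_sq_le {Z : ℤ → Ω → E} (hZ : ∀ t, MemLp (Z t) 2 P) {c : ℤ → ℝ}
    (hc : Summable c) (h : ∀ s t, |∫ ω, inner ℝ (Z s ω) (Z t ω) ∂P| ≤ c (t - s)) (A : Finset ℤ) :
    ∫ ω, ‖∑ t ∈ A, Z t ω‖ ^ 2 ∂P ≤ (∑' h, c h) * A.card := by
  have hc0 : ∀ h, 0 ≤ c h := fun i => by simpa using (abs_nonneg _).trans (h 0 i)
  have h1 : ∫ ω, ‖∑ t ∈ A, Z t ω‖ ^ 2 ∂P = ∑ s ∈ A, ∑ t ∈ A, ∫ ω, inner ℝ (Z s ω) (Z t ω) ∂P := by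
    simp_rw [← real_inner_self_eq_norm_sq, sum_inner, inner_sum]
    rw [integral_finsetSum _ fun s _ => integrable_finsetSum _ fun t _ =>
      MemLp.integrable_inner_real (hZ s) (hZ t)]
    exact Finset.sum_congr rfl fun s _ => integral_finsetSum _ fun t _ =>
      MemLp.integrable_inner_real (hZ s) (hZ t)
  rw [h1, mul_comm, ← nsmul_eq_mul]
  refine Finset.sum_le_card_nsmul _ _ _ fun s _ => ?_
  calc ∑ t ∈ A, ∫ ω, inner ℝ (Z s ω) (Z t ω) ∂P ≤ ∑ t ∈ A, c (t - s) :=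
        Finset.sum_le_sum fun t _ => (le_abs_self _).trans (h s t)
    _ = ∑ t ∈ A.map (Equiv.subRight s).toEmbedding, c t := by simp
    _ ≤ ∑' h, c h := hc.sum_le_tsum _ fun i _ => hc0 i

lemma summable_natAbs {r : ℕ → ℝ} (hr : Summable r) : Summable fun h : ℤ => r h.natAbs :=
  Summable.of_nat_of_neg (by simpa using hr) (by simpa using hr)

lemma tsum_natAbs_le {r : ℕ → ℝ} (hr : Summable r) (hr0 : ∀ h, 0 ≤ r h) :
    ∑' h : ℤ, r h.natAbs ≤ 2 * ∑' h : ℕ, r h := by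
  have h1 := tsum_of_nat_of_neg_add_one (f := fun h : ℤ => r h.natAbs) (by simpa using hr)
    (by
      refine ((summable_nat_add_iff 1).2 hr).congr fun n => ?_
      congr 1)
  have : ∀ n : ℕ, (-((n : ℤ) + 1)).natAbs = n + 1 := fun n => by omega
  simp only [Int.natAbs_natCast, this] at h1
  rw [h1, hr.tsum_eq_zero_add]
  linarith [hr0 0]

end CovarianceBound

/-! ### Independence over disjoint sets of innovations. -/

section Innovations

variable {Ω S E : Type*} [mS : MeasurableSpace S]

/-- The σ-algebra generated by the innovations `δ t`, `t ∈ A`. -/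
abbrev innovSigma (δ : ℤ → Ω → S) (A : Set ℤ) : MeasurableSpace Ω :=
  ⨆ t ∈ A, mS.comap (δ t)

variable {δ : ℤ → Ω → S}

lemma innovSigma_mono {A B : Set ℤ} (h : A ⊆ B) : innovSigma δ A ≤ innovSigma δ B :=
  biSup_mono h

lemma measurable_innovSigma {A : Set ℤ} {t : ℤ} (ht : t ∈ A) :
    Measurable[innovSigma δ A] (δ t) :=
  Measurable.mono (comap_measurable (δ t)) (le_iSup₂_of_le t ht le_rfl) le_rfl

variable [mΩ : MeasurableSpace Ω]

lemma innovSigma_le (hδ : ∀ t, Measurable (δ t)) (A : Set ℤ) : innovSigma δ A ≤ mΩ :=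
  iSup₂_le fun t _ => (hδ t).comap_le

lemma indepFun_of_innovSigma {P : Measure Ω} (hδ : ∀ t, Measurable (δ t)) (hi : iIndepFun δ P)
    {A B : Set ℤ} (hAB : Disjoint A B) {F G : Type*} [MeasurableSpace F] [MeasurableSpace G]
    {Y : Ω → F} {Z : Ω → G} (hY : Measurable[innovSigma δ A] Y)
    (hZ : Measurable[innovSigma δ B] Z) : IndepFun Y Z P := by
  have h : Indep (innovSigma δ A) (innovSigma δ B) P :=
    indep_iSup_of_disjoint (fun t => (hδ t).comap_le) hi.iIndep hAB
  exact indep_of_indep_of_le_left (indep_of_indep_of_le_right h hZ.comap_le) hY.comap_le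

variable [NormedAddCommGroup E] [InnerProductSpace ℝ E] [MeasurableSpace E] [BorelSpace E]
  [CompleteSpace E]

lemma integral_inner_eq_zero_of_innovSigma {P : Measure Ω} [IsProbabilityMeasure P]
    (hδ : ∀ t, Measurable (δ t))
    (hi : iIndepFun δ P) {A B : Set ℤ} (hAB : Disjoint A B) {Y Z : Ω → E}
    (hY : Measurable[innovSigma δ A] Y) (hZ : Measurable[innovSigma δ B] Z)
    (hY2 : MemLp Y 2 P) (hZ2 : MemLp Z 2 P) (h0 : ∫ ω, Y ω ∂P = 0) :
    ∫ ω, inner ℝ (Y ω) (Z ω) ∂P = 0 := by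
  have h := (indepFun_of_innovSigma hδ hi hAB hY hZ).integral_bilin
    (hY2.integrable one_le_two) (hZ2.integrable one_le_two) (innerSL ℝ)
  simp only [h0, map_zero, zero_apply] at h
  exact h

/-- The covariances of a centered process adapted to the past of the innovations are controlled by
the error of approximation by functions of the most recent innovations. -/
lemma abs_integral_inner_le_of_approx {P : Measure Ω} [IsProbabilityMeasure P]
    (hδ : ∀ t, Measurable (δ t)) (hi : iIndepFun δ P) {Z : ℤ → Ω → E}
    (hZm : ∀ t, Measurable[innovSigma δ (Set.Iic t)] (Z t)) (hZ : ∀ t, MemLp (Z t) 2 P)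
    (h0 : ∀ t, ∫ ω, Z t ω ∂P = 0) {a : ℝ} (ha : ∀ t, rms P (Z t) ≤ a) {r : ℕ → ℝ}
    (hr : ∀ t (h : ℕ), ∃ G : Ω → E, Measurable[innovSigma δ (Set.Ioc (t - h) t)] G ∧
      MemLp G 2 P ∧ rms P (fun ω => Z t ω - G ω) ≤ r h) (s t : ℤ) :
    |∫ ω, inner ℝ (Z s ω) (Z t ω) ∂P| ≤ a * r (t - s).natAbs := by
  wlog hst : s ≤ t generalizing s t with H
  · have := H t s (by omega)
    simp_rw [real_inner_comm (Z s _) (Z t _)] at this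
    rwa [show (t - s).natAbs = (s - t).natAbs by omega]
  obtain ⟨G, hGm, hG2, hGr⟩ := hr t (t - s).natAbs
  -- With `h = t - s` the approximant `G` uses only innovations in `(s, t]`, so it is orthogonal to
  -- the centred `Z s` and can be subtracted for free.
  have h1 : ∫ ω, inner ℝ (Z s ω) (Z t ω) ∂P = ∫ ω, inner ℝ (Z s ω) (Z t ω - G ω) ∂P := by
    simp_rw [inner_sub_right]
    rw [integral_sub (MemLp.integrable_inner_real (hZ s) (hZ t))
      (MemLp.integrable_inner_real (hZ s) hG2),
      integral_inner_eq_zero_of_innovSigma hδ hi (A := Set.Iic s) _ (hZm s) hGm (hZ s) hG2 (h0 s),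
      sub_zero]
    rw [Set.disjoint_left]
    intro u hu hu'
    simp only [Set.mem_Iic, Set.mem_Ioc] at hu hu'
    omega
  rw [h1]
  refine (abs_integral_inner_le (hZ s) ((hZ t).sub hG2)).trans ?_
  exact mul_le_mul (ha s) hGr (rms_nonneg _) ((rms_nonneg _).trans (ha s))

/-- Linear growth of second moments of partial sums of a centered adapted process which is
approximated, with summable error, by functions of the most recent innovations. -/
lemma integral_norm_sum_sq_le_of_approx {P : Measure Ω} [IsProbabilityMeasure P]
    (hδ : ∀ t, Measurable (δ t)) (hi : iIndepFun δ P) {Z : ℤ → Ω → E}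
    (hZm : ∀ t, Measurable[innovSigma δ (Set.Iic t)] (Z t)) (hZ : ∀ t, MemLp (Z t) 2 P)
    (h0 : ∀ t, ∫ ω, Z t ω ∂P = 0) {a : ℝ} (ha : ∀ t, rms P (Z t) ≤ a) {r : ℕ → ℝ}
    (hrs : Summable r)
    (hr : ∀ t (h : ℕ), ∃ G : Ω → E, Measurable[innovSigma δ (Set.Ioc (t - h) t)] G ∧
      MemLp G 2 P ∧ rms P (fun ω => Z t ω - G ω) ≤ r h) (A : Finset ℤ) :
    ∫ ω, ‖∑ t ∈ A, Z t ω‖ ^ 2 ∂P ≤ 2 * a * (∑' h, r h) * A.card := by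
  have hr0 : ∀ h, 0 ≤ r h := fun h => by
    obtain ⟨G, -, -, hG⟩ := hr 0 h
    exact (rms_nonneg _).trans hG
  refine (integral_norm_sum_sq_le hZ ((summable_natAbs hrs).mul_left a)
    (abs_integral_inner_le_of_approx hδ hi hZm hZ h0 ha hr) A).trans ?_
  gcongr
  rw [tsum_mul_left, mul_comm 2 a, mul_assoc]
  exact mul_le_mul_of_nonneg_left (tsum_natAbs_le hrs hr0) ((rms_nonneg _).trans (ha 0))

end Innovations

/-! ### Causal processes and splicing of innovation sequences. -/

section Adapted

variable {Ω S E : Type*} [MeasurableSpace S] [MeasurableSpace E]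

/-- The causal process `f (δ_t, δ_{t-1}, …)` driven by the innovations `δ`. -/
def causalProc (δ : ℤ → Ω → S) (f : (ℕ → S) → E) (t : ℤ) (ω : Ω) : E :=
  f fun j => δ (t - j) ω

/-- The sequence whose first `m` entries are those of `x` and whose other entries are those
of `y`. -/
def spliceSeq (m : ℕ) (x y : ℕ → S) : ℕ → S := fun j => if j < m then x j else y j

lemma measurable_spliceSeq (m : ℕ) :
    Measurable fun p : (ℕ → S) × (ℕ → S) => spliceSeq m p.1 p.2 := by
  refine measurable_pi_lambda _ fun j => ?_
  unfold spliceSeq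
  split_ifs <;> fun_prop

/-- The preimage of a cylinder under splicing is a rectangle: the constraints on coordinates below
`m` fall on the first sequence, the others on the second. The two masses multiply back to the
product over all coordinates. -/
lemma map_spliceSeq (μ : Measure S) [IsProbabilityMeasure μ] (m : ℕ) :
    ((Measure.infinitePi fun _ : ℕ => μ).prod (Measure.infinitePi fun _ : ℕ => μ)).map
      (fun p => spliceSeq m p.1 p.2) = Measure.infinitePi fun _ : ℕ => μ := by
  refine Measure.eq_infinitePi _ fun s t ht => ?_
  rw [Measure.map_apply (measurable_spliceSeq m)
    (MeasurableSet.pi s.countable_toSet fun i _ => ht i)]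
  have h : (fun p : (ℕ → S) × (ℕ → S) => spliceSeq m p.1 p.2) ⁻¹' (Set.pi s t)
      = (Set.pi (s.filter (· < m)) t) ×ˢ (Set.pi (s.filter (¬ · < m)) t) := by
    ext p
    simp only [Set.mem_preimage, Set.mem_pi, Finset.mem_coe, Set.mem_prod, Finset.mem_filter,
      spliceSeq]
    constructor
    · intro h
      exact ⟨fun i hi => by simpa [hi.2] using h i hi.1, fun i hi => by simpa [hi.2] using h i hi.1⟩
    · intro h i hi
      split_ifs with him
      · exact h.1 i ⟨hi, him⟩
      · exact h.2 i ⟨hi, him⟩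
  rw [h, Measure.prod_prod, Measure.infinitePi_pi _ fun i _ => ht i,
    Measure.infinitePi_pi _ fun i _ => ht i]
  exact Finset.prod_filter_mul_prod_filter_not s (· < m) fun i => μ (t i)

lemma measurable_causalProc_innovSigma {δ : ℤ → Ω → S} {f : (ℕ → S) → E} (hf : Measurable f)
    (t : ℤ) :
    Measurable[innovSigma δ (Set.Iic t)] (causalProc δ f t) := by
  refine hf.comp (@measurable_pi_lambda _ _ _ (innovSigma δ (Set.Iic t)) _ _ fun j => ?_)
  exact measurable_innovSigma (by simp)

lemma measurable_spliced_innovSigma {δ : ℤ → Ω → S} {f : (ℕ → S) → E} (hf : Measurable f)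
    (t : ℤ) (m : ℕ) (y : ℕ → S) :
    Measurable[innovSigma δ (Set.Ioc (t - m) t)]
      (fun ω => f (spliceSeq m (fun j => δ (t - j) ω) y)) := by
  refine hf.comp (@measurable_pi_lambda _ _ _ (innovSigma δ (Set.Ioc (t - m) t)) _ _ fun j => ?_)
  unfold spliceSeq
  split_ifs with hj
  · exact measurable_innovSigma (by simp [hj])
  · exact @measurable_const _ _ _ (_) _

end Adapted

/-! ### Stationarity, and freezing the independent copy in the coupling. -/

section Stationarity

variable {Ω S E : Type*} [MeasurableSpace Ω] [MeasurableSpace S]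
  [NormedAddCommGroup E] [InnerProductSpace ℝ E] [MeasurableSpace E]

variable {P : Measure Ω} {X : ℤ → Ω → E} {δ : ℤ → Ω → S} {f : (ℕ → S) → E}

lemma IsL2mApproximable.map_innovation (h : IsL2mApproximable P X δ f) (t : ℤ) :
    P.map (δ t) = P.map (δ 0) := (h.identDistrib_innovation t).map_eq

variable [IsProbabilityMeasure P]

/-- The source of stationarity: reindexing i.i.d. variables injectively always yields the same
product law, whatever the reindexing. It is used for shifts of `ℤ` and for the past of a given time.
-/
lemma IsL2mApproximable.map_comp_injective (h : IsL2mApproximable P X δ f) {ι : Type*}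
    {i : ι → ℤ} (hi : Function.Injective i) :
    P.map (fun ω j => δ (i j) ω) = Measure.infinitePi fun _ : ι => P.map (δ 0) := by
  rw [(h.iIndep_innovation.precomp hi).map_fun_eq_infinitePi_map
    fun j => h.measurable_innovation (i j)]
  simp_rw [h.map_innovation]

lemma IsL2mApproximable.map_past (h : IsL2mApproximable P X δ f) (t : ℤ) :
    P.map (fun ω (j : ℕ) => δ (t - j) ω) = Measure.infinitePi fun _ : ℕ => P.map (δ 0) :=
  h.map_comp_injective fun i j hij => by simpa using hij

lemma IsL2mApproximable.measurable_past (h : IsL2mApproximable P X δ f) (t : ℤ) :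
    Measurable (fun ω (j : ℕ) => δ (t - j) ω) :=
  measurable_pi_lambda _ fun _ => h.measurable_innovation _

lemma IsL2mApproximable.map_causalProc_shift (h : IsL2mApproximable P X δ f) (t : ℤ) :
    P.map (fun ω (s : ℤ) => causalProc δ f (t + s) ω) = P.map fun ω s => causalProc δ f s ω := by
  have hΨ : Measurable fun (x : ℤ → S) (s : ℤ) => f fun j : ℕ => x (s - j) :=
    measurable_pi_lambda _ fun s => h.measurable_fun.comp
      (measurable_pi_lambda _ fun j => measurable_pi_apply _)
  have key : ∀ t : ℤ, P.map (fun ω (s : ℤ) => causalProc δ f (t + s) ω)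
      = (Measure.infinitePi fun _ : ℤ => P.map (δ 0)).map
        fun (x : ℤ → S) (s : ℤ) => f fun j : ℕ => x (s - j) := by
    intro t
    rw [← h.map_comp_injective (add_right_injective t), Measure.map_map hΨ
      (measurable_pi_lambda _ fun j => h.measurable_innovation _)]
    congr 1
    ext ω s
    simp [causalProc, add_sub_assoc]
  rw [key t, ← key 0]
  simp

variable [BorelSpace E] [SecondCountableTopology E]

/-- Stationarity in the form used later. `φ` sees the whole trajectory, so that norms, cross moments
at two times and squared block sums are all covered. -/
lemma IsL2mApproximable.integral_causalProc_shift (h : IsL2mApproximable P X δ f)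
    {F : Type*} [NormedAddCommGroup F] [NormedSpace ℝ F] {φ : (ℤ → E) → F} (hφ : Continuous φ)
    (t : ℤ) : ∫ ω, φ (fun s => causalProc δ f (t + s) ω) ∂P
      = ∫ ω, φ (fun s => causalProc δ f s ω) ∂P := by
  have hm : ∀ t : ℤ, Measurable fun ω (s : ℤ) => causalProc δ f (t + s) ω := fun t =>
    measurable_pi_lambda _ fun s => h.measurable_fun.comp (h.measurable_past _)
  have hm0 : Measurable fun ω (s : ℤ) => causalProc δ f s ω := by simpa using hm 0
  rw [← integral_map (hm t).aemeasurable hφ.aestronglyMeasurable,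
    ← integral_map hm0.aemeasurable hφ.aestronglyMeasurable, h.map_causalProc_shift]

lemma IsL2mApproximable.memLp_fun (h : IsL2mApproximable P X δ f) :
    MemLp f 2 (Measure.infinitePi fun _ : ℕ => P.map (δ 0)) := by
  rw [← h.map_past 0, memLp_map_measure_iff h.measurable_fun.aestronglyMeasurable
    (h.measurable_past 0).aemeasurable]
  exact (memLp_congr_ae (h.representation 0)).1 h.memLp

lemma IsL2mApproximable.memLp_causalProc (h : IsL2mApproximable P X δ f) (t : ℤ) :
    MemLp (causalProc δ f t) 2 P := by
  have := h.memLp_fun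
  rwa [← h.map_past t, memLp_map_measure_iff h.measurable_fun.aestronglyMeasurable
    (h.measurable_past t).aemeasurable] at this

/-- Transport to the space of innovation sequences removes the time: the right-hand side is free of
`t`, which is why later bounds mention the coupling error at time `0` only. -/
lemma IsL2mApproximable.couplingError_eq (h : IsL2mApproximable P (causalProc δ f) δ f) (t : ℤ)
    (m : ℕ) : couplingError P (causalProc δ f) δ f t m
      = Real.sqrt (∫ p, ‖f p.1 - f (spliceSeq m p.1 p.2)‖ ^ 2
        ∂((Measure.infinitePi fun _ : ℕ => P.map (δ 0)).prod
          (Measure.infinitePi fun _ : ℕ => P.map (δ 0)))) := by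
  have hm : Measurable fun p : (ℕ → S) × (ℕ → S) => ‖f p.1 - f (spliceSeq m p.1 p.2)‖ ^ 2 :=
    (((h.measurable_fun.comp measurable_fst).sub
      (h.measurable_fun.comp (measurable_spliceSeq m))).norm).pow_const 2
  have := Measure.isProbabilityMeasure_map (μ := P) (h.measurable_past t).aemeasurable
  rw [← h.map_past t, Measure.map_prod_map _ _ (h.measurable_past t) (h.measurable_past t),
    integral_map ((h.measurable_past t).prodMap (h.measurable_past t)).aemeasurable
      hm.aestronglyMeasurable]
  rfl

/-- For a suitable fixed continuation `y` of the innovations, the error of replacing the remote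
innovations by `y` is at most the coupling error. -/
lemma IsL2mApproximable.exists_spliced (h : IsL2mApproximable P (causalProc δ f) δ f) (m : ℕ) :
    ∃ y : ℕ → S, ∀ t : ℤ, MemLp (fun ω => f (spliceSeq m (fun j => δ (t - j) ω) y)) 2 P ∧
      rms P (fun ω => causalProc δ f t ω - f (spliceSeq m (fun j => δ (t - j) ω) y))
        ≤ couplingError P (causalProc δ f) δ f 0 m := by
  have := Measure.isProbabilityMeasure_map (μ := P) (h.measurable_innovation 0).aemeasurable
  set Q := Measure.infinitePi fun _ : ℕ => P.map (δ 0) with hQ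
  have hfst : MemLp (fun p : (ℕ → S) × (ℕ → S) => f p.1) 2 (Q.prod Q) :=
    h.memLp_fun.comp_measurePreserving measurePreserving_fst
  have hspl : MemLp (fun p : (ℕ → S) × (ℕ → S) => f (spliceSeq m p.1 p.2)) 2 (Q.prod Q) := by
    have := h.memLp_fun
    rwa [← map_spliceSeq (P.map (δ 0)) m, memLp_map_measure_iff
      h.measurable_fun.aestronglyMeasurable (measurable_spliceSeq m).aemeasurable] at this
  have hint := MemLp.integrable_norm_sq (hfst.sub hspl)
  -- Integrating out `x` first, some continuation `y` does no worse than the average over `y`. It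
  -- can be taken off the null set where the inner integral is not integrable, so the Bochner
  -- integral there has no default value.
  obtain ⟨y, hy1, hy2⟩ : ∃ y, Integrable (fun x => ‖f x - f (spliceSeq m x y)‖ ^ 2) Q ∧
      ∫ x, ‖f x - f (spliceSeq m x y)‖ ^ 2 ∂Q
        ≤ ∫ p, ‖f p.1 - f (spliceSeq m p.1 p.2)‖ ^ 2 ∂(Q.prod Q) := by
    have hint' : Integrable (fun p : (ℕ → S) × (ℕ → S) => ‖f p.1 - f (spliceSeq m p.1 p.2)‖ ^ 2)
        (Q.prod Q) := hint
    rw [integral_prod_symm _ hint']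
    have h1 : ∀ᵐ y ∂Q, Integrable (fun x => ‖f x - f (spliceSeq m x y)‖ ^ 2) Q :=
      hint.prod_left_ae
    obtain ⟨y, hy, hyN⟩ := exists_notMem_null_le_integral hint.integral_prod_right
      (ae_iff.1 h1)
    exact ⟨y, by simpa using hy, hyN⟩
  have hym : Measurable fun x => f (spliceSeq m x y) :=
    h.measurable_fun.comp ((measurable_spliceSeq m).comp measurable_prodMk_right)
  refine ⟨y, fun t => ?_⟩
  have hd : MemLp (fun x => f x - f (spliceSeq m x y)) 2 Q :=
    (memLp_two_iff_integrable_sq_norm (h.measurable_fun.sub hym).aestronglyMeasurable).2 hy1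
  have hy : MemLp (fun x => f (spliceSeq m x y)) 2 Q := by
    refine (h.memLp_fun.sub hd).ae_eq (ae_of_all _ fun x => ?_)
    simp
  constructor
  · rwa [hQ, ← h.map_past t, memLp_map_measure_iff hym.aestronglyMeasurable
      (h.measurable_past t).aemeasurable] at hy
  · rw [h.couplingError_eq]
    refine Real.sqrt_le_sqrt (le_trans (le_of_eq ?_) hy2)
    have hm : Measurable fun x => ‖f x - f (spliceSeq m x y)‖ ^ 2 :=
      (h.measurable_fun.sub hym).norm.pow_const 2
    rw [hQ, ← h.map_past t, integral_map (h.measurable_past t).aemeasurable hm.aestronglyMeasurable]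
    rfl

end Stationarity

/-! ### Expected tensor products. -/

section ExpTensor

variable {Ω E : Type*} [MeasurableSpace Ω] [NormedAddCommGroup E] [InnerProductSpace ℝ E]
  {P : Measure Ω}

lemma continuous_rankOne :
    Continuous fun p : E × E => InnerProductSpace.rankOne ℝ p.1 p.2 :=
  ((InnerProductSpace.rankOne ℝ (E := E) (F := E)).continuous.comp continuous_fst).clm_apply
    continuous_snd

lemma integrable_rankOne {Y Z : Ω → E} (hY : MemLp Y 2 P) (hZ : MemLp Z 2 P) :
    Integrable (fun ω => InnerProductSpace.rankOne ℝ (Z ω) (Y ω)) P := by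
  refine (MemLp.integrable_norm_mul hZ hY).mono ?_ (ae_of_all _ fun ω => by simp)
  exact Continuous.comp_aestronglyMeasurable₂
    (g := fun z y : E => InnerProductSpace.rankOne ℝ z y) continuous_rankOne hZ.1 hY.1

lemma norm_expTensor_le {Y Z : Ω → E} (hY : MemLp Y 2 P) (hZ : MemLp Z 2 P) :
    ‖expTensor P Y Z‖ ≤ rms P Y * rms P Z := by
  refine (norm_integral_le_integral_norm _).trans ?_
  simp only [InnerProductSpace.norm_rankOne]
  rw [mul_comm]
  exact integral_norm_mul_le hZ hY

lemma expTensor_smul_smul (a c : ℝ) (Y Z : Ω → E) :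
    expTensor P (fun ω => a • Y ω) (fun ω => c • Z ω) = (a * c) • expTensor P Y Z := by
  simp only [expTensor]
  rw [← integral_smul]
  congr 1
  ext ω : 1
  ext v
  simp [smul_smul]

variable [CompleteSpace E]

lemma expTensor_apply {Y Z : Ω → E} (hY : MemLp Y 2 P) (hZ : MemLp Z 2 P) (u : E) :
    expTensor P Y Z u = ∫ ω, inner ℝ (Y ω) u • Z ω ∂P := by
  rw [expTensor, ContinuousLinearMap.integral_apply (integrable_rankOne hY hZ)]
  rfl

lemma inner_expTensor {Y Z : Ω → E} (hY : MemLp Y 2 P) (hZ : MemLp Z 2 P) (u v : E) :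
    inner ℝ (expTensor P Y Z u) v = ∫ ω, inner ℝ (Y ω) u * inner ℝ (Z ω) v ∂P := by
  rw [expTensor_apply hY hZ, real_inner_comm, ← integral_inner]
  · simp_rw [inner_smul_right, real_inner_comm]
  · exact (ContinuousLinearMap.apply ℝ E u).integrable_comp (integrable_rankOne hY hZ)

lemma expTensor_sum {ι κ : Type*} (A : Finset ι) (B : Finset κ) {Y : ι → Ω → E} {Z : κ → Ω → E}
    (hY : ∀ i, MemLp (Y i) 2 P) (hZ : ∀ i, MemLp (Z i) 2 P) :
    expTensor P (fun ω => ∑ i ∈ A, Y i ω) (fun ω => ∑ j ∈ B, Z j ω)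
      = ∑ i ∈ A, ∑ j ∈ B, expTensor P (Y i) (Z j) := by
  simp only [expTensor, map_sum, sum_apply]
  rw [integral_finsetSum _ fun i _ => integrable_finsetSum _ fun j _ =>
    integrable_rankOne (hY i) (hZ j)]
  exact Finset.sum_congr rfl fun i _ => integral_finsetSum _ fun j _ =>
    integrable_rankOne (hY i) (hZ j)

end ExpTensor

/-! ### Autocovariance operators and the long-run covariance operator. -/

section Covariances

variable {Ω S E : Type*} [MeasurableSpace Ω] [MeasurableSpace S]
  [NormedAddCommGroup E] [InnerProductSpace ℝ E] [MeasurableSpace E] [BorelSpace E]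
  [SecondCountableTopology E] {P : Measure Ω} [IsProbabilityMeasure P] {δ : ℤ → Ω → S}
  {f : (ℕ → S) → E}

lemma IsL2mApproximable.summable_couplingError_zero (h : IsL2mApproximable P (causalProc δ f) δ f) :
    Summable fun m => couplingError P (causalProc δ f) δ f 0 m :=
  (summable_nat_add_iff 1).1 (h.summable_couplingError 0)

lemma IsL2mApproximable.exists_approx (h : IsL2mApproximable P (causalProc δ f) δ f) (t : ℤ)
    (m : ℕ) : ∃ G : Ω → E, Measurable[innovSigma δ (Set.Ioc (t - m) t)] G ∧ MemLp G 2 P ∧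
      rms P (fun ω => causalProc δ f t ω - G ω) ≤ couplingError P (causalProc δ f) δ f 0 m := by
  obtain ⟨y, hy⟩ := h.exists_spliced m
  exact ⟨_, measurable_spliced_innovSigma h.measurable_fun t m y, hy t⟩

lemma IsL2mApproximable.rms_comp_causalProc (h : IsL2mApproximable P (causalProc δ f) δ f)
    {F : Type*} [NormedAddCommGroup F] {φ : E → F} (hφ : Continuous φ) (t : ℤ) :
    rms P (fun ω => φ (causalProc δ f t ω)) = rms P (fun ω => φ (causalProc δ f 0 ω)) := by
  have := h.integral_causalProc_shift (φ := fun x : ℤ → E => ‖φ (x 0)‖ ^ 2) (by fun_prop) t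
  simp only [add_zero] at this
  rw [rms, this, rms]

lemma IsL2mApproximable.expTensor_eq_autocovOp (h : IsL2mApproximable P (causalProc δ f) δ f)
    (s t : ℤ) : expTensor P (causalProc δ f s) (causalProc δ f t)
      = autocovOp P (causalProc δ f) (t - s) := by
  have hc : Continuous fun x : ℤ → E => (x (t - s), x 0) := by fun_prop
  have hφ : Continuous fun x : ℤ → E => InnerProductSpace.rankOne ℝ (x (t - s)) (x 0) :=
    continuous_rankOne.comp hc
  have := h.integral_causalProc_shift hφ s
  simpa [expTensor, autocovOp] using this

variable [CompleteSpace E]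

/-- By independence `E (⟪Y, u⟫ Z)` factors. It suffices that one factor is centred, which matters
because the approximants of the process need not be; they occur on the right for lags `≥ 0` and on
the left for lags `≤ 0`. -/
lemma expTensor_eq_zero_of_innovSigma (hδ : ∀ t, Measurable (δ t)) (hi : iIndepFun δ P)
    {A B : Set ℤ} (hAB : Disjoint A B) {Y Z : Ω → E}
    (hY : Measurable[innovSigma δ A] Y) (hZ : Measurable[innovSigma δ B] Z)
    (hY2 : MemLp Y 2 P) (hZ2 : MemLp Z 2 P) (h0 : ∫ ω, Y ω ∂P = 0 ∨ ∫ ω, Z ω ∂P = 0) :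
    expTensor P Y Z = 0 := by
  ext u
  rw [expTensor_apply hY2 hZ2]
  have hYu : Measurable[innovSigma δ A] fun ω => inner ℝ (Y ω) u :=
    (Continuous.measurable (f := fun x : E => inner ℝ x u) (by fun_prop)).comp hY
  rw [(indepFun_of_innovSigma hδ hi hAB hYu hZ).integral_fun_smul_eq_smul_integral
    ((hY2.inner_const u).1) hZ2.1]
  rcases h0 with h0 | h0
  · have : ∫ ω, inner ℝ (Y ω) u ∂P = 0 := by
      simp_rw [real_inner_comm]
      rw [integral_inner (hY2.integrable one_le_two), h0, inner_zero_right]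
    rw [this]; simp
  · rw [h0]; simp

/-- The later of the two variables is replaced by its deviation from an approximant built on the
innovations after the earlier time. For a lag `≤ 0` the later variable is the one at time `0`. -/
lemma IsL2mApproximable.norm_autocovOp_le (h : IsL2mApproximable P (causalProc δ f) δ f)
    (hmean : ∀ t, ∫ ω, causalProc δ f t ω ∂P = 0) (i : ℤ) :
    ‖autocovOp P (causalProc δ f) i‖
      ≤ rms P (causalProc δ f 0) * couplingError P (causalProc δ f) δ f 0 i.natAbs := by
  have hδ := h.measurable_innovation
  have hdis : ∀ (s t : ℤ), s ≤ t → Disjoint (Set.Iic s) (Set.Ioc (t - (t - s).natAbs) t) := by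
    intro s t hst
    rw [Set.disjoint_left]
    intro u hu hu'
    simp only [Set.mem_Iic, Set.mem_Ioc] at hu hu'
    omega
  have hrms : ∀ t, rms P (causalProc δ f t) = rms P (causalProc δ f 0) := fun t =>
    h.rms_comp_causalProc (φ := fun x => x) continuous_id t
  rcases le_total 0 i with hi | hi
  · obtain ⟨G, hGm, hG2, hGr⟩ := h.exists_approx i i.natAbs
    have h1 : autocovOp P (causalProc δ f) i
        = expTensor P (causalProc δ f 0) (fun ω => causalProc δ f i ω - G ω) := by
      have h0 : expTensor P (causalProc δ f 0) G = 0 := by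
        refine expTensor_eq_zero_of_innovSigma hδ h.iIndep_innovation (hdis 0 i hi)
          (measurable_causalProc_innovSigma h.measurable_fun 0) ?_ (h.memLp_causalProc 0) hG2
          (Or.inl (hmean 0))
        rwa [sub_zero]
      rw [autocovOp, ← sub_zero (expTensor P (causalProc δ f 0) (causalProc δ f i)), ← h0]
      simp only [expTensor, map_sub, sub_apply]
      rw [← integral_sub (integrable_rankOne (h.memLp_causalProc 0) (h.memLp_causalProc i))
        (integrable_rankOne (h.memLp_causalProc 0) hG2)]
    rw [h1]
    exact (norm_expTensor_le (h.memLp_causalProc 0) ((h.memLp_causalProc i).sub hG2)).trans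
      (mul_le_mul_of_nonneg_left hGr (rms_nonneg _))
  · obtain ⟨G, hGm, hG2, hGr⟩ := h.exists_approx 0 i.natAbs
    have h1 : autocovOp P (causalProc δ f) i
        = expTensor P (fun ω => causalProc δ f 0 ω - G ω) (causalProc δ f i) := by
      have h0 : expTensor P G (causalProc δ f i) = 0 := by
        refine expTensor_eq_zero_of_innovSigma hδ h.iIndep_innovation (hdis i 0 hi).symm
          ?_ (measurable_causalProc_innovSigma h.measurable_fun i) hG2 (h.memLp_causalProc i)
          (Or.inr (hmean i))
        rw [show (0 - i).natAbs = i.natAbs by omega]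
        exact hGm
      rw [autocovOp, ← sub_zero (expTensor P (causalProc δ f 0) (causalProc δ f i)), ← h0]
      simp only [expTensor, map_sub]
      rw [← integral_sub (integrable_rankOne (h.memLp_causalProc 0) (h.memLp_causalProc i))
        (integrable_rankOne hG2 (h.memLp_causalProc i))]
    rw [h1]
    refine (norm_expTensor_le ((h.memLp_causalProc 0).sub hG2) (h.memLp_causalProc i)).trans ?_
    rw [hrms i, mul_comm]
    exact mul_le_mul_of_nonneg_left hGr (rms_nonneg _)

lemma IsL2mApproximable.summable_autocovOp (h : IsL2mApproximable P (causalProc δ f) δ f)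
    (hmean : ∀ t, ∫ ω, causalProc δ f t ω ∂P = 0) : Summable (autocovOp P (causalProc δ f)) :=
  Summable.of_norm_bounded ((summable_natAbs h.summable_couplingError_zero).mul_left _)
    (h.norm_autocovOp_le hmean)

lemma IsL2mApproximable.meanCovOp_eq (h : IsL2mApproximable P (causalProc δ f) δ f) (n : ℕ) :
    meanCovOp P (causalProc δ f) n
      = (n : ℝ)⁻¹ • ∑ s ∈ Finset.range n, ∑ t ∈ Finset.range n,
        autocovOp P (causalProc δ f) ((t : ℤ) - s) := by
  rcases Nat.eq_zero_or_pos n with rfl | hn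
  · simp [meanCovOp]
  simp only [meanCovOp, sampleMean]
  rw [expTensor_smul_smul, expTensor_sum _ _ (fun i => h.memLp_causalProc _)
    (fun i => h.memLp_causalProc _), smul_smul]
  congr 1
  · field_simp
  · refine Finset.sum_congr rfl fun s _ => Finset.sum_congr rfl fun t _ => ?_
    rw [h.expTensor_eq_autocovOp]
    congr 1; ring

/-- Enlarging the square of indices from `n` to `n + 1` adds a row and a column meeting in a corner,
on which each lag in `[-n, n]` occurs exactly once. The double sum thus becomes a sum of symmetric
partial sums, ready for Cesàro averaging. -/
lemma sum_range_sum_range_sub {G : Type*} [AddCommGroup G] (c : ℤ → G) (n : ℕ) :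
    ∑ s ∈ Finset.range n, ∑ t ∈ Finset.range n, c ((t : ℤ) - s)
      = ∑ i ∈ Finset.range n, ∑ h ∈ Finset.Icc (-(i : ℤ)) i, c h := by
  induction n with
  | zero => simp
  | succ n ih =>
    rw [Finset.sum_range_succ,
      Finset.sum_range_succ (fun i : ℕ => ∑ h ∈ Finset.Icc (-(i : ℤ)) i, c h), ← ih]
    have h2 : ∀ s : ℕ, ∑ t ∈ Finset.range (n + 1), c ((t : ℤ) - s)
        = ∑ t ∈ Finset.range n, c ((t : ℤ) - s) + c ((n : ℤ) - s) := fun s =>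
      Finset.sum_range_succ _ n
    simp_rw [h2]
    rw [Finset.sum_add_distrib, add_assoc]
    congr 1
    have h1 : ∀ k : ℕ, ∑ h ∈ Finset.Icc (-(k : ℤ)) k, c h
        = ∑ x ∈ Finset.range k, c ((k : ℤ) - x) +
          (∑ x ∈ Finset.range k, c (x - (k : ℤ)) + c 0) := by
      intro k
      have hsplit : Finset.Icc (-(k : ℤ)) k
          = ((Finset.range k).image fun x : ℕ => (k : ℤ) - x) ∪
            (((Finset.range k).image fun x : ℕ => (x : ℤ) - k) ∪ {0}) := by
        ext h
        simp only [Finset.mem_Icc, Finset.mem_union, Finset.mem_image, Finset.mem_range,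
          Finset.mem_singleton]
        constructor
        · rintro ⟨h1, h2⟩
          rcases lt_trichotomy h 0 with h0 | h0 | h0
          · exact Or.inr (Or.inl ⟨(k + h).toNat, by omega, by omega⟩)
          · exact Or.inr (Or.inr h0)
          · exact Or.inl ⟨(k - h).toNat, by omega, by omega⟩
        · rintro (⟨x, hx, rfl⟩ | ⟨x, hx, rfl⟩ | rfl) <;> omega
      rw [hsplit, Finset.sum_union, Finset.sum_union, Finset.sum_image, Finset.sum_image,
        Finset.sum_singleton]
      · intro x _ y _ hxy; simpa using hxy
      · intro x _ y _ hxy; simpa using hxy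
      · rw [Finset.disjoint_left]
        intro a ha hb
        simp only [Finset.mem_image, Finset.mem_range, Finset.mem_singleton] at ha hb
        obtain ⟨x, hx, rfl⟩ := ha
        omega
      · rw [Finset.disjoint_left]
        intro a ha hb
        simp only [Finset.mem_image, Finset.mem_range, Finset.mem_singleton,
          Finset.mem_union] at ha hb
        obtain ⟨x, hx, rfl⟩ := ha
        rcases hb with ⟨y, hy, hxy⟩ | hb <;> omega
    rw [h1 n]
    simp [sub_self]

lemma tendsto_Icc_neg_atTop : Tendsto (fun i : ℕ => Finset.Icc (-(i : ℤ)) i) atTop atTop := by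
  refine tendsto_atTop_finset_of_monotone ?_ fun x => ⟨x.natAbs, ?_⟩
  · intro i j hij
    exact Finset.Icc_subset_Icc (by omega) (by omega)
  · rw [Finset.mem_Icc]; omega

/-- The scaled covariance of the sample mean is the Cesàro mean of the symmetric partial sums of a
summable family. -/
lemma IsL2mApproximable.tendsto_meanCovOp (h : IsL2mApproximable P (causalProc δ f) δ f)
    (hmean : ∀ t, ∫ ω, causalProc δ f t ω ∂P = 0) :
    Tendsto (meanCovOp P (causalProc δ f)) atTop
      (𝓝 (∑' i, autocovOp P (causalProc δ f) i)) := by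
  have h1 := ((h.summable_autocovOp hmean).hasSum.comp tendsto_Icc_neg_atTop).cesaro_smul
  refine h1.congr fun n => ?_
  rw [h.meanCovOp_eq, sum_range_sum_range_sub]
  rfl

/-- Second moments of partial sums of a continuous linear image of the process. -/
lemma IsL2mApproximable.integral_norm_sum_clm_sq_le
    (h : IsL2mApproximable P (causalProc δ f) δ f) (hmean : ∀ t, ∫ ω, causalProc δ f t ω ∂P = 0)
    {F : Type*} [NormedAddCommGroup F] [InnerProductSpace ℝ F] [CompleteSpace F]
    [MeasurableSpace F] [BorelSpace F] (L : E →L[ℝ] F) (A : Finset ℤ) :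
    ∫ ω, ‖∑ t ∈ A, L (causalProc δ f t ω)‖ ^ 2 ∂P
      ≤ 2 * rms P (fun ω => L (causalProc δ f 0 ω))
        * (‖L‖ * ∑' m, couplingError P (causalProc δ f) δ f 0 m) * A.card := by
  rw [← tsum_mul_left]
  refine integral_norm_sum_sq_le_of_approx h.measurable_innovation h.iIndep_innovation
    (Z := fun t ω => L (causalProc δ f t ω))
    (fun t => L.measurable.comp (measurable_causalProc_innovSigma h.measurable_fun t))
    (fun t => L.comp_memLp' (h.memLp_causalProc t)) (fun t => ?_)
    (fun t => (h.rms_comp_causalProc L.continuous t).le)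
    (h.summable_couplingError_zero.mul_left _) (fun t m => ?_) A
  · rw [L.integral_comp_comm ((h.memLp_causalProc t).integrable one_le_two), hmean, map_zero]
  · obtain ⟨G, hGm, hG2, hGr⟩ := h.exists_approx t m
    refine ⟨fun ω => L (G ω), L.measurable.comp hGm, L.comp_memLp' hG2, ?_⟩
    simp_rw [← map_sub]
    exact (rms_clm_le L ((h.memLp_causalProc t).sub hG2)).trans
      (mul_le_mul_of_nonneg_left hGr (norm_nonneg _))

end Covariances

/-! ### Approximation by bounded `m`-dependent scalar processes. -/

section BoundedApproximation

variable {Ω S E : Type*} [MeasurableSpace Ω] [MeasurableSpace S]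

/-- A bounded, centered process whose value at time `t` depends on the last `m` innovations only. -/
structure IsBddMDependent (P : Measure Ω) (δ : ℤ → Ω → S) (m : ℕ) (B : ℝ) (y : ℤ → Ω → ℝ) :
    Prop where
  measurable : ∀ t, Measurable[innovSigma δ (Set.Ioc (t - m) t)] (y t)
  bdd : ∀ t ω, |y t ω| ≤ B
  integral_eq_zero : ∀ t, ∫ ω, y t ω ∂P = 0

variable [NormedAddCommGroup E] [InnerProductSpace ℝ E] [MeasurableSpace E] [BorelSpace E]
  [SecondCountableTopology E] {P : Measure Ω} [IsProbabilityMeasure P] {δ : ℤ → Ω → S}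
  {f : (ℕ → S) → E}

lemma tendsto_rms_sub_truncation {g : Ω → ℝ} (hg : MemLp g 2 P) :
    Tendsto (fun B : ℝ => rms P fun ω => g ω - truncation g B ω) atTop (𝓝 0) := by
  have h : Tendsto (fun B : ℝ => ∫ ω, ‖g ω - truncation g B ω‖ ^ 2 ∂P) atTop
      (𝓝 (∫ _, (0 : ℝ) ∂P)) := by
    refine tendsto_integral_filter_of_dominated_convergence (fun ω => ‖g ω‖ ^ 2) ?_ ?_
      (MemLp.integrable_norm_sq hg) ?_
    · exact Eventually.of_forall fun B =>
        ((hg.1.sub hg.1.truncation).norm.pow 2)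
    · refine Eventually.of_forall fun B => ae_of_all _ fun ω => ?_
      rw [norm_pow, norm_norm]
      refine pow_le_pow_left₀ (norm_nonneg _) ?_ 2
      simp only [truncation, Function.comp, Set.indicator]
      split_ifs <;> simp
    · refine ae_of_all _ fun ω => tendsto_const_nhds.congr' ?_
      filter_upwards [eventually_gt_atTop |g ω|] with B hB
      rw [truncation_eq_self hB]
      simp
  have := (Real.continuous_sqrt.tendsto _).comp h
  simpa [rms, Function.comp_def] using this

lemma rms_sub_integral_le {g : Ω → ℝ} (hg : MemLp g 2 P) :
    rms P (fun ω => g ω - ∫ ω, g ω ∂P) ≤ rms P g := by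
  refine Real.sqrt_le_sqrt ?_
  have h1 : ∫ ω, ‖g ω - ∫ ω, g ω ∂P‖ ^ 2 ∂P
      = ∫ ω, (‖g ω‖ ^ 2 - 2 * (∫ ω, g ω ∂P) * g ω + (∫ ω, g ω ∂P) ^ 2) ∂P := by
    congr 1
    ext ω
    simp only [Real.norm_eq_abs, sq_abs]
    ring
  have i1 := MemLp.integrable_norm_sq hg
  have i2 := (hg.integrable one_le_two).const_mul (2 * ∫ ω, g ω ∂P)
  have i12 : Integrable (fun ω => ‖g ω‖ ^ 2 - 2 * (∫ ω, g ω ∂P) * g ω) P := i1.sub i2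
  rw [h1, integral_add i12 (integrable_const _), integral_sub i1 i2, integral_const_mul]
  simp only [integral_const, probReal_univ, one_smul]
  nlinarith [sq_nonneg (∫ ω, g ω ∂P)]

variable [CompleteSpace E]

/-- Bounded `m`-dependent approximation of a linear functional of the process, with an arbitrarily
small long-run variance of the error. -/
lemma IsStronglyL2mApproximable.exists_bddMDependent
    (h : IsStronglyL2mApproximable P (causalProc δ f) δ f)
    (hmean : ∀ t, ∫ ω, causalProc δ f t ω ∂P = 0) (L : E →L[ℝ] ℝ) {ε : ℝ} (hε : 0 < ε) :
    ∃ (m : ℕ) (B : ℝ) (y : ℤ → Ω → ℝ), IsBddMDependent P δ m B y ∧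
      ∀ A : Finset ℤ, ∫ ω, (∑ t ∈ A, (L (causalProc δ f t ω) - y t ω)) ^ 2 ∂P ≤ ε * A.card := by
  have h' := h.toIsL2mApproximable
  set e : ℕ → ℝ := fun m => couplingError P (causalProc δ f) δ f 0 m with he
  have hes : Summable e := h'.summable_couplingError_zero
  have he0 : ∀ m, 0 ≤ e m := fun m => Real.sqrt_nonneg _
  set c := ‖L‖ with hc
  have hc0 : 0 ≤ c := norm_nonneg _
  -- The errors will have size `a = τ / (m + 1)` with covariance decay of total mass at most `m a +
  -- c ∑ e ≤ 1 + c ∑ e`. This choice makes the resulting bound `2 a (m a + c ∑ e)` at most `ε`.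
  set τ : ℝ := min 1 (ε / (2 * (1 + c * ∑' m, e m))) with hτ
  have hE0 : 0 ≤ c * ∑' m, e m := mul_nonneg hc0 (tsum_nonneg he0)
  have hτ0 : 0 < τ := lt_min one_pos (by positivity)
  -- The decay of `m` times the coupling error enters here: the approximation error must be small
  -- even after multiplication by `m`, since up to `m` lags of the error process have no better
  -- bound than its variance.
  obtain ⟨m, hm⟩ : ∃ m : ℕ, ((m : ℝ) + 1) * (c * e m) < τ / 2 := by
    have h1 : Tendsto (fun m : ℕ => c * ((m : ℝ) * e m + e m)) atTop (𝓝 (c * (0 + 0))) :=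
      ((h.tendsto_couplingError 0).add hes.tendsto_atTop_zero).const_mul c
    simp only [add_zero, mul_zero] at h1
    obtain ⟨m, hm⟩ := (h1.eventually (gt_mem_nhds (half_pos hτ0))).exists
    exact ⟨m, by linarith⟩
  obtain ⟨z, hz⟩ := h'.exists_spliced m
  set G : ℤ → Ω → ℝ := fun t ω => L (f (spliceSeq m (fun j => δ (t - j) ω) z)) with hG
  have hG2 : ∀ t, MemLp (G t) 2 P := fun t => L.comp_memLp' (hz t).1
  have hx2 : ∀ t, MemLp (fun ω => L (causalProc δ f t ω)) 2 P :=
    fun t => L.comp_memLp' (h'.memLp_causalProc t)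
  have hx0 : ∀ t, ∫ ω, L (causalProc δ f t ω) ∂P = 0 := fun t => by
    rw [L.integral_comp_comm ((h'.memLp_causalProc t).integrable one_le_two), hmean, map_zero]
  have hGm : ∀ t, Measurable[innovSigma δ (Set.Ioc (t - m) t)] (G t) := fun t =>
    L.measurable.comp (measurable_spliced_innovSigma h'.measurable_fun t m z)
  obtain ⟨B, hB⟩ : ∃ B : ℝ, rms P (fun ω => G 0 ω - truncation (G 0) B ω)
      < τ / (2 * ((m : ℝ) + 1)) :=
    ((tendsto_rms_sub_truncation (hG2 0)).eventually (gt_mem_nhds (by positivity))).exists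
  -- One truncation level serves all times, because `G t` is the same function of the past at every
  -- `t`.
  have hB' : ∀ t, rms P (fun ω => G t ω - truncation (G t) B ω)
      < τ / (2 * ((m : ℝ) + 1)) := by
    intro t
    refine lt_of_eq_of_lt ?_ hB
    have key : ∀ t, ∫ ω, ‖G t ω - truncation (G t) B ω‖ ^ 2 ∂P
        = ∫ x, ‖L (f (spliceSeq m x z))
          - truncation (fun x => L (f (spliceSeq m x z))) B x‖ ^ 2
            ∂(Measure.infinitePi fun _ : ℕ => P.map (δ 0)) := by
      intro t
      have hmm : Measurable fun x => L (f (spliceSeq m x z)) :=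
        L.measurable.comp (h'.measurable_fun.comp
          ((measurable_spliceSeq m).comp measurable_prodMk_right))
      rw [← h'.map_past t, integral_map (h'.measurable_past t).aemeasurable]
      · rfl
      · have : Measurable (truncation (fun x => L (f (spliceSeq m x z))) B) :=
          (measurable_id.indicator measurableSet_Ioc).comp hmm
        exact ((hmm.sub this).norm.pow_const 2).aestronglyMeasurable
    rw [rms, rms, key t, key 0]
  have hT2 : ∀ t, MemLp (truncation (G t) B) 2 P := fun t => (hG2 t).1.memLp_truncation
  set y : ℤ → Ω → ℝ := fun t ω => truncation (G t) B ω - ∫ ω, truncation (G t) B ω ∂P with hy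
  have hy2 : ∀ t, MemLp (y t) 2 P := fun t => (hT2 t).sub (memLp_const _)
  have hTm : ∀ t, Measurable[innovSigma δ (Set.Ioc (t - m) t)] (truncation (G t) B) := fun t =>
    (measurable_id.indicator measurableSet_Ioc).comp (hGm t)
  have hym : ∀ t, Measurable[innovSigma δ (Set.Ioc (t - m) t)] (y t) := fun t =>
    (measurable_id.sub_const _).comp (hTm t)
  have hy0 : ∀ t, ∫ ω, y t ω ∂P = 0 := fun t => by
    rw [hy, integral_sub ((hT2 t).integrable one_le_two) (integrable_const _)]
    simp
  set a : ℝ := τ / ((m : ℝ) + 1) with ha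
  have ha0 : 0 < a := by positivity
  have hDa : ∀ t, rms P (fun ω => L (causalProc δ f t ω) - y t ω) ≤ a := by
    intro t
    have h1 : (fun ω => L (causalProc δ f t ω) - y t ω)
        = fun ω => (L (causalProc δ f t ω) - truncation (G t) B ω)
          - ∫ ω, (L (causalProc δ f t ω) - truncation (G t) B ω) ∂P := by
      rw [integral_sub ((hx2 t).integrable one_le_two) ((hT2 t).integrable one_le_two), hx0]
      ext ω
      simp only [hy]
      ring
    rw [h1]
    refine (rms_sub_integral_le ((hx2 t).sub (hT2 t))).trans ?_
    have h2 : (fun ω => L (causalProc δ f t ω) - truncation (G t) B ω)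
        = fun ω => (L (causalProc δ f t ω) - G t ω) + (G t ω - truncation (G t) B ω) := by
      ext ω; ring
    have h3 : rms P (fun ω => L (causalProc δ f t ω) - G t ω) ≤ c * e m := by
      simp only [hG, ← map_sub]
      exact (rms_clm_le L ((h'.memLp_causalProc t).sub (hz t).1)).trans
        (mul_le_mul_of_nonneg_left (hz t).2 hc0)
    have h4 : c * e m ≤ τ / (2 * ((m : ℝ) + 1)) := by
      rw [le_div_iff₀ (by positivity)]
      nlinarith
    have h5 : a = τ / (2 * ((m : ℝ) + 1)) + τ / (2 * ((m : ℝ) + 1)) := by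
      rw [ha]; field_simp; norm_num
    rw [h5]
    change rms P (fun ω => L (causalProc δ f t ω) - truncation (G t) B ω) ≤ _
    rw [h2]
    exact (rms_add_le ((hx2 t).sub (hG2 t)) ((hG2 t).sub (hT2 t))).trans
      (add_le_add (h3.trans h4) (hB' t).le)
  refine ⟨m, |B| + |B|, y, ⟨hym, fun t ω => ?_, hy0⟩, fun A => ?_⟩
  · have h1 : ∀ ω, ‖truncation (G t) B ω‖ ≤ |B| := fun ω => abs_truncation_le_bound _ _ _
    have h2 := norm_integral_le_of_norm_le_const (μ := P) (ae_of_all _ h1)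
    simp only [probReal_univ, mul_one] at h2
    exact (abs_sub _ _).trans (add_le_add (h1 ω) h2)
  -- Two regimes for the error process. For `i < m` it is approximated by `0`, at cost `a`. For `i ≥
  -- m` the process `y` already depends on the last `i` innovations only, so the linear functional
  -- alone is approximated, at cost `c * e i`.
  set r : ℕ → ℝ := fun i => (if i < m then a else 0) + c * e i with hr
  have hite : HasSum (fun i : ℕ => if i < m then a else 0) (m * a) := by
    have : HasSum (fun i : ℕ => if i < m then a else 0)
        (∑ i ∈ Finset.range m, if i < m then a else 0) :=
      hasSum_sum_of_ne_finset_zero fun i hi => by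
        rw [Finset.mem_range] at hi; simp [hi]
    rwa [Finset.sum_congr rfl (fun i hi => if_pos (Finset.mem_range.1 hi)), Finset.sum_const,
      Finset.card_range, nsmul_eq_mul] at this
  have hrs : HasSum r (m * a + c * ∑' i, e i) := hite.add (hes.hasSum.mul_left c)
  have hmain := integral_norm_sum_sq_le_of_approx h'.measurable_innovation h'.iIndep_innovation
    (Z := fun t ω => L (causalProc δ f t ω) - y t ω) (a := a) (r := r)
    (fun t => ?_) (fun t => (hx2 t).sub (hy2 t)) (fun t => ?_) hDa hrs.summable (fun t i => ?_) A
  · simp only [Real.norm_eq_abs, sq_abs] at hmain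
    refine hmain.trans (mul_le_mul_of_nonneg_right ?_ (Nat.cast_nonneg _))
    rw [hrs.tsum_eq]
    have hma : (m : ℝ) * a ≤ τ := by
      rw [ha, mul_div_assoc', div_le_iff₀ (by positivity)]
      nlinarith
    have haτ : a ≤ τ := by
      rw [ha, div_le_iff₀ (by positivity)]
      nlinarith [(Nat.cast_nonneg m : (0 : ℝ) ≤ m)]
    have hτ1 : τ ≤ 1 := min_le_left _ _
    have hτ2 : τ * (2 * (1 + c * ∑' m, e m)) ≤ ε := by
      rw [← le_div_iff₀ (by positivity)]; exact min_le_right _ _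
    calc 2 * a * (m * a + c * ∑' i, e i) ≤ 2 * τ * (1 + c * ∑' i, e i) := by
          gcongr; exact hma.trans hτ1
      _ ≤ ε := by linarith
  · refine Measurable.sub (m := innovSigma δ (Set.Iic t)) ?_ ?_
    · exact L.measurable.comp (measurable_causalProc_innovSigma h'.measurable_fun t)
    · exact (hym t).mono (innovSigma_mono fun s hs => hs.2) le_rfl
  · rw [integral_sub ((hx2 t).integrable one_le_two) ((hy2 t).integrable one_le_two), hx0, hy0,
      sub_zero]
  · by_cases hi : i < m
    · refine ⟨fun _ => 0, @measurable_const _ _ _ (_) _, memLp_const _, ?_⟩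
      simp only [sub_zero, hr, hi, if_true]
      exact (hDa t).trans (le_add_of_nonneg_right (mul_nonneg hc0 (he0 i)))
    · obtain ⟨K, hKm, hK2, hKr⟩ := h'.exists_approx t i
      refine ⟨fun ω => L (K ω) - y t ω, ?_, (L.comp_memLp' hK2).sub (hy2 t), ?_⟩
      · refine Measurable.sub (m := innovSigma δ (Set.Ioc (t - i) t)) (L.measurable.comp hKm) ?_
        refine (hym t).mono (innovSigma_mono fun s hs => ?_) le_rfl
        simp only [Set.mem_Ioc] at hs ⊢
        omega
      · simp only [hr, hi, if_false, zero_add, sub_sub_sub_cancel_right]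
        simp_rw [← map_sub]
        exact (rms_clm_le L ((h'.memLp_causalProc t).sub hK2)).trans
          (mul_le_mul_of_nonneg_left hKr hc0)

end BoundedApproximation

/-! ### Gaussian approximation of characteristic functions of small variables. -/

section CharacteristicFunction

variable {Ω : Type*} [MeasurableSpace Ω] {P : Measure Ω}

/-- The value `E e^{iZ}` of the characteristic function of `Z` at one. -/
noncomputable def charExp (P : Measure Ω) (Z : Ω → ℝ) : ℂ := ∫ ω, Complex.exp (Z ω * Complex.I) ∂P

lemma norm_exp_ofReal_mul_I_sub_le (x y : ℝ) :
    ‖Complex.exp (x * Complex.I) - Complex.exp (y * Complex.I)‖ ≤ |x - y| := by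
  have h : Complex.exp (x * Complex.I) - Complex.exp (y * Complex.I)
      = Complex.exp (y * Complex.I) * (Complex.exp (Complex.I * ((x - y : ℝ) : ℂ)) - 1) := by
    rw [mul_sub, ← Complex.exp_add, mul_one]
    congr 2
    push_cast; ring
  rw [h, norm_mul, Complex.norm_exp_ofReal_mul_I, one_mul]
  exact Real.norm_exp_I_mul_ofReal_sub_one_le

lemma norm_exp_ofReal_mul_I_sub_taylor_le {x : ℝ} (hx : |x| ≤ 1) :
    ‖Complex.exp (x * Complex.I) - (1 + x * Complex.I - (x : ℂ) ^ 2 / 2)‖ ≤ |x| ^ 3 / 3 := by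
  have hn : ‖(x : ℂ) * Complex.I‖ = |x| := by simp
  have h := Complex.exp_bound' (x := (x : ℂ) * Complex.I) (n := 3) (by
    rw [hn]; norm_num; linarith)
  rw [hn] at h
  have h2 : ∑ m ∈ Finset.range 3, ((x : ℂ) * Complex.I) ^ m / (m.factorial : ℂ)
      = 1 + x * Complex.I - (x : ℂ) ^ 2 / 2 := by
    simp [Finset.sum_range_succ, mul_pow, Nat.factorial]
    ring
  rw [h2] at h
  refine h.trans (le_of_eq ?_)
  norm_num [Nat.factorial]
  ring

lemma aestronglyMeasurable_exp_mul_I {Z : Ω → ℝ} (hZ : AEStronglyMeasurable Z P) :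
    AEStronglyMeasurable (fun ω => Complex.exp (Z ω * Complex.I)) P :=
  Continuous.comp_aestronglyMeasurable (g := fun x : ℝ => Complex.exp (x * Complex.I))
    (by fun_prop) hZ

lemma norm_prod_sub_prod_le {ι : Type*} (s : Finset ι) (a c : ι → ℂ) (ha : ∀ i, ‖a i‖ ≤ 1)
    (hc : ∀ i, ‖c i‖ ≤ 1) : ‖∏ i ∈ s, a i - ∏ i ∈ s, c i‖ ≤ ∑ i ∈ s, ‖a i - c i‖ := by
  classical
  induction s using Finset.induction_on with
  | empty => simp
  | insert i s hi ih =>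
    rw [Finset.prod_insert hi, Finset.prod_insert hi, Finset.sum_insert hi]
    have h1 : a i * ∏ j ∈ s, a j - c i * ∏ j ∈ s, c j
        = (a i - c i) * ∏ j ∈ s, a j + c i * (∏ j ∈ s, a j - ∏ j ∈ s, c j) := by ring
    rw [h1]
    refine (norm_add_le _ _).trans (add_le_add ?_ ?_)
    · rw [norm_mul, norm_prod]
      exact mul_le_of_le_one_right (norm_nonneg _)
        (Finset.prod_le_one (fun _ _ => norm_nonneg _) fun j _ => ha j)
    · rw [norm_mul]
      exact (mul_le_of_le_one_left (norm_nonneg _) (hc i)).trans ih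

variable [IsProbabilityMeasure P]

lemma norm_charExp_le_one (Z : Ω → ℝ) : ‖charExp P Z‖ ≤ 1 := by
  refine (norm_integral_le_integral_norm _).trans ?_
  simp [Complex.norm_exp_ofReal_mul_I]

lemma integrable_exp_mul_I {Z : Ω → ℝ} (hZ : AEStronglyMeasurable Z P) :
    Integrable (fun ω => Complex.exp (Z ω * Complex.I)) P :=
  (integrable_const (1 : ℝ)).mono (aestronglyMeasurable_exp_mul_I hZ)
    (ae_of_all _ fun ω => by simp [Complex.norm_exp_ofReal_mul_I])

lemma norm_charExp_sub_le {Y Z : Ω → ℝ} (hY : MemLp Y 2 P) (hZ : MemLp Z 2 P) :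
    ‖charExp P Y - charExp P Z‖ ≤ rms P fun ω => Y ω - Z ω := by
  rw [charExp, charExp, ← integral_sub (integrable_exp_mul_I hY.1) (integrable_exp_mul_I hZ.1)]
  refine (norm_integral_le_integral_norm _).trans (le_trans ?_ (integral_norm_le_rms (hY.sub hZ)))
  refine integral_mono_of_nonneg (ae_of_all _ fun _ => norm_nonneg _)
    ((hY.sub hZ).integrable one_le_two).norm (ae_of_all _ fun ω => ?_)
  exact norm_exp_ofReal_mul_I_sub_le _ _

/-- Gaussian approximation of the characteristic function of a centered variable bounded by a
small constant. -/
lemma norm_charExp_sub_gaussian_le {Z : Ω → ℝ} (hZm : AEStronglyMeasurable Z P) {M : ℝ}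
    (hM : M ≤ 1) (hZ : ∀ ω, |Z ω| ≤ M) (h0 : ∫ ω, Z ω ∂P = 0) :
    ‖charExp P Z - Complex.exp ((-(∫ ω, Z ω ^ 2 ∂P) / 2 : ℝ))‖ ≤ M * ∫ ω, Z ω ^ 2 ∂P := by
  set s := ∫ ω, Z ω ^ 2 ∂P with hs
  have hM0 : 0 ≤ M := by
    obtain ⟨ω⟩ : Nonempty Ω := P.nonempty_of_neZero
    exact (abs_nonneg _).trans (hZ ω)
  have hZ2 : MemLp Z 2 P := MemLp.of_bound hZm M (ae_of_all _ hZ)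
  have hs0 : 0 ≤ s := integral_nonneg fun _ => sq_nonneg _
  -- `M ≤ 1` turns `s ≤ M²` into `s ≤ M`. This keeps `s / 2` within the range of the expansion of
  -- the exponential and turns its remainder `s² / 4` into `M s / 4`.
  have hsM : s ≤ M := by
    have : s ≤ ∫ _, M ^ 2 ∂P := integral_mono hZ2.integrable_sq (integrable_const _) fun ω => by
      simpa [sq_abs] using pow_le_pow_left₀ (abs_nonneg _) (hZ ω) 2
    simp only [integral_const, probReal_univ, one_smul] at this
    nlinarith
  have h1 : ‖charExp P Z - (1 - s / 2 : ℝ)‖ ≤ M * s / 3 := by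
    have i1 : Integrable (fun ω => (Z ω : ℂ)) P := (hZ2.integrable one_le_two).ofReal
    have i2 : Integrable (fun ω => (Z ω : ℂ) ^ 2) P := by
      simpa using (hZ2.integrable_sq.ofReal (𝕜 := ℂ))
    have e1 : ∫ ω, (1 + Z ω * Complex.I - (Z ω : ℂ) ^ 2 / 2) ∂P = ((1 - s / 2 : ℝ) : ℂ) := by
      have i3 : Integrable (fun ω => 1 + Z ω * Complex.I) P :=
        (integrable_const _).add (i1.mul_const _)
      rw [integral_sub i3 (i2.div_const _), integral_add (integrable_const _) (i1.mul_const _),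
        integral_mul_const, integral_div, integral_complex_ofReal, h0]
      have : ∫ ω, (Z ω : ℂ) ^ 2 ∂P = (s : ℂ) := by
        rw [hs, ← integral_complex_ofReal]; simp
      rw [this]
      simp
    have i4 : Integrable (fun ω => 1 + Z ω * Complex.I - (Z ω : ℂ) ^ 2 / 2) P :=
      ((integrable_const _).add (i1.mul_const _)).sub (i2.div_const _)
    rw [← e1, charExp, ← integral_sub (integrable_exp_mul_I hZm) i4]
    refine (norm_integral_le_integral_norm _).trans ?_
    have : M * s / 3 = ∫ ω, M * Z ω ^ 2 / 3 ∂P := by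
      rw [integral_div, integral_const_mul]
    rw [this]
    refine integral_mono_of_nonneg (ae_of_all _ fun _ => norm_nonneg _)
      ((hZ2.integrable_sq.const_mul M).div_const 3) (ae_of_all _ fun ω => ?_)
    refine (norm_exp_ofReal_mul_I_sub_taylor_le ((hZ ω).trans hM)).trans ?_
    have h3 : |Z ω| ^ 3 = |Z ω| * Z ω ^ 2 := by rw [pow_succ', sq_abs]
    dsimp only
    rw [h3]
    have := mul_le_mul_of_nonneg_right (hZ ω) (sq_nonneg (Z ω))
    linarith
  have h2 : ‖((1 - s / 2 : ℝ) : ℂ) - Complex.exp ((-s / 2 : ℝ))‖ ≤ M * s / 4 := by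
    rw [← Complex.ofReal_exp, ← Complex.ofReal_sub, Complex.norm_real, norm_sub_rev]
    have := Real.norm_exp_sub_one_sub_id_le (x := -s / 2) (by
      rw [Real.norm_eq_abs, abs_le]; constructor <;> linarith)
    rw [show Real.exp (-s / 2) - (1 - s / 2) = Real.exp (-s / 2) - 1 - -s / 2 by ring]
    refine this.trans ?_
    rw [Real.norm_eq_abs, sq_abs]
    nlinarith
  calc _ = ‖(charExp P Z - ((1 - s / 2 : ℝ) : ℂ))
        + (((1 - s / 2 : ℝ) : ℂ) - Complex.exp ((-s / 2 : ℝ)))‖ := by rw [sub_add_sub_cancel]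
    _ ≤ M * s / 3 + M * s / 4 := (norm_add_le _ _).trans (add_le_add h1 h2)
    _ ≤ M * s := by nlinarith [mul_nonneg hM0 hs0]

/-- Gaussian approximation for a product of characteristic functions of small variables. -/
lemma norm_prod_charExp_sub_gaussian_le {ι : Type*} (A : Finset ι) {Z : ι → Ω → ℝ}
    (hZm : ∀ i, AEStronglyMeasurable (Z i) P) {M : ℝ}
    (hM : M ≤ 1) (hZ : ∀ i ω, |Z i ω| ≤ M) (h0 : ∀ i, ∫ ω, Z i ω ∂P = 0) :
    ‖∏ i ∈ A, charExp P (Z i) - Complex.exp ((-(∑ i ∈ A, ∫ ω, Z i ω ^ 2 ∂P) / 2 : ℝ))‖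
      ≤ M * ∑ i ∈ A, ∫ ω, Z i ω ^ 2 ∂P := by
  have h : Complex.exp ((-(∑ i ∈ A, ∫ ω, Z i ω ^ 2 ∂P) / 2 : ℝ))
      = ∏ i ∈ A, Complex.exp ((-(∫ ω, Z i ω ^ 2 ∂P) / 2 : ℝ)) := by
    rw [← Complex.exp_sum, ← Complex.ofReal_sum, ← Finset.sum_neg_distrib, Finset.sum_div]
  rw [h, Finset.mul_sum]
  refine (norm_prod_sub_prod_le A _ _ (fun i => norm_charExp_le_one _) fun i => ?_).trans
    (Finset.sum_le_sum fun i _ => norm_charExp_sub_gaussian_le (hZm i) hM (hZ i) (h0 i))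
  rw [← Complex.ofReal_exp, Complex.norm_real, Real.norm_of_nonneg (Real.exp_pos _).le]
  refine Real.exp_le_one_iff.2 ?_
  have : 0 ≤ ∫ ω, Z i ω ^ 2 ∂P := integral_nonneg fun _ => sq_nonneg _
  linarith

end CharacteristicFunction

/-! ### The bootstrap mean in terms of block sums, for fixed data. -/

section BlockSums

variable {E : Type*} [NormedAddCommGroup E] [InnerProductSpace ℝ E]

/-- The block sum `x_{i+1} + … + x_{i+b}`. -/
def blockSum (b : ℕ) (x : ℤ → E) (i : ℤ) : E := ∑ j ∈ Finset.range b, x (i + 1 + j)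

lemma blockSum_eq_sum_Ioc (b : ℕ) (x : ℤ → E) (i : ℤ) :
    blockSum b x i = ∑ t ∈ Finset.Ioc i (i + b), x t := by
  have h : Finset.Ioc i (i + b) = (Finset.range b).image fun j : ℕ => i + 1 + j := by
    ext t
    simp only [Finset.mem_Ioc, Finset.mem_image, Finset.mem_range]
    constructor
    · rintro ⟨h1, h2⟩
      exact ⟨(t - i - 1).toNat, by omega, by omega⟩
    · rintro ⟨j, hj, rfl⟩
      omega
  rw [h, Finset.sum_image]
  · rfl
  · intro a _ c _ hac; simpa using hac

/-- The average of the `N` block sums. -/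
noncomputable def blockAvg (k b : ℕ) (x : ℤ → E) : E :=
  (numBlocks k b : ℝ)⁻¹ • ∑ i ∈ Finset.range (numBlocks k b), blockSum b x i

/-- The variance of the bootstrap distribution, `(bN)⁻¹ ∑ ‖S_i - S̄‖²`. -/
noncomputable def bootVar (k b : ℕ) (x : ℤ → E) : ℝ :=
  ((b : ℝ) * numBlocks k b)⁻¹ *
    ∑ i ∈ Finset.range (numBlocks k b), ‖blockSum b x i - blockAvg k b x‖ ^ 2

lemma bootVar_nonneg (k b : ℕ) (x : ℤ → E) : 0 ≤ bootVar k b x := by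
  unfold bootVar; positivity

lemma numBlocks_pos (k b : ℕ) : (0 : ℝ) < numBlocks k b := by
  unfold numBlocks; positivity

lemma sum_blockSum_sub_blockAvg (k b : ℕ) (x : ℤ → E) :
    ∑ i ∈ Finset.range (numBlocks k b), (blockSum b x i - blockAvg k b x) = 0 := by
  rw [Finset.sum_sub_distrib, Finset.sum_const, Finset.card_range, blockAvg,
    ← Nat.cast_smul_eq_nsmul ℝ,
    smul_inv_smul₀ (numBlocks_pos k b).ne', sub_self]

/-- Separates the effect of centring, later shown to be of order `b / N` in mean, from the average
squared block sum to which the law of large numbers applies. -/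
lemma bootVar_eq (k b : ℕ) (x : ℤ → E) :
    bootVar k b x = ((b : ℝ) * numBlocks k b)⁻¹ *
      ∑ i ∈ Finset.range (numBlocks k b), ‖blockSum b x i‖ ^ 2
      - (b : ℝ)⁻¹ * ‖blockAvg k b x‖ ^ 2 := by
  have hN := numBlocks_pos k b
  have h1 : ∑ i ∈ Finset.range (numBlocks k b), ‖blockSum b x i‖ ^ 2
      = ∑ i ∈ Finset.range (numBlocks k b), ‖blockSum b x i - blockAvg k b x‖ ^ 2
        + numBlocks k b * ‖blockAvg k b x‖ ^ 2 := by
    have h2 : ∀ i : ℕ, ‖blockSum b x i‖ ^ 2 = ‖blockSum b x i - blockAvg k b x‖ ^ 2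
        + 2 * inner ℝ (blockSum b x i - blockAvg k b x) (blockAvg k b x)
        + ‖blockAvg k b x‖ ^ 2 := fun i => by
      rw [← norm_add_sq_real, sub_add_cancel]
    simp_rw [h2]
    rw [Finset.sum_add_distrib, Finset.sum_add_distrib, ← Finset.mul_sum, ← sum_inner,
      sum_blockSum_sub_blockAvg]
    simp
  rw [h1, bootVar, mul_add, mul_inv, mul_assoc, mul_assoc, inv_mul_cancel_left₀ hN.ne']
  ring

lemma bootVar_le (k b : ℕ) (x : ℤ → E) :
    bootVar k b x ≤ ((b : ℝ) * numBlocks k b)⁻¹ *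
      ∑ i ∈ Finset.range (numBlocks k b), ‖blockSum b x i‖ ^ 2 := by
  rw [bootVar_eq]
  have : 0 ≤ (b : ℝ)⁻¹ * ‖blockAvg k b x‖ ^ 2 := by positivity
  linarith

variable {F : Type*} [NormedAddCommGroup F] [InnerProductSpace ℝ F]

lemma blockSum_clm (L : E →L[ℝ] F) (b : ℕ) (x : ℤ → E) (i : ℤ) :
    blockSum b (fun t => L (x t)) i = L (blockSum b x i) := by
  simp [blockSum]

lemma blockAvg_clm (L : E →L[ℝ] F) (k b : ℕ) (x : ℤ → E) :
    blockAvg k b (fun t => L (x t)) = L (blockAvg k b x) := by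
  simp [blockAvg, blockSum_clm]

lemma blockSum_sub (b : ℕ) (x y : ℤ → E) (i : ℤ) :
    blockSum b (fun t => x t - y t) i = blockSum b x i - blockSum b y i := by
  simp [blockSum]

lemma blockAvg_sub (k b : ℕ) (x y : ℤ → E) :
    blockAvg k b (fun t => x t - y t) = blockAvg k b x - blockAvg k b y := by
  simp [blockAvg, blockSum_sub, smul_sub]

lemma bootMean_eq (k b : ℕ) (x : ℤ → E) (I : Fin k → Fin (numBlocks k b)) :
    bootMean k b x I = ((k * b : ℕ) : ℝ)⁻¹ • ∑ l, blockSum b x ((I l : ℕ) : ℤ) := by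
  rw [bootMean]
  congr 1
  rw [← finProdFinEquiv.sum_comp, Fintype.sum_prod_type]
  refine Finset.sum_congr rfl fun l _ => ?_
  rw [blockSum, Finset.sum_range]
  refine Finset.sum_congr rfl fun j _ => ?_
  have h := finProdFinEquiv.symm_apply_apply (l, j)
  rw [finProdFinEquiv_symm_apply, Prod.mk.injEq] at h
  rw [pseudoObs, h.1, h.2]

lemma integral_uniformOfFintype_numBlocks {G : Type*} [NormedAddCommGroup G] [NormedSpace ℝ G]
    [CompleteSpace G] (k b : ℕ) (g : ℕ → G) :
    ∫ i, g (i : ℕ) ∂(PMF.uniformOfFintype (Fin (numBlocks k b))).toMeasure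
      = (numBlocks k b : ℝ)⁻¹ • ∑ i ∈ Finset.range (numBlocks k b), g i := by
  rw [PMF.integral_eq_sum, Finset.sum_range, Finset.smul_sum]
  simp only [PMF.uniformOfFintype_apply, Fintype.card_fin, ENNReal.toReal_inv,
    ENNReal.toReal_natCast]

lemma integral_blockIndexLaw_eval {G : Type*} [NormedAddCommGroup G] [NormedSpace ℝ G]
    [CompleteSpace G] (k b : ℕ) (l : Fin k) (g : ℕ → G) :
    ∫ I, g (I l : ℕ) ∂(blockIndexLaw k b)
      = (numBlocks k b : ℝ)⁻¹ • ∑ i ∈ Finset.range (numBlocks k b), g i := by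
  have h := integral_map (μ := blockIndexLaw k b) (φ := fun I => I l)
    (f := fun i : Fin (numBlocks k b) => g i) (measurable_pi_apply l).aemeasurable
    .of_discrete
  rw [← h, ← integral_uniformOfFintype_numBlocks, blockIndexLaw]
  congr 1
  exact (measurePreserving_eval (fun _ : Fin k =>
    (PMF.uniformOfFintype (Fin (numBlocks k b))).toMeasure) l).map_eq

lemma integrable_blockIndexLaw {G : Type*} [NormedAddCommGroup G] (k b : ℕ)
    (g : (Fin k → Fin (numBlocks k b)) → G) : Integrable g (blockIndexLaw k b) :=
  .of_finite

lemma memLp_blockIndexLaw {G : Type*} [NormedAddCommGroup G] (k b : ℕ)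
    (g : (Fin k → Fin (numBlocks k b)) → G) : MemLp g 2 (blockIndexLaw k b) :=
  .of_discrete

variable [CompleteSpace E]

lemma bootCentered_eq (k b : ℕ) (x : ℤ → E) (I : Fin k → Fin (numBlocks k b)) :
    bootCentered k b x I
      = ((k * b : ℕ) : ℝ)⁻¹ • ∑ l, (blockSum b x ((I l : ℕ) : ℤ) - blockAvg k b x) := by
  rw [bootCentered]
  simp_rw [bootMean_eq]
  rw [integral_smul, integral_finsetSum _ fun l _ => integrable_blockIndexLaw k b _]
  simp_rw [integral_blockIndexLaw_eval k b _ fun i : ℕ => blockSum b x (i : ℤ)]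
  rw [← smul_sub, ← Finset.sum_sub_distrib]
  rfl

lemma bootCentered_clm [CompleteSpace F] (L : E →L[ℝ] F) (k b : ℕ) (x : ℤ → E)
    (I : Fin k → Fin (numBlocks k b)) :
    bootCentered k b (fun t => L (x t)) I = L (bootCentered k b x I) := by
  simp [bootCentered_eq, blockSum_clm, blockAvg_clm]

lemma bootCentered_sub (k b : ℕ) (x y : ℤ → E) (I : Fin k → Fin (numBlocks k b)) :
    bootCentered k b (fun t => x t - y t) I = bootCentered k b x I - bootCentered k b y I := by
  simp only [bootCentered_eq, blockSum_sub, blockAvg_sub, ← smul_sub, ← Finset.sum_sub_distrib]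
  congr 1
  exact Finset.sum_congr rfl fun l _ => by abel

/-- The second moment of the scaled bootstrap distribution. -/
lemma integral_norm_sq_bootCentered {k b : ℕ} (hk : 0 < k) (hb : 0 < b) (x : ℤ → E) :
    ∫ I, ‖Real.sqrt ((k * b : ℕ) : ℝ) • bootCentered k b x I‖ ^ 2 ∂(blockIndexLaw k b)
      = bootVar k b x := by
  set z : ℕ → E := fun i => blockSum b x i - blockAvg k b x with hz
  have hpair : ∀ l l' : Fin k, l ≠ l' →
      ∫ I, inner ℝ (z (I l)) (z (I l')) ∂(blockIndexLaw k b) = 0 := by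
    intro l l' hl
    have hind : IndepFun (fun I : Fin k → Fin (numBlocks k b) => I l) (fun I => I l')
        (blockIndexLaw k b) :=
      (iIndepFun_pi (μ := fun _ : Fin k => (PMF.uniformOfFintype (Fin (numBlocks k b))).toMeasure)
        (X := fun _ => id) fun _ => aemeasurable_id).indepFun hl
    have h := hind.integral_bilin_comp_comp (f := fun i : Fin (numBlocks k b) => z i)
      (g := fun i : Fin (numBlocks k b) => z i)
      (measurable_pi_apply l).aemeasurable (measurable_pi_apply l').aemeasurable
      .of_finite .of_finite (innerSL ℝ)
    have h0 : ∫ I, z (I l) ∂(blockIndexLaw k b) = 0 := by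
      rw [integral_blockIndexLaw_eval, hz, sum_blockSum_sub_blockAvg, smul_zero]
    rw [h0, map_zero, zero_apply] at h
    exact h
  have h1 : ∫ I, ‖∑ l, z (I l)‖ ^ 2 ∂(blockIndexLaw k b)
      = k * ((numBlocks k b : ℝ)⁻¹ * ∑ i ∈ Finset.range (numBlocks k b), ‖z i‖ ^ 2) := by
    simp_rw [← real_inner_self_eq_norm_sq (∑ l, z _), sum_inner, inner_sum]
    rw [integral_finsetSum _ fun l _ => integrable_blockIndexLaw k b _]
    simp_rw [integral_finsetSum _ fun l _ => integrable_blockIndexLaw k b _]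
    have h2 : ∀ l : Fin k, ∑ l', ∫ I, inner ℝ (z (I l)) (z (I l')) ∂(blockIndexLaw k b)
        = (numBlocks k b : ℝ)⁻¹ * ∑ i ∈ Finset.range (numBlocks k b), ‖z i‖ ^ 2 := by
      intro l
      rw [Finset.sum_eq_single l (fun l' _ hl => hpair l l' hl.symm) (by simp)]
      simp_rw [real_inner_self_eq_norm_sq]
      exact integral_blockIndexLaw_eval k b l fun i => ‖z i‖ ^ 2
    simp [h2]
  have hn : (0 : ℝ) < k * b := by positivity
  simp_rw [bootCentered_eq, smul_smul, norm_smul, mul_pow]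
  rw [integral_const_mul]
  change _ * ∫ I, ‖∑ l, z (I l)‖ ^ 2 ∂(blockIndexLaw k b) = _
  rw [h1, bootVar]
  simp only [Nat.cast_mul, Real.norm_eq_abs, sq_abs, mul_pow]
  rw [Real.sq_sqrt hn.le]
  field_simp
  rfl

/-- The block indices are i.i.d., so the characteristic function factors over the `k` drawn blocks,
with equal factors. -/
lemma charExp_bootCentered {k b : ℕ} (x : ℤ → ℝ) (c : ℝ) :
    charExp (blockIndexLaw k b) (fun I => c * bootCentered k b x I)
      = ∏ _l : Fin k, charExp (PMF.uniformOfFintype (Fin (numBlocks k b))).toMeasure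
        fun i => c * (((k * b : ℕ) : ℝ)⁻¹ * (blockSum b x ((i : ℕ) : ℤ) - blockAvg k b x)) := by
  unfold charExp
  rw [blockIndexLaw, ← integral_fintype_prod_eq_prod]
  congr 1
  ext I
  dsimp only
  rw [← Complex.exp_sum, bootCentered_eq]
  congr 1
  rw [← Finset.sum_mul]
  congr 1
  rw [smul_eq_mul, Finset.mul_sum, Finset.mul_sum]
  push_cast
  rfl

/-- Gaussian approximation of the bootstrap characteristic function for bounded data. -/
lemma norm_charExp_bootCentered_sub_gaussian_le {k b : ℕ} (hk : 0 < k) (hb : 0 < b) {x : ℤ → ℝ}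
    {B : ℝ} (hx : ∀ t, |x t| ≤ B) (hB : 2 * B * (b / Real.sqrt ((k * b : ℕ) : ℝ)) ≤ 1) :
    ‖charExp (blockIndexLaw k b)
        (fun I => Real.sqrt ((k * b : ℕ) : ℝ) • bootCentered k b x I)
      - Complex.exp ((-(bootVar k b x) / 2 : ℝ))‖
      ≤ 2 * B * (b / Real.sqrt ((k * b : ℕ) : ℝ)) * bootVar k b x := by
  simp only [smul_eq_mul]
  rw [charExp_bootCentered]
  set n : ℝ := ((k * b : ℕ) : ℝ) with hn
  have hn0 : 0 < n := by rw [hn]; positivity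
  have hN := numBlocks_pos k b
  set z : ℕ → ℝ := fun i => Real.sqrt n * (n⁻¹ * (blockSum b x i - blockAvg k b x)) with hz
  have hS : ∀ i : ℕ, |blockSum b x i| ≤ b * B := fun i => by
    refine (Finset.abs_sum_le_sum_abs _ _).trans ?_
    simpa using Finset.sum_le_card_nsmul (Finset.range b) (fun j => |x (i + 1 + j)|) B
      fun j _ => hx _
  have hA : |blockAvg k b x| ≤ b * B := by
    rw [blockAvg, smul_eq_mul, abs_mul, abs_inv, abs_of_pos hN, inv_mul_le_iff₀ hN]
    refine (Finset.abs_sum_le_sum_abs _ _).trans ?_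
    simpa using Finset.sum_le_card_nsmul (Finset.range (numBlocks k b))
      (fun j => |blockSum b x j|) (b * B) fun j _ => hS j
  have hzb : ∀ i, |z i| ≤ 2 * B * (b / Real.sqrt n) := fun i => by
    have h1 : z i = (blockSum b x i - blockAvg k b x) / Real.sqrt n := by
      rw [hz]
      dsimp only
      rw [← mul_assoc, div_eq_inv_mul]
      congr 1
      rw [← div_eq_mul_inv, Real.sqrt_div_self', one_div]
    rw [h1, abs_div, abs_of_nonneg (Real.sqrt_nonneg n), ← mul_div_assoc]
    gcongr
    refine (abs_sub _ _).trans ((add_le_add (hS i) hA).trans_eq ?_)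
    ring
  have hz0 : ∫ i, z (i : ℕ) ∂(PMF.uniformOfFintype (Fin (numBlocks k b))).toMeasure = 0 := by
    rw [integral_uniformOfFintype_numBlocks, hz, ← Finset.mul_sum, ← Finset.mul_sum,
      sum_blockSum_sub_blockAvg]
    simp
  have hs : ∑ _l : Fin k,
      ∫ i, z (i : ℕ) ^ 2 ∂(PMF.uniformOfFintype (Fin (numBlocks k b))).toMeasure
        = bootVar k b x := by
    rw [integral_uniformOfFintype_numBlocks k b fun i => z i ^ 2, bootVar]
    simp only [hz, mul_pow, Real.norm_eq_abs, sq_abs, Finset.sum_const, Finset.card_univ,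
      Fintype.card_fin, nsmul_eq_mul, smul_eq_mul, Real.sq_sqrt hn0.le]
    rw [← Finset.mul_sum, ← Finset.mul_sum, hn]
    push_cast
    field_simp
  have h := norm_prod_charExp_sub_gaussian_le (Finset.univ : Finset (Fin k))
    (P := (PMF.uniformOfFintype (Fin (numBlocks k b))).toMeasure)
    (Z := fun _ i => z (i : ℕ)) (fun _ => .of_discrete)
    hB (fun _ i => hzb i) fun _ => hz0
  rw [hs] at h
  exact h

/-- The bootstrap mean is linear in the data, so for the same indices the two variables differ by
the bootstrap of `x - y`, whose second moment is its `bootVar`. This transfers the limit theorem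
from bounded data to general data. -/
lemma norm_charExp_bootCentered_sub_le {k b : ℕ} (hk : 0 < k) (hb : 0 < b) (x y : ℤ → ℝ) :
    ‖charExp (blockIndexLaw k b)
        (fun I => Real.sqrt ((k * b : ℕ) : ℝ) • bootCentered k b x I)
      - charExp (blockIndexLaw k b)
        (fun I => Real.sqrt ((k * b : ℕ) : ℝ) • bootCentered k b y I)‖
      ≤ Real.sqrt (bootVar k b fun t => x t - y t) := by
  refine (norm_charExp_sub_le (memLp_blockIndexLaw k b _) (memLp_blockIndexLaw k b _)).trans
    (le_of_eq ?_)
  simp_rw [← smul_sub, ← bootCentered_sub]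
  rw [rms, integral_norm_sq_bootCentered hk hb]

end BlockSums

/-! ### Growth of the number of blocks. -/

section BlockLengths

variable {k b : ℕ → ℕ}

lemma eventually_pos_of_tendsto_mul (hn : Tendsto (fun j => k j * b j) atTop atTop) :
    ∀ᶠ j in atTop, 0 < k j ∧ 0 < b j := by
  filter_upwards [hn.eventually_gt_atTop 0] with j hj
  exact ⟨Nat.pos_of_mul_pos_right hj, Nat.pos_of_mul_pos_left hj⟩

/-- Once `2 b² / n < 1` there are at least two blocks, and then `N ≥ n / 2`, so `b² / N` is at most
twice `(b / √n)²`. -/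
lemma tendsto_sq_div_numBlocks (hn : Tendsto (fun j => k j * b j) atTop atTop)
    (hbn : Tendsto (fun j => (b j : ℝ) / Real.sqrt ((k j * b j : ℕ) : ℝ)) atTop (𝓝 0)) :
    Tendsto (fun j => (b j : ℝ) ^ 2 / numBlocks (k j) (b j)) atTop (𝓝 0) := by
  have h2 : Tendsto (fun j => 2 * ((b j : ℝ) / Real.sqrt ((k j * b j : ℕ) : ℝ)) ^ 2)
      atTop (𝓝 0) := by
    simpa using (hbn.pow 2).const_mul 2
  refine squeeze_zero' (Eventually.of_forall fun j => by positivity) ?_ h2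
  filter_upwards [eventually_pos_of_tendsto_mul hn, h2.eventually (gt_mem_nhds one_pos)]
    with j ⟨hk, hb⟩ hj
  rw [div_pow, Real.sq_sqrt (Nat.cast_nonneg _)] at hj ⊢
  have hk' : (0 : ℝ) < k j := by exact_mod_cast hk
  have hb' : (1 : ℝ) ≤ b j := by exact_mod_cast hb
  have hk2 : 2 ≤ k j := by
    have : (2 : ℝ) * b j < k j := by
      rw [← mul_div_assoc, div_lt_one (by positivity)] at hj
      push_cast at hj
      nlinarith
    have h3 : (1 : ℝ) < k j := by nlinarith
    exact_mod_cast h3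
  have hN : ((k j * b j : ℕ) : ℝ) / 2 ≤ numBlocks (k j) (b j) := by
    have h4 : k j * b j ≤ 2 * numBlocks (k j) (b j) := by
      unfold numBlocks
      obtain ⟨l, hl⟩ := Nat.exists_eq_add_of_le hk2
      rw [hl]
      have : (2 + l) * b j - b j = (1 + l) * b j := by
        rw [show 2 + l = (1 + l) + 1 by ring, Nat.succ_mul, Nat.add_sub_cancel]
      rw [this]
      nlinarith
    have : ((k j * b j : ℕ) : ℝ) ≤ 2 * numBlocks (k j) (b j) := by exact_mod_cast h4
    linarith
  calc (b j : ℝ) ^ 2 / numBlocks (k j) (b j) ≤ (b j : ℝ) ^ 2 / (((k j * b j : ℕ) : ℝ) / 2) := by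
        gcongr
    _ = _ := by rw [div_div_eq_mul_div]; ring

lemma tendsto_div_numBlocks (hn : Tendsto (fun j => k j * b j) atTop atTop)
    (hbn : Tendsto (fun j => (b j : ℝ) / Real.sqrt ((k j * b j : ℕ) : ℝ)) atTop (𝓝 0)) :
    Tendsto (fun j => (b j : ℝ) / numBlocks (k j) (b j)) atTop (𝓝 0) := by
  refine squeeze_zero' (Eventually.of_forall fun j => by positivity) ?_
    (tendsto_sq_div_numBlocks hn hbn)
  filter_upwards [eventually_pos_of_tendsto_mul hn] with j hj
  have hb' : (1 : ℝ) ≤ b j := by exact_mod_cast hj.2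
  gcongr
  nlinarith

end BlockLengths

/-! ### Second moments of block sums and of their average. -/

section BlockMoments

variable {Ω E : Type*} [MeasurableSpace Ω] [NormedAddCommGroup E] [InnerProductSpace ℝ E]
  {P : Measure Ω}

lemma rms_sum_le {ι : Type*} (A : Finset ι) {Z : ι → Ω → E} (hZ : ∀ i, MemLp (Z i) 2 P) :
    rms P (fun ω => ∑ i ∈ A, Z i ω) ≤ ∑ i ∈ A, rms P (Z i) := by
  classical
  induction A using Finset.induction_on with
  | empty => simp [rms]
  | insert i s hi ih =>
    simp only [Finset.sum_insert hi]
    exact (rms_add_le (hZ i) (memLp_finsetSum s fun j _ => hZ j)).trans (by gcongr)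

variable {Z : ℤ → Ω → E}

lemma memLp_blockSum (hZ : ∀ t, MemLp (Z t) 2 P) (b : ℕ) (i : ℤ) :
    MemLp (fun ω => blockSum b (fun t => Z t ω) i) 2 P :=
  memLp_finsetSum _ fun _ _ => hZ _

lemma memLp_blockAvg (hZ : ∀ t, MemLp (Z t) 2 P) (k b : ℕ) :
    MemLp (fun ω => blockAvg k b (fun t => Z t ω)) 2 P :=
  have h : MemLp (fun ω => ∑ i ∈ Finset.range (numBlocks k b), blockSum b (fun t => Z t ω) i) 2 P :=
    memLp_finsetSum _ fun i _ => memLp_blockSum hZ b i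
  h.const_smul (numBlocks k b : ℝ)⁻¹

lemma integrable_bootVar (hZ : ∀ t, MemLp (Z t) 2 P) (k b : ℕ) :
    Integrable (fun ω => bootVar k b (fun t => Z t ω)) P :=
  have h : Integrable (fun ω => ∑ i ∈ Finset.range (numBlocks k b),
      ‖blockSum b (fun t => Z t ω) i - blockAvg k b (fun t => Z t ω)‖ ^ 2) P :=
    integrable_finsetSum _ fun i _ => MemLp.integrable_norm_sq
      ((memLp_blockSum hZ b i).sub (memLp_blockAvg hZ k b))
  h.const_mul _

variable {κ : ℝ}

lemma nonneg_of_integral_sum_sq_le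
    (hκ : ∀ A : Finset ℤ, ∫ ω, ‖∑ t ∈ A, Z t ω‖ ^ 2 ∂P ≤ κ * A.card) :
    0 ≤ κ := by
  have := (integral_nonneg fun ω => by positivity).trans (hκ {0})
  simpa using this

lemma integral_norm_sq_blockSum_le
    (hκ : ∀ A : Finset ℤ, ∫ ω, ‖∑ t ∈ A, Z t ω‖ ^ 2 ∂P ≤ κ * A.card) (b : ℕ) (i : ℤ) :
    ∫ ω, ‖blockSum b (fun t => Z t ω) i‖ ^ 2 ∂P ≤ κ * b := by
  simp_rw [blockSum_eq_sum_Ioc]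
  simpa using hκ (Finset.Ioc i (i + b))

lemma rms_blockSum_le
    (hκ : ∀ A : Finset ℤ, ∫ ω, ‖∑ t ∈ A, Z t ω‖ ^ 2 ∂P ≤ κ * A.card) (b : ℕ) (i : ℤ) :
    rms P (fun ω => blockSum b (fun t => Z t ω) i) ≤ Real.sqrt κ * Real.sqrt b := by
  rw [← Real.sqrt_mul (nonneg_of_integral_sum_sq_le hκ)]
  exact rms_le_sqrt (integral_norm_sq_blockSum_le hκ b i)

lemma integral_bootVar_le
    (hκ : ∀ A : Finset ℤ, ∫ ω, ‖∑ t ∈ A, Z t ω‖ ^ 2 ∂P ≤ κ * A.card)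
    (hZ : ∀ t, MemLp (Z t) 2 P) {b : ℕ} (hb : 0 < b) (k : ℕ) :
    ∫ ω, bootVar k b (fun t => Z t ω) ∂P ≤ κ := by
  have hN := numBlocks_pos k b
  have hb' : (0 : ℝ) < b := by exact_mod_cast hb
  have hi : ∀ i ∈ Finset.range (numBlocks k b),
      Integrable (fun ω => ‖blockSum b (fun t => Z t ω) (i : ℤ)‖ ^ 2) P := fun i _ =>
    MemLp.integrable_norm_sq (memLp_blockSum hZ b i)
  calc ∫ ω, bootVar k b (fun t => Z t ω) ∂P
      ≤ ∫ ω, ((b : ℝ) * numBlocks k b)⁻¹ *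
        ∑ i ∈ Finset.range (numBlocks k b), ‖blockSum b (fun t => Z t ω) i‖ ^ 2 ∂P :=
        integral_mono (integrable_bootVar hZ k b) ((integrable_finsetSum _ hi).const_mul _)
          fun ω => bootVar_le k b _
    _ = ((b : ℝ) * numBlocks k b)⁻¹ * ∑ i ∈ Finset.range (numBlocks k b),
        ∫ ω, ‖blockSum b (fun t => Z t ω) i‖ ^ 2 ∂P := by
        rw [integral_const_mul, integral_finsetSum _ hi]
    _ ≤ ((b : ℝ) * numBlocks k b)⁻¹ * ∑ i ∈ Finset.range (numBlocks k b), κ * b := by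
        gcongr with i _
        exact integral_norm_sq_blockSum_le hκ b i
    _ = κ := by
        rw [Finset.sum_const, Finset.card_range, nsmul_eq_mul]
        field_simp

/-- The order of summation is exchanged: the average consists of `b` shifted sums over `N`
consecutive indices, each of root mean square at most `√(κ N)`. Bounding the overlapping block sums
one by one would give only `κ b`, without the decisive factor `b / N`. -/
lemma integral_norm_sq_blockAvg_le
    (hκ : ∀ A : Finset ℤ, ∫ ω, ‖∑ t ∈ A, Z t ω‖ ^ 2 ∂P ≤ κ * A.card)
    (hZ : ∀ t, MemLp (Z t) 2 P) (k b : ℕ) :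
    ∫ ω, ‖blockAvg k b (fun t => Z t ω)‖ ^ 2 ∂P ≤ b ^ 2 * κ / numBlocks k b := by
  have hN := numBlocks_pos k b
  set N := numBlocks k b with hNdef
  have hκ0 := nonneg_of_integral_sum_sq_le hκ
  have h1 : rms P (fun ω => blockAvg k b (fun t => Z t ω))
      ≤ (N : ℝ)⁻¹ * (b * Real.sqrt (κ * N)) := by
    have h2 : (fun ω => blockAvg k b (fun t => Z t ω))
        = fun ω => (N : ℝ)⁻¹ • ∑ j ∈ Finset.range b, ∑ i ∈ Finset.range N, Z (i + 1 + j) ω := by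
      ext ω
      rw [Finset.sum_comm]
      rfl
    rw [h2, rms_const_smul, abs_of_pos (inv_pos.2 hN)]
    refine mul_le_mul_of_nonneg_left ?_ (inv_pos.2 hN).le
    refine (rms_sum_le (Finset.range b) (Z := fun j ω => ∑ i ∈ Finset.range N, Z (i + 1 + j) ω)
      fun j => memLp_finsetSum _ fun i _ => hZ _).trans ?_
    have h3 : ∀ j ∈ Finset.range b, rms P (fun ω => ∑ i ∈ Finset.range N, Z (i + 1 + j) ω)
        ≤ Real.sqrt (κ * N) := by
      intro j _
      refine rms_le_sqrt ?_
      have hA := hκ ((Finset.range N).image fun i : ℕ => (i : ℤ) + 1 + j)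
      rw [Finset.card_image_of_injective _ (fun a c hac => by simpa using hac),
        Finset.card_range] at hA
      refine le_trans (le_of_eq ?_) hA
      congr 1
      ext ω
      rw [Finset.sum_image (fun a _ c _ hac => by simpa using hac)]
    simpa using Finset.sum_le_card_nsmul _ _ _ h3
  rw [← rms_sq]
  refine (pow_le_pow_left₀ (rms_nonneg _) h1 2).trans (le_of_eq ?_)
  rw [mul_pow, mul_pow, Real.sq_sqrt (by positivity)]
  field_simp

end BlockMoments

/-! ### Concentration of squared block sums under bounded `m`-dependence. -/

section BlockVariance

variable {Ω S : Type*} [MeasurableSpace Ω] [MeasurableSpace S] {P : Measure Ω}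
  {δ : ℤ → Ω → S} {m : ℕ} {B : ℝ} {y : ℤ → Ω → ℝ}

lemma IsBddMDependent.measurable_sum (hy : IsBddMDependent P δ m B y) {A : Finset ℤ} {C : Set ℤ}
    (h : ∀ t ∈ A, Set.Ioc (t - m) t ⊆ C) :
    Measurable[innovSigma δ C] fun ω => ∑ t ∈ A, y t ω :=
  Finset.measurable_fun_sum (m := innovSigma δ C) A fun t ht =>
    (hy.measurable t).mono (innovSigma_mono (h t ht)) le_rfl

lemma IsBddMDependent.measurable_blockSum (hy : IsBddMDependent P δ m B y) (b : ℕ) (i : ℤ) :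
    Measurable[innovSigma δ (Set.Ioc (i - m) (i + b))] fun ω => blockSum b (fun t => y t ω) i := by
  simp_rw [blockSum_eq_sum_Ioc]
  refine hy.measurable_sum fun t ht s hs => ?_
  simp only [Finset.mem_Ioc, Set.mem_Ioc] at ht hs ⊢
  omega

lemma IsBddMDependent.abs_blockSum_le (hy : IsBddMDependent P δ m B y) (b : ℕ) (i : ℤ) (ω : Ω) :
    |blockSum b (fun t => y t ω) i| ≤ B * b := by
  refine (Finset.abs_sum_le_sum_abs _ _).trans ?_
  have := Finset.sum_le_card_nsmul (Finset.range b) (fun j => |y (i + 1 + j) ω|) B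
    fun j _ => hy.bdd _ _
  simpa [mul_comm] using this

variable [IsProbabilityMeasure P]

lemma IsBddMDependent.memLp (hδ : ∀ t, Measurable (δ t)) (hy : IsBddMDependent P δ m B y) (t : ℤ)
    (p : ℝ≥0∞) : MemLp (y t) p P :=
  MemLp.of_bound ((hy.measurable t).mono (innovSigma_le hδ _) le_rfl).aestronglyMeasurable B
    (ae_of_all _ (hy.bdd t))

/-- Concentration of the average squared block sum of a bounded `m`-dependent process. -/
lemma IsBddMDependent.integral_abs_sum_blockSum_sq_sub_le (hδ : ∀ t, Measurable (δ t))
    (hi : iIndepFun δ P) (hy : IsBddMDependent P δ m B y) {κ : ℝ} {b : ℕ} (hb : 0 < b)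
    (hκ : ∀ i : ℤ, ∫ ω, blockSum b (fun t => y t ω) i ^ 2 ∂P ≤ κ * b) (N : ℕ) (hN : 0 < N) :
    ∫ ω, |((b : ℝ) * N)⁻¹ * ∑ i ∈ Finset.range N, (blockSum b (fun t => y t ω) i ^ 2
        - ∫ ω, blockSum b (fun t => y t ω) i ^ 2 ∂P)| ∂P
      ≤ Real.sqrt (2 * B ^ 2 * κ * ((b : ℝ) ^ 2 / N + m * (b / N))) := by
  set q : ℕ → Ω → ℝ := fun i ω => blockSum b (fun t => y t ω) i ^ 2 with hq
  have hb' : (0 : ℝ) < b := by exact_mod_cast hb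
  have hN' : (0 : ℝ) < N := by exact_mod_cast hN
  have hqm : ∀ i : ℕ, Measurable[innovSigma δ (Set.Ioc ((i : ℤ) - m) (i + b))] (q i) := fun i =>
    (hy.measurable_blockSum b i).pow_const 2
  have hqb : ∀ i ω, |q i ω| ≤ (B * b) ^ 2 := fun i ω => by
    rw [hq, abs_pow]
    exact pow_le_pow_left₀ (abs_nonneg _) (hy.abs_blockSum_le b i ω) 2
  have hq0 : ∀ i ω, 0 ≤ q i ω := fun i ω => sq_nonneg _
  have hqL : ∀ i, MemLp (q i) 2 P := fun i =>
    MemLp.of_bound ((hqm i).mono (innovSigma_le hδ _) le_rfl).aestronglyMeasurable _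
      (ae_of_all _ (hqb i))
  have hqi : ∀ i, Integrable (q i) P := fun i => (hqL i).integrable one_le_two
  have hqE0 : ∀ i, 0 ≤ ∫ ω, q i ω ∂P := fun i => integral_nonneg (hq0 i)
  set p : ℕ → Ω → ℝ := fun i ω => q i ω - ∫ ω, q i ω ∂P with hp
  have hpL : ∀ i, MemLp (p i) 2 P := fun i => (hqL i).sub (memLp_const _)
  have hpp : ∀ i j, ∫ ω, p i ω * p j ω ∂P
      = ∫ ω, q i ω * q j ω ∂P - (∫ ω, q i ω ∂P) * ∫ ω, q j ω ∂P := by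
    intro i j
    have e : ∀ ω, p i ω * p j ω = q i ω * q j ω - (∫ ω, q j ω ∂P) * q i ω
        - ((∫ ω, q i ω ∂P) * q j ω - (∫ ω, q i ω ∂P) * ∫ ω, q j ω ∂P) := fun ω => by
      simp only [hp]; ring
    have i1 : Integrable (fun ω => q i ω * q j ω) P := (hqL i).integrable_mul (hqL j)
    have i2 : Integrable (fun ω => (∫ ω, q j ω ∂P) * q i ω) P := (hqi i).const_mul _
    have i3 : Integrable (fun ω => (∫ ω, q i ω ∂P) * q j ω) P := (hqi j).const_mul _
    have i4 : Integrable (fun ω => q i ω * q j ω - (∫ ω, q j ω ∂P) * q i ω) P := i1.sub i2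
    have i5 : Integrable
        (fun ω => (∫ ω, q i ω ∂P) * q j ω - (∫ ω, q i ω ∂P) * ∫ ω, q j ω ∂P) P :=
      i3.sub (integrable_const _)
    simp_rw [e]
    rw [integral_sub i4 i5, integral_sub i1 i2, integral_sub i3 (integrable_const _),
      integral_const_mul, integral_const_mul]
    simp
    ring
  have hfar : ∀ i j : ℕ, i + b + m ≤ j → ∫ ω, p i ω * p j ω ∂P = 0 := by
    intro i j hij
    have hd : Disjoint (Set.Ioc ((i : ℤ) - m) (i + b)) (Set.Ioc ((j : ℤ) - m) (j + b)) := by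
      rw [Set.disjoint_left]
      intro t h1 h2
      simp only [Set.mem_Ioc] at h1 h2
      omega
    have hind := indepFun_of_innovSigma hδ hi hd (hqm i) (hqm j)
    rw [hpp, hind.integral_fun_mul_eq_mul_integral (hqL i).1 (hqL j).1, sub_self]
  -- One squared block sum is bounded by `(B b)²` and the other by its mean, at most `κ b`.
  -- Covariances vanish from distance `b + m` on, so each `i` meets at most `2 (b + m)` nonzero
  -- terms.
  have hle : ∀ i j : ℕ, ∫ ω, p i ω * p j ω ∂P
      ≤ if i < j + b + m ∧ j < i + b + m then (B * b) ^ 2 * (κ * b) else 0 := by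
    intro i j
    split_ifs with hij
    · rw [hpp]
      have h1 : ∫ ω, q i ω * q j ω ∂P ≤ ∫ ω, (B * b) ^ 2 * q i ω ∂P :=
        integral_mono ((hqL i).integrable_mul (hqL j)) ((hqi i).const_mul _) fun ω => by
          dsimp only
          rw [mul_comm]
          exact mul_le_mul_of_nonneg_right ((le_abs_self _).trans (hqb j ω)) (hq0 i ω)
      rw [integral_const_mul] at h1
      have h2 := mul_le_mul_of_nonneg_left (hκ i) (sq_nonneg (B * b))
      have h3 := mul_nonneg (hqE0 i) (hqE0 j)
      exact (sub_le_self _ h3).trans (h1.trans h2)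
    · rcases not_and_or.1 hij with h | h
      · simp_rw [mul_comm (p i _)]
        exact (hfar j i (by omega)).le
      · exact (hfar i j (by omega)).le
  have hκb : 0 ≤ κ * b := (hqE0 0).trans (hκ _)
  have hsum : ∫ ω, (∑ i ∈ Finset.range N, p i ω) ^ 2 ∂P
      ≤ N * ((2 * (b + m)) * ((B * b) ^ 2 * (κ * b))) := by
    have e : ∀ ω, (∑ i ∈ Finset.range N, p i ω) ^ 2
        = ∑ i ∈ Finset.range N, ∑ j ∈ Finset.range N, p i ω * p j ω := fun ω => by
      rw [sq, Finset.sum_mul_sum]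
    have ii : ∀ i j, Integrable (fun ω => p i ω * p j ω) P := fun i j =>
      (hpL i).integrable_mul (hpL j)
    simp_rw [e]
    rw [integral_finsetSum _ fun i _ => integrable_finsetSum _ fun j _ => ii i j]
    simp_rw [fun i => integral_finsetSum (Finset.range N) fun j _ => ii i j]
    rw [← nsmul_eq_mul]
    refine (Finset.sum_le_card_nsmul (Finset.range N) _
      ((2 * (b + m)) * ((B * b) ^ 2 * (κ * b))) fun i _ => ?_).trans_eq (by simp)
    refine (Finset.sum_le_sum fun j _ => hle i j).trans ?_
    rw [← Finset.sum_filter, Finset.sum_const, nsmul_eq_mul]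
    refine mul_le_mul_of_nonneg_right ?_ (by positivity)
    have hsub : (Finset.range N).filter (fun j => i < j + b + m ∧ j < i + b + m)
        ⊆ Finset.Ico (i + 1 - (b + m)) (i + (b + m)) := by
      intro j hj
      simp only [Finset.mem_filter, Finset.mem_range, Finset.mem_Ico] at hj ⊢
      omega
    have hcard := Finset.card_le_card hsub
    rw [Nat.card_Ico] at hcard
    have : ((Finset.range N).filter (fun j => i < j + b + m ∧ j < i + b + m)).card
        ≤ 2 * (b + m) := by omega
    exact_mod_cast this
  have hL : MemLp (fun ω => ((b : ℝ) * N)⁻¹ • ∑ i ∈ Finset.range N, p i ω) 2 P := by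
    have h : MemLp (fun ω => ∑ i ∈ Finset.range N, p i ω) 2 P :=
      memLp_finsetSum _ fun i _ => hpL i
    exact h.const_smul ((b : ℝ) * N)⁻¹
  refine (integral_norm_le_rms hL).trans ?_
  refine rms_le_sqrt ?_
  simp_rw [norm_smul, mul_pow, Real.norm_eq_abs, sq_abs]
  rw [integral_const_mul]
  refine (mul_le_mul_of_nonneg_left hsum (by positivity)).trans (le_of_eq ?_)
  field_simp

end BlockVariance

/-! ### Convergence to zero in mean through integrable majorants. -/

section VanishingInMean

variable {Ω : Type*} [MeasurableSpace Ω]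

/-- The functions `u j` are dominated by integrable functions whose integrals tend to zero. -/
def VanishesInMean (P : Measure Ω) (u : ℕ → Ω → ℝ) : Prop :=
  ∀ η : ℝ, 0 < η → ∀ᶠ j in atTop, ∃ G : Ω → ℝ, Integrable G P ∧ (∀ ω, |u j ω| ≤ G ω) ∧
    ∫ ω, G ω ∂P ≤ η

variable {P : Measure Ω}

lemma exists_pos_ofReal_le {ε : ℝ≥0∞} (hε : 0 < ε) : ∃ c : ℝ, 0 < c ∧ ENNReal.ofReal c ≤ ε := by
  rcases eq_or_ne ε ∞ with rfl | h
  · exact ⟨1, one_pos, le_top⟩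
  · exact ⟨ε.toReal, ENNReal.toReal_pos hε.ne' h, (ENNReal.ofReal_toReal h).le⟩

/-- Markov's inequality is applied to the majorant, so no measurability of `u` itself is required.
-/
lemma measure_le_of_integral_le {u G : Ω → ℝ} (hG : Integrable G P) (hu : ∀ ω, |u ω| ≤ G ω)
    {r η : ℝ} (hr : 0 < r) (hη : ∫ ω, G ω ∂P ≤ η) :
    P {ω | r ≤ |u ω|} ≤ ENNReal.ofReal (η / r) := by
  have hG0 : 0 ≤ G := fun ω => (abs_nonneg _).trans (hu ω)
  have h1 : ENNReal.ofReal r * P {ω | r ≤ |u ω|} ≤ ENNReal.ofReal η := by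
    calc ENNReal.ofReal r * P {ω | r ≤ |u ω|}
        ≤ ENNReal.ofReal r * P {ω | ENNReal.ofReal r ≤ ENNReal.ofReal (G ω)} := by
          gcongr with ω
          intro h
          exact ENNReal.ofReal_le_ofReal (h.trans (hu ω))
      _ ≤ ∫⁻ ω, ENNReal.ofReal (G ω) ∂P :=
          mul_meas_ge_le_lintegral₀ hG.aemeasurable.ennreal_ofReal _
      _ = ENNReal.ofReal (∫ ω, G ω ∂P) :=
          (ofReal_integral_eq_lintegral_ofReal hG (ae_of_all _ hG0)).symm
      _ ≤ ENNReal.ofReal η := ENNReal.ofReal_le_ofReal hη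
  rw [ENNReal.ofReal_div_of_pos hr]
  rwa [ENNReal.le_div_iff_mul_le (Or.inl (by simpa using hr)) (Or.inl ENNReal.ofReal_ne_top),
    mul_comm]

lemma VanishesInMean.tendsto_measure {u : ℕ → Ω → ℝ} (hu : VanishesInMean P u) {r : ℝ}
    (hr : 0 < r) : Tendsto (fun j => P {ω | r ≤ |u j ω|}) atTop (𝓝 0) := by
  rw [ENNReal.tendsto_nhds_zero]
  intro ε hε
  obtain ⟨c, hc0, hc⟩ := exists_pos_ofReal_le hε
  filter_upwards [hu (c * r) (by positivity)] with j ⟨G, hG, hle, hη⟩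
  refine (measure_le_of_integral_le hG hle hr hη).trans ?_
  rwa [mul_div_cancel_right₀ _ hr.ne']

lemma VanishesInMean.mono {u w : ℕ → Ω → ℝ} (hu : VanishesInMean P u)
    (h : ∀ j ω, |w j ω| ≤ |u j ω|) : VanishesInMean P w := fun η hη => by
  filter_upwards [hu η hη] with j ⟨G, hG, hle, hi⟩
  exact ⟨G, hG, fun ω => (h j ω).trans (hle ω), hi⟩

lemma VanishesInMean.add {u w : ℕ → Ω → ℝ} (hu : VanishesInMean P u) (hw : VanishesInMean P w) :
    VanishesInMean P fun j ω => u j ω + w j ω := fun η hη => by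
  filter_upwards [hu (η / 2) (half_pos hη), hw (η / 2) (half_pos hη)] with j ⟨G, hG, hle, hi⟩
    ⟨G', hG', hle', hi'⟩
  refine ⟨fun ω => G ω + G' ω, hG.add hG', fun ω => (abs_add_le _ _).trans
    (add_le_add (hle ω) (hle' ω)), ?_⟩
  rw [integral_add hG hG']
  linarith

lemma VanishesInMean.const_mul {u : ℕ → Ω → ℝ} (hu : VanishesInMean P u) (c : ℝ) :
    VanishesInMean P fun j ω => c * u j ω := fun η hη => by
  filter_upwards [hu (η / (|c| + 1)) (by positivity)] with j ⟨G, hG, hle, hi⟩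
  refine ⟨fun ω => |c| * G ω, hG.const_mul _, fun ω => ?_, ?_⟩
  · rw [abs_mul]
    exact mul_le_mul_of_nonneg_left (hle ω) (abs_nonneg c)
  · rw [integral_const_mul]
    rw [le_div_iff₀ (by positivity)] at hi
    have h0 : 0 ≤ ∫ ω, G ω ∂P := integral_nonneg fun ω => (abs_nonneg _).trans (hle ω)
    nlinarith

lemma VanishesInMean.sum {ι : Type*} (A : Finset ι) {u : ι → ℕ → Ω → ℝ}
    (hu : ∀ i, VanishesInMean P (u i)) : VanishesInMean P fun j ω => ∑ i ∈ A, u i j ω := by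
  classical
  induction A using Finset.induction_on with
  | empty =>
    exact fun η hη => .of_forall fun j => ⟨0, integrable_zero _ _ _, by simp, by simp [hη.le]⟩
  | insert i s hi ih =>
    simp only [Finset.sum_insert hi]
    exact (hu i).add ih

lemma VanishesInMean.of_tendsto [IsProbabilityMeasure P] {c : ℕ → ℝ}
    (hc : Tendsto c atTop (𝓝 0)) : VanishesInMean P fun j _ => c j := fun η hη => by
  have h : Tendsto (fun j => |c j|) atTop (𝓝 0) := by simpa using hc.abs
  filter_upwards [h.eventually (gt_mem_nhds hη)] with j hj
  exact ⟨fun _ => |c j|, integrable_const _, fun _ => le_rfl, by simpa using hj.le⟩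

end VanishingInMean

/-! ### Scalar limit theorems for the bootstrap. -/

section BlockRegular

variable {Ω S : Type*} [MeasurableSpace Ω] [MeasurableSpace S]

/-- A real process whose partial sums have linearly growing second moments, with long-run variance
`v`, and which is approximable by bounded `m`-dependent processes. -/
structure IsBlockRegular (P : Measure Ω) (δ : ℤ → Ω → S) (x : ℤ → Ω → ℝ) (κ v : ℝ) : Prop where
  memLp : ∀ t, MemLp (x t) 2 P
  sum_sq_le : ∀ A : Finset ℤ, ∫ ω, ‖∑ t ∈ A, x t ω‖ ^ 2 ∂P ≤ κ * A.card
  approx : ∀ ε : ℝ, 0 < ε → ∃ (m : ℕ) (B : ℝ) (y : ℤ → Ω → ℝ), IsBddMDependent P δ m B y ∧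
    ∀ A : Finset ℤ, ∫ ω, ‖∑ t ∈ A, (x t ω - y t ω)‖ ^ 2 ∂P ≤ ε * A.card
  blockSum_sq : ∀ (b : ℕ) (i : ℤ), ∫ ω, blockSum b (fun t => x t ω) i ^ 2 ∂P
    = ∫ ω, blockSum b (fun t => x t ω) 0 ^ 2 ∂P
  tendsto : Tendsto (fun b : ℕ => (b : ℝ)⁻¹ * ∫ ω, blockSum b (fun t => x t ω) 0 ^ 2 ∂P)
    atTop (𝓝 v)

/-- The average squared block sum `(bN)⁻¹ ∑ S_i²`. -/
noncomputable def blockSqAvg (k b : ℕ) (x : ℤ → ℝ) : ℝ :=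
  ((b : ℝ) * numBlocks k b)⁻¹ * ∑ i ∈ Finset.range (numBlocks k b), blockSum b x i ^ 2

variable {P : Measure Ω} [IsProbabilityMeasure P] {δ : ℤ → Ω → S} {x y : ℤ → Ω → ℝ}
  {κ κ' τ v : ℝ} {m : ℕ} {B : ℝ}

lemma integrable_blockSqAvg (hx : ∀ t, MemLp (x t) 2 P) (k b : ℕ) :
    Integrable (fun ω => blockSqAvg k b (fun t => x t ω)) P := by
  have h : Integrable (fun ω => ∑ i ∈ Finset.range (numBlocks k b),
      blockSum b (fun t => x t ω) i ^ 2) P :=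
    integrable_finsetSum _ fun i _ => (memLp_blockSum hx b (i : ℤ)).integrable_sq
  exact h.const_mul _

lemma integral_blockSqAvg (hx : ∀ t, MemLp (x t) 2 P) (k b : ℕ) :
    ∫ ω, blockSqAvg k b (fun t => x t ω) ∂P = ((b : ℝ) * numBlocks k b)⁻¹ *
      ∑ i ∈ Finset.range (numBlocks k b), ∫ ω, blockSum b (fun t => x t ω) i ^ 2 ∂P := by
  have h : ∀ i ∈ Finset.range (numBlocks k b),
      Integrable (fun ω => blockSum b (fun t => x t ω) (i : ℤ) ^ 2) P :=
    fun i _ => (memLp_blockSum hx b (i : ℤ)).integrable_sq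
  simp only [blockSqAvg]
  rw [integral_const_mul, integral_finsetSum _ h]

/-- The approximating process inherits linear growth with a constant that does not depend on its `m`
and `B`, by the triangle inequality for root mean squares. -/
lemma rms_sum_le_of_approx (hx : ∀ t, MemLp (x t) 2 P) (hy : ∀ t, MemLp (y t) 2 P) (hτ : 0 ≤ τ)
    (hκ : ∀ A : Finset ℤ, ∫ ω, ‖∑ t ∈ A, x t ω‖ ^ 2 ∂P ≤ κ * A.card)
    (hxy : ∀ A : Finset ℤ, ∫ ω, ‖∑ t ∈ A, (x t ω - y t ω)‖ ^ 2 ∂P ≤ τ ^ 2 * A.card)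
    (A : Finset ℤ) :
    ∫ ω, ‖∑ t ∈ A, y t ω‖ ^ 2 ∂P ≤ (Real.sqrt κ + τ) ^ 2 * A.card := by
  have hκ0 := nonneg_of_integral_sum_sq_le hκ
  have h1 : rms P (fun ω => ∑ t ∈ A, y t ω) ≤ (Real.sqrt κ + τ) * Real.sqrt A.card := by
    have e : (fun ω => ∑ t ∈ A, y t ω)
        = fun ω => ∑ t ∈ A, x t ω - ∑ t ∈ A, (x t ω - y t ω) := by
      ext ω
      rw [← Finset.sum_sub_distrib]
      simp
    rw [e]
    have m1 : MemLp (fun ω => ∑ t ∈ A, x t ω) 2 P := memLp_finsetSum A fun t _ => hx t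
    have m2 : MemLp (fun ω => ∑ t ∈ A, (x t ω - y t ω)) 2 P :=
      memLp_finsetSum A fun t _ => (hx t).sub (hy t)
    refine (rms_sub_le m1 m2).trans ?_
    rw [add_mul]
    refine add_le_add ?_ ?_
    · rw [← Real.sqrt_mul hκ0]
      exact rms_le_sqrt (hκ A)
    · refine rms_le_of_integral_le (by positivity) ?_
      rw [mul_pow, Real.sq_sqrt (Nat.cast_nonneg _)]
      exact hxy A
  rw [← rms_sq]
  refine (pow_le_pow_left₀ (rms_nonneg _) h1 2).trans_eq ?_
  rw [mul_pow, Real.sq_sqrt (Nat.cast_nonneg _)]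

lemma integral_abs_sq_sub_sq_le {U V : Ω → ℝ} (hU : MemLp U 2 P) (hV : MemLp V 2 P) :
    ∫ ω, |U ω ^ 2 - V ω ^ 2| ∂P
      ≤ rms P (fun ω => U ω - V ω) * (rms P U + rms P V) := by
  have e : ∀ ω, |U ω ^ 2 - V ω ^ 2| = ‖U ω - V ω‖ * ‖U ω + V ω‖ := fun ω => by
    rw [Real.norm_eq_abs, Real.norm_eq_abs, ← abs_mul]
    congr 1; ring
  simp_rw [e]
  exact (integral_norm_mul_le (hU.sub hV) (hU.add hV)).trans
    (mul_le_mul_of_nonneg_left (rms_add_le hU hV) (rms_nonneg _))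

/-- Write `|S² - T²| = |S - T| |S + T|` and use Cauchy-Schwarz: the block sums contribute `τ √b` and
`(2 √κ + τ) √b`. The resulting `b` cancels the normalization, so the bound is uniform in `k` and
`b`. -/
lemma integral_abs_blockSqAvg_sub_le (hx : ∀ t, MemLp (x t) 2 P) (hy : ∀ t, MemLp (y t) 2 P)
    (hτ : 0 ≤ τ) (hκ : ∀ A : Finset ℤ, ∫ ω, ‖∑ t ∈ A, x t ω‖ ^ 2 ∂P ≤ κ * A.card)
    (hxy : ∀ A : Finset ℤ, ∫ ω, ‖∑ t ∈ A, (x t ω - y t ω)‖ ^ 2 ∂P ≤ τ ^ 2 * A.card)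
    {b : ℕ} (hb : 0 < b) (k : ℕ) :
    ∫ ω, |blockSqAvg k b (fun t => x t ω) - blockSqAvg k b (fun t => y t ω)| ∂P
      ≤ τ * (2 * Real.sqrt κ + τ) := by
  have hN := numBlocks_pos k b
  have hb' : (0 : ℝ) < b := by exact_mod_cast hb
  set N := numBlocks k b with hNdef
  have hsqrtb : 0 < Real.sqrt b := Real.sqrt_pos.2 hb'
  have hi : ∀ i : ℕ, Integrable (fun ω => |blockSum b (fun t => x t ω) i ^ 2
      - blockSum b (fun t => y t ω) i ^ 2|) P := fun i =>
    ((memLp_blockSum hx b i).integrable_sq.sub (memLp_blockSum hy b i).integrable_sq).abs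
  have hbd : ∀ i : ℕ, ∫ ω, |blockSum b (fun t => x t ω) i ^ 2
      - blockSum b (fun t => y t ω) i ^ 2| ∂P ≤ τ * (2 * Real.sqrt κ + τ) * b := by
    intro i
    refine (integral_abs_sq_sub_sq_le (memLp_blockSum hx b i) (memLp_blockSum hy b i)).trans ?_
    have h1 : rms P (fun ω => blockSum b (fun t => x t ω) i - blockSum b (fun t => y t ω) i)
        ≤ τ * Real.sqrt b := by
      simp_rw [← blockSum_sub]
      have := rms_blockSum_le (Z := fun t ω => x t ω - y t ω) hxy b i
      rwa [Real.sqrt_sq hτ] at this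
    have h2 := rms_blockSum_le hκ b i
    have h3 := rms_blockSum_le (rms_sum_le_of_approx hx hy hτ hκ hxy) b i
    rw [Real.sqrt_sq (by positivity)] at h3
    calc _ ≤ (τ * Real.sqrt b) * (Real.sqrt κ * Real.sqrt b
          + (Real.sqrt κ + τ) * Real.sqrt b) := by
          exact mul_le_mul h1 (add_le_add h2 h3) (add_nonneg (rms_nonneg _) (rms_nonneg _))
            (by positivity)
      _ = τ * (2 * Real.sqrt κ + τ) * (Real.sqrt b * Real.sqrt b) := by ring
      _ = _ := by rw [Real.mul_self_sqrt hb'.le]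
  calc ∫ ω, |blockSqAvg k b (fun t => x t ω) - blockSqAvg k b (fun t => y t ω)| ∂P
      ≤ ∫ ω, ((b : ℝ) * N)⁻¹ * ∑ i ∈ Finset.range N,
        |blockSum b (fun t => x t ω) i ^ 2 - blockSum b (fun t => y t ω) i ^ 2| ∂P := by
        refine integral_mono
          ((integrable_blockSqAvg hx k b).sub (integrable_blockSqAvg hy k b)).abs
          ((integrable_finsetSum _ fun i _ => hi i).const_mul _) fun ω => ?_
        dsimp only
        rw [blockSqAvg, blockSqAvg, ← mul_sub, ← Finset.sum_sub_distrib, abs_mul,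
          abs_of_pos (by positivity)]
        exact mul_le_mul_of_nonneg_left (Finset.abs_sum_le_sum_abs _ _) (by positivity)
    _ = ((b : ℝ) * N)⁻¹ * ∑ i ∈ Finset.range N,
        ∫ ω, |blockSum b (fun t => x t ω) i ^ 2 - blockSum b (fun t => y t ω) i ^ 2| ∂P := by
        rw [integral_const_mul, integral_finsetSum _ fun i _ => hi i]
    _ ≤ ((b : ℝ) * N)⁻¹ * ∑ i ∈ Finset.range N, τ * (2 * Real.sqrt κ + τ) * b := by
        gcongr with i _
        exact hbd i
    _ = τ * (2 * Real.sqrt κ + τ) := by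
        rw [Finset.sum_const, Finset.card_range, nsmul_eq_mul]
        field_simp

lemma integral_abs_bootVar_sub_blockSqAvg_le (hx : ∀ t, MemLp (x t) 2 P)
    (hκ : ∀ A : Finset ℤ, ∫ ω, ‖∑ t ∈ A, x t ω‖ ^ 2 ∂P ≤ κ * A.card) {b : ℕ} (hb : 0 < b) (k : ℕ) :
    ∫ ω, |bootVar k b (fun t => x t ω) - blockSqAvg k b (fun t => x t ω)| ∂P
      ≤ κ * (b / numBlocks k b) := by
  have hb' : (0 : ℝ) < b := by exact_mod_cast hb
  have e : ∀ ω, |bootVar k b (fun t => x t ω) - blockSqAvg k b (fun t => x t ω)|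
      = (b : ℝ)⁻¹ * ‖blockAvg k b (fun t => x t ω)‖ ^ 2 := fun ω => by
    rw [bootVar_eq, blockSqAvg]
    simp only [Real.norm_eq_abs, sq_abs]
    rw [sub_sub_cancel_left, abs_neg, abs_of_nonneg (by positivity)]
  simp_rw [e]
  rw [integral_const_mul]
  refine (mul_le_mul_of_nonneg_left (integral_norm_sq_blockAvg_le hκ hx k b)
    (by positivity)).trans_eq ?_
  field_simp

/-- The three terms are the fluctuation of the average for the bounded process, the change of its
mean when passing to `x`, and the distance of the scaled block variance of `x` from its limit. -/
lemma integral_abs_blockSqAvg_sub_const_le (hδ : ∀ t, Measurable (δ t)) (hi : iIndepFun δ P)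
    (hx : IsBlockRegular P δ x κ v) (hy : IsBddMDependent P δ m B y) (hτ : 0 ≤ τ)
    (hxy : ∀ A : Finset ℤ, ∫ ω, ‖∑ t ∈ A, (x t ω - y t ω)‖ ^ 2 ∂P ≤ τ ^ 2 * A.card)
    {b : ℕ} (hb : 0 < b) (k : ℕ) :
    ∫ ω, |blockSqAvg k b (fun t => y t ω) - v| ∂P
      ≤ Real.sqrt (2 * B ^ 2 * (Real.sqrt κ + τ) ^ 2 *
          ((b : ℝ) ^ 2 / numBlocks k b + m * (b / numBlocks k b)))
        + τ * (2 * Real.sqrt κ + τ)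
        + |(b : ℝ)⁻¹ * ∫ ω, blockSum b (fun t => x t ω) 0 ^ 2 ∂P - v| := by
  have hN := numBlocks_pos k b
  have hb' : (0 : ℝ) < b := by exact_mod_cast hb
  have hy2 : ∀ t, MemLp (y t) 2 P := fun t => hy.memLp hδ t 2
  have hκy := rms_sum_le_of_approx hx.memLp hy2 hτ hx.sum_sq_le hxy
  have hEx : ∫ ω, blockSqAvg k b (fun t => x t ω) ∂P
      = (b : ℝ)⁻¹ * ∫ ω, blockSum b (fun t => x t ω) 0 ^ 2 ∂P := by
    rw [integral_blockSqAvg hx.memLp]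
    simp_rw [hx.blockSum_sq]
    rw [Finset.sum_const, Finset.card_range, nsmul_eq_mul]
    field_simp
  have h1 : |∫ ω, blockSqAvg k b (fun t => x t ω) ∂P - ∫ ω, blockSqAvg k b (fun t => y t ω) ∂P|
      ≤ τ * (2 * Real.sqrt κ + τ) := by
    rw [← integral_sub (integrable_blockSqAvg hx.memLp k b) (integrable_blockSqAvg hy2 k b)]
    exact abs_integral_le_integral_abs.trans
      (integral_abs_blockSqAvg_sub_le hx.memLp hy2 hτ hx.sum_sq_le hxy hb k)
  have h2 := hy.integral_abs_sum_blockSum_sq_sub_le hδ hi hb (κ := (Real.sqrt κ + τ) ^ 2)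
    (fun i => by simpa using integral_norm_sq_blockSum_le hκy b i) (numBlocks k b)
    (Nat.succ_pos _)
  have h3 : ∀ ω, ((b : ℝ) * numBlocks k b)⁻¹ * ∑ i ∈ Finset.range (numBlocks k b),
      (blockSum b (fun t => y t ω) i ^ 2 - ∫ ω, blockSum b (fun t => y t ω) i ^ 2 ∂P)
      = blockSqAvg k b (fun t => y t ω) - ∫ ω, blockSqAvg k b (fun t => y t ω) ∂P := by
    intro ω
    rw [integral_blockSqAvg hy2, blockSqAvg, Finset.sum_sub_distrib, mul_sub]
  simp_rw [h3] at h2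
  rw [← hEx]
  have hint : Integrable (fun ω => |blockSqAvg k b (fun t => y t ω)
      - ∫ ω, blockSqAvg k b (fun t => y t ω) ∂P|) P :=
    ((integrable_blockSqAvg hy2 k b).sub (integrable_const _)).abs
  calc ∫ ω, |blockSqAvg k b (fun t => y t ω) - v| ∂P
      ≤ ∫ ω, (|blockSqAvg k b (fun t => y t ω) - ∫ ω, blockSqAvg k b (fun t => y t ω) ∂P|
        + (|∫ ω, blockSqAvg k b (fun t => x t ω) ∂P - ∫ ω, blockSqAvg k b (fun t => y t ω) ∂P|
          + |∫ ω, blockSqAvg k b (fun t => x t ω) ∂P - v|)) ∂P := by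
        refine integral_mono ((integrable_blockSqAvg hy2 k b).sub (integrable_const _)).abs
          (hint.add (integrable_const _)) fun ω => ?_
        dsimp only
        rw [abs_sub_comm (∫ ω, blockSqAvg k b (fun t => x t ω) ∂P)
          (∫ ω, blockSqAvg k b (fun t => y t ω) ∂P)]
        refine (abs_sub_le _ (∫ ω, blockSqAvg k b (fun t => y t ω) ∂P) _).trans ?_
        gcongr
        exact abs_sub_le _ _ _
    _ ≤ _ := by
        rw [integral_add hint (integrable_const _)]
        simp only [integral_const, probReal_univ, one_smul]
        linarith

section Limits

variable {k b : ℕ → ℕ}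

lemma IsBlockRegular.nonneg (hx : IsBlockRegular P δ x κ v) : 0 ≤ v :=
  ge_of_tendsto' hx.tendsto fun b => mul_nonneg (by positivity)
    (integral_nonneg fun _ => sq_nonneg _)

lemma exists_pos_small (c : ℝ) {η : ℝ} (hη : 0 < η) : ∃ τ : ℝ, 0 < τ ∧ τ ≤ 1 ∧ τ * c ≤ η := by
  refine ⟨min 1 (η / (|c| + 1)), lt_min one_pos (by positivity), min_le_left _ _, ?_⟩
  have h1 : min 1 (η / (|c| + 1)) ≤ η / (|c| + 1) := min_le_right _ _
  have h0 : 0 < min 1 (η / (|c| + 1)) := lt_min one_pos (by positivity)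
  rw [le_div_iff₀ (by positivity)] at h1
  nlinarith [le_abs_self c]

/-- The terms of the error bounds for a fixed bounded `m`-dependent approximation vanish. -/
lemma IsBlockRegular.tendsto_remainder (hx : IsBlockRegular P δ x κ v)
    (hn : Tendsto (fun j => k j * b j) atTop atTop) (hb : Tendsto b atTop atTop)
    (hbn : Tendsto (fun j => (b j : ℝ) / Real.sqrt ((k j * b j : ℕ) : ℝ)) atTop (𝓝 0))
    (B c : ℝ) (m : ℕ) :
    Tendsto (fun j => Real.sqrt (2 * B ^ 2 * c *
        ((b j : ℝ) ^ 2 / numBlocks (k j) (b j) + m * (b j / numBlocks (k j) (b j))))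
      + |(b j : ℝ)⁻¹ * ∫ ω, blockSum (b j) (fun t => x t ω) 0 ^ 2 ∂P - v|) atTop (𝓝 0) := by
  have h1 := ((tendsto_sq_div_numBlocks hn hbn).add
    ((tendsto_div_numBlocks hn hbn).const_mul (m : ℝ))).const_mul (2 * B ^ 2 * c)
  have h2 := (Real.continuous_sqrt.tendsto _).comp h1
  have h3 := ((hx.tendsto.comp hb).sub_const v).abs
  simpa [Function.comp_def] using h2.add h3

/-- Law of large numbers for the bootstrap variance. -/
lemma IsBlockRegular.vanishesInMean_bootVar_sub (hδ : ∀ t, Measurable (δ t)) (hi : iIndepFun δ P)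
    (hx : IsBlockRegular P δ x κ v) (hn : Tendsto (fun j => k j * b j) atTop atTop)
    (hb : Tendsto b atTop atTop)
    (hbn : Tendsto (fun j => (b j : ℝ) / Real.sqrt ((k j * b j : ℕ) : ℝ)) atTop (𝓝 0)) :
    VanishesInMean P fun j ω => bootVar (k j) (b j) (fun t => x t ω) - v := by
  intro η hη
  -- The approximation error `τ (2 √κ + τ)`, with `τ ≤ 1`, is paid twice: in replacing `x` by `y`
  -- and in comparing their means.
  obtain ⟨τ, hτ0, hτ1, hτ⟩ := exists_pos_small (2 * (2 * Real.sqrt κ + 1)) (half_pos hη)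
  obtain ⟨m, B, y, hy, hxy⟩ := hx.approx (τ ^ 2) (by positivity)
  have hy2 : ∀ t, MemLp (y t) 2 P := fun t => hy.memLp hδ t 2
  have hR := (hx.tendsto_remainder hn hb hbn B ((Real.sqrt κ + τ) ^ 2) m).add
    ((tendsto_div_numBlocks hn hbn).const_mul κ)
  simp only [mul_zero, add_zero] at hR
  filter_upwards [hR.eventually (gt_mem_nhds (half_pos hη)), eventually_pos_of_tendsto_mul hn]
    with j hj ⟨_, hbj⟩
  have i1 := integrable_bootVar hx.memLp (k j) (b j)
  have i2 := integrable_blockSqAvg hx.memLp (k j) (b j)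
  have i3 := integrable_blockSqAvg hy2 (k j) (b j)
  have j1 : Integrable (fun ω => |bootVar (k j) (b j) (fun t => x t ω)
    - blockSqAvg (k j) (b j) (fun t => x t ω)|) P := (i1.sub i2).abs
  have j2 : Integrable (fun ω => |blockSqAvg (k j) (b j) (fun t => x t ω)
    - blockSqAvg (k j) (b j) (fun t => y t ω)|) P := (i2.sub i3).abs
  have j3 : Integrable (fun ω => |blockSqAvg (k j) (b j) (fun t => y t ω) - v|) P :=
    (i3.sub (integrable_const _)).abs
  have j12 : Integrable (fun ω => |bootVar (k j) (b j) (fun t => x t ω)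
    - blockSqAvg (k j) (b j) (fun t => x t ω)| + |blockSqAvg (k j) (b j) (fun t => x t ω)
    - blockSqAvg (k j) (b j) (fun t => y t ω)|) P := j1.add j2
  refine ⟨fun ω => |bootVar (k j) (b j) (fun t => x t ω)
    - blockSqAvg (k j) (b j) (fun t => x t ω)| + |blockSqAvg (k j) (b j) (fun t => x t ω)
    - blockSqAvg (k j) (b j) (fun t => y t ω)| + |blockSqAvg (k j) (b j) (fun t => y t ω) - v|,
    j12.add j3, fun ω => ?_, ?_⟩
  · refine (abs_sub_le _ (blockSqAvg (k j) (b j) (fun t => y t ω)) _).trans ?_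
    exact add_le_add (abs_sub_le _ _ _) le_rfl
  · rw [integral_add j12 j3, integral_add j1 j2]
    have h1 := integral_abs_bootVar_sub_blockSqAvg_le hx.memLp hx.sum_sq_le hbj (k j)
    have h2 := integral_abs_blockSqAvg_sub_le hx.memLp hy2 hτ0.le hx.sum_sq_le hxy hbj (k j)
    have h3 := integral_abs_blockSqAvg_sub_const_le hδ hi hx hy hτ0.le hxy hbj (k j)
    nlinarith [Real.sqrt_nonneg κ]

lemma norm_exp_neg_half_sub_le {a c : ℝ} (ha : 0 ≤ a) (hc : 0 ≤ c) :
    ‖Complex.exp ((-a / 2 : ℝ)) - Complex.exp ((-c / 2 : ℝ))‖ ≤ |a - c| := by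
  rw [← Complex.ofReal_exp, ← Complex.ofReal_exp, ← Complex.ofReal_sub, Complex.norm_real,
    Real.norm_eq_abs]
  wlog h : a ≤ c generalizing a c with H
  · rw [abs_sub_comm, abs_sub_comm a]
    exact H hc ha (le_of_not_ge h)
  have h1 : Real.exp (-c / 2) ≤ Real.exp (-a / 2) := Real.exp_le_exp.2 (by linarith)
  rw [abs_of_nonneg (by linarith), abs_of_nonpos (by linarith)]
  have h2 : Real.exp (-c / 2) = Real.exp (-a / 2) * Real.exp (-(c - a) / 2) := by
    rw [← Real.exp_add]; congr 1; ring
  have h3 := Real.add_one_le_exp (-(c - a) / 2)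
  have h4 : Real.exp (-a / 2) ≤ 1 := Real.exp_le_one_iff.2 (by linarith)
  have h5 := Real.exp_pos (-a / 2)
  nlinarith

lemma integral_sqrt_le {g : Ω → ℝ} (hg : Integrable g P) (hg0 : ∀ ω, 0 ≤ g ω) {c : ℝ} (hc : 0 ≤ c)
    (h : ∫ ω, g ω ∂P ≤ c ^ 2) :
    Integrable (fun ω => Real.sqrt (g ω)) P ∧ ∫ ω, Real.sqrt (g ω) ∂P ≤ c := by
  have hL : MemLp (fun ω => Real.sqrt (g ω)) 2 P := by
    refine (memLp_two_iff_integrable_sq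
      (Real.continuous_sqrt.comp_aestronglyMeasurable hg.1)).2 ?_
    simpa [Real.sq_sqrt (hg0 _)] using hg
  refine ⟨hL.integrable one_le_two, ?_⟩
  have h1 := integral_norm_le_rms hL
  simp only [Real.norm_eq_abs, abs_of_nonneg (Real.sqrt_nonneg _)] at h1
  refine h1.trans (rms_le_of_integral_le hc ?_)
  simpa [Real.sq_sqrt (hg0 _)] using h

/-- Conditional central limit theorem for the bootstrap, on the level of characteristic
functions. -/
lemma IsBlockRegular.vanishesInMean_charExp_bootCentered_sub (hδ : ∀ t, Measurable (δ t))
    (hi : iIndepFun δ P) (hx : IsBlockRegular P δ x κ v)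
    (hn : Tendsto (fun j => k j * b j) atTop atTop) (hb : Tendsto b atTop atTop)
    (hbn : Tendsto (fun j => (b j : ℝ) / Real.sqrt ((k j * b j : ℕ) : ℝ)) atTop (𝓝 0)) :
    VanishesInMean P fun j ω => ‖charExp (blockIndexLaw (k j) (b j))
        (fun I => Real.sqrt ((k j * b j : ℕ) : ℝ) • bootCentered (k j) (b j) (fun t => x t ω) I)
      - Complex.exp ((-v / 2 : ℝ))‖ := by
  intro η hη
  -- The summand `1` pays for the change of characteristic function, at most `τ` in mean, and `2 √κ
  -- + 1` for the bias of the variance of `y`.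
  obtain ⟨τ, hτ0, hτ1, hτ⟩ := exists_pos_small (1 + (2 * Real.sqrt κ + 1)) (half_pos hη)
  obtain ⟨m, B, y, hy, hxy⟩ := hx.approx (τ ^ 2) (by positivity)
  have hy2 : ∀ t, MemLp (y t) 2 P := fun t => hy.memLp hδ t 2
  have hκy := rms_sum_le_of_approx hx.memLp hy2 hτ0.le hx.sum_sq_le hxy
  set c := (Real.sqrt κ + τ) ^ 2 with hc
  have hM : Tendsto (fun j => 2 * B * ((b j : ℝ) / Real.sqrt ((k j * b j : ℕ) : ℝ))) atTop
      (𝓝 0) := by simpa using hbn.const_mul (2 * B)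
  have hR := ((hx.tendsto_remainder hn hb hbn B c m).add
    ((tendsto_div_numBlocks hn hbn).const_mul c)).add (hM.mul_const c)
  simp only [mul_zero, add_zero, zero_mul] at hR
  have hB0 : 0 ≤ B := by
    obtain ⟨ω⟩ : Nonempty Ω := P.nonempty_of_neZero
    exact (abs_nonneg _).trans (hy.bdd 0 ω)
  filter_upwards [hR.eventually (gt_mem_nhds (half_pos hη)), eventually_pos_of_tendsto_mul hn,
    hM.eventually (gt_mem_nhds one_pos)] with j hj ⟨hkj, hbj⟩ hMj
  set M := 2 * B * ((b j : ℝ) / Real.sqrt ((k j * b j : ℕ) : ℝ)) with hMdef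
  have hM0 : 0 ≤ M := by positivity
  have id : Integrable (fun ω => bootVar (k j) (b j) (fun t => x t ω - y t ω)) P :=
    integrable_bootVar (Z := fun t ω => x t ω - y t ω) (fun t => (hx.memLp t).sub (hy2 t)) _ _
  have hd := integral_bootVar_le (Z := fun t ω => x t ω - y t ω) hxy
    (fun t => (hx.memLp t).sub (hy2 t)) hbj (k j)
  obtain ⟨i1, hi1⟩ := integral_sqrt_le id (fun ω => bootVar_nonneg _ _ _) hτ0.le hd
  have i2 := integrable_bootVar hy2 (k j) (b j)
  have i3 := integrable_blockSqAvg hy2 (k j) (b j)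
  have j2 : Integrable (fun ω => M * bootVar (k j) (b j) (fun t => y t ω)) P := i2.const_mul _
  have j3 : Integrable (fun ω => |bootVar (k j) (b j) (fun t => y t ω)
    - blockSqAvg (k j) (b j) (fun t => y t ω)|) P := (i2.sub i3).abs
  have j4 : Integrable (fun ω => |blockSqAvg (k j) (b j) (fun t => y t ω) - v|) P :=
    (i3.sub (integrable_const _)).abs
  have j12 : Integrable (fun ω => Real.sqrt (bootVar (k j) (b j) fun t => x t ω - y t ω)
    + M * bootVar (k j) (b j) (fun t => y t ω)) P := i1.add j2
  have j123 : Integrable (fun ω => Real.sqrt (bootVar (k j) (b j) fun t => x t ω - y t ω)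
    + M * bootVar (k j) (b j) (fun t => y t ω) + |bootVar (k j) (b j) (fun t => y t ω)
    - blockSqAvg (k j) (b j) (fun t => y t ω)|) P := j12.add j3
  refine ⟨fun ω => Real.sqrt (bootVar (k j) (b j) fun t => x t ω - y t ω)
    + M * bootVar (k j) (b j) (fun t => y t ω) + |bootVar (k j) (b j) (fun t => y t ω)
    - blockSqAvg (k j) (b j) (fun t => y t ω)|
    + |blockSqAvg (k j) (b j) (fun t => y t ω) - v|, j123.add j4, fun ω => ?_, ?_⟩
  · rw [abs_of_nonneg (norm_nonneg _)]
    have h1 := norm_charExp_bootCentered_sub_le hkj hbj (fun t => x t ω) (fun t => y t ω)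
    have h2 := norm_charExp_bootCentered_sub_gaussian_le hkj hbj (x := fun t => y t ω)
      (fun t => hy.bdd t ω) hMj.le
    have h3 := norm_exp_neg_half_sub_le (bootVar_nonneg (k j) (b j) (fun t => y t ω)) hx.nonneg
    have h4 := abs_sub_le (bootVar (k j) (b j) (fun t => y t ω))
      (blockSqAvg (k j) (b j) (fun t => y t ω)) v
    refine (norm_sub_le_norm_sub_add_norm_sub _ _ _).trans ((add_le_add h1
      ((norm_sub_le_norm_sub_add_norm_sub _ _ _).trans
        (add_le_add h2 (h3.trans h4)))).trans_eq ?_)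
    ring
  · rw [integral_add j123 j4, integral_add j12 j3, integral_add i1 j2, integral_const_mul]
    have h1 := integral_abs_bootVar_sub_blockSqAvg_le hy2 hκy hbj (k j)
    have h2 := integral_bootVar_le hκy hy2 hbj (k j)
    have h3 := integral_abs_blockSqAvg_sub_const_le hδ hi hx hy hτ0.le hxy hbj (k j)
    have h4 := mul_le_mul_of_nonneg_left h2 hM0
    nlinarith [Real.sqrt_nonneg κ]

end Limits

end BlockRegular

/-! ### Scalar central limit theorem for the sample mean by big and small blocks. -/

section MeanCharacteristicFunction

variable {Ω S : Type*} [MeasurableSpace Ω] [MeasurableSpace S]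
  {P : Measure Ω} [IsProbabilityMeasure P] {δ : ℤ → Ω → S} {x y : ℤ → Ω → ℝ}
  {κ τ v : ℝ} {m : ℕ} {B : ℝ}

/-- The last summand is split off at each step: the earlier ones are functions of the innovations up
to time `k b`, the last one of strictly later innovations. -/
lemma charExp_sum_of_innovSigma (hδ : ∀ t, Measurable (δ t)) (hi : iIndepFun δ P) (b : ℕ)
    {T : ℕ → Ω → ℝ}
    (hT : ∀ i : ℕ, Measurable[innovSigma δ (Set.Ioc ((i : ℤ) * b) ((i : ℤ) * b + b))] (T i))
    (k : ℕ) :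
    charExp P (fun ω => ∑ i ∈ Finset.range k, T i ω)
      = ∏ i ∈ Finset.range k, charExp P (T i) := by
  induction k with
  | zero => simp [charExp]
  | succ k ih =>
    rw [Finset.prod_range_succ, ← ih]
    simp_rw [Finset.sum_range_succ]
    have h1 : Measurable[innovSigma δ (Set.Iic ((k : ℤ) * b))]
        (fun ω => ∑ i ∈ Finset.range k, T i ω) := by
      refine Finset.measurable_sum _ fun i hik => (hT i).mono (innovSigma_mono ?_) le_rfl
      intro t ht
      have h2 : ((i : ℤ) + 1) * b ≤ (k : ℤ) * b :=
        mul_le_mul_of_nonneg_right (by have := Finset.mem_range.1 hik; omega) (by positivity)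
      simp only [Set.mem_Ioc, Set.mem_Iic] at ht ⊢
      linarith [ht.2]
    have hd : Disjoint (Set.Iic ((k : ℤ) * b)) (Set.Ioc ((k : ℤ) * b) ((k : ℤ) * b + b)) := by
      rw [Set.disjoint_left]
      intro u hu hu'
      simp only [Set.mem_Iic, Set.mem_Ioc] at hu hu'
      omega
    have hind := indepFun_of_innovSigma hδ hi hd h1 (hT k)
    have he : Measurable fun z : ℝ => Complex.exp (z * Complex.I) := by fun_prop
    have m1 := h1.mono (innovSigma_le hδ _) le_rfl
    have m2 := (hT k).mono (innovSigma_le hδ _) le_rfl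
    have h3 := (hind.comp he he).integral_fun_mul_eq_mul_integral
      (he.comp m1).aestronglyMeasurable (he.comp m2).aestronglyMeasurable
    simp only [Function.comp] at h3
    rw [charExp, charExp, charExp, ← h3]
    refine integral_congr_ae (ae_of_all _ fun ω => ?_)
    dsimp only
    rw [← Complex.exp_add, ← add_mul]
    push_cast
    rfl

/-- The indices `1 ≤ t ≤ kb` outside the first `m` positions of each block of length `b`. -/
noncomputable def bigBlocks (k b m : ℕ) : Finset ℤ :=
  (Finset.range k).biUnion fun i => Finset.Ioc ((i : ℤ) * b + m) ((i : ℤ) * b + b)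

lemma pairwiseDisjoint_bigBlocks (k b m : ℕ) :
    ((Finset.range k : Finset ℕ) : Set ℕ).PairwiseDisjoint
      fun i : ℕ => Finset.Ioc ((i : ℤ) * b + m) ((i : ℤ) * b + b) := by
  intro i _ j _ hij
  refine Finset.disjoint_left.2 fun t hi hj => ?_
  simp only [Finset.mem_Ioc] at hi hj
  rcases lt_or_gt_of_ne hij with h | h
  · have : ((i : ℤ) + 1) * b ≤ j * b := mul_le_mul_of_nonneg_right (by omega) (by positivity)
    linarith [hi.2, hj.1, Int.natCast_nonneg m]
  · have : ((j : ℤ) + 1) * b ≤ i * b := mul_le_mul_of_nonneg_right (by omega) (by positivity)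
    linarith [hj.2, hi.1, Int.natCast_nonneg m]

lemma bigBlocks_subset (k b m : ℕ) : bigBlocks k b m ⊆ Finset.Ioc (0 : ℤ) ((k * b : ℕ) : ℤ) := by
  intro t ht
  simp only [bigBlocks, Finset.mem_biUnion, Finset.mem_range, Finset.mem_Ioc] at ht ⊢
  obtain ⟨i, hik, h1, h2⟩ := ht
  have h3 : ((i : ℤ) + 1) * b ≤ k * b := mul_le_mul_of_nonneg_right (by omega) (by positivity)
  have h4 : 0 ≤ (i : ℤ) * b := by positivity
  push_cast
  constructor <;> linarith [Int.natCast_nonneg m]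

lemma card_sdiff_bigBlocks {k b m : ℕ} (hm : m ≤ b) :
    (Finset.Ioc (0 : ℤ) ((k * b : ℕ) : ℤ) \ bigBlocks k b m).card = k * m := by
  have h1 : (bigBlocks k b m).card = k * (b - m) := by
    rw [bigBlocks, Finset.card_biUnion (pairwiseDisjoint_bigBlocks k b m)]
    have : ∀ i : ℕ, (Finset.Ioc ((i : ℤ) * b + m) ((i : ℤ) * b + b)).card = b - m := fun i => by
      rw [Int.card_Ioc]; omega
    simp [this]
  rw [Finset.card_sdiff_of_subset (bigBlocks_subset k b m), h1, Int.card_Ioc]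
  obtain ⟨c, rfl⟩ := Nat.exists_eq_add_of_le hm
  rw [Nat.add_sub_cancel_left, Nat.mul_add]
  omega

/-- For `t` beyond the first `m` positions of a block, the `m` innovations behind `y t` stay inside
that block. The truncated block sums are therefore functions of disjoint sets of innovations. -/
lemma IsBddMDependent.charExp_bigBlocks (hδ : ∀ t, Measurable (δ t)) (hi : iIndepFun δ P)
    (hy : IsBddMDependent P δ m B y) (k b : ℕ) (c : ℝ) :
    charExp P (fun ω => c * ∑ t ∈ bigBlocks k b m, y t ω)
      = ∏ i ∈ Finset.range k, charExp P fun ω =>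
        c * ∑ t ∈ Finset.Ioc ((i : ℤ) * b + m) ((i : ℤ) * b + b), y t ω := by
  have hT : ∀ i : ℕ, Measurable[innovSigma δ (Set.Ioc ((i : ℤ) * b) ((i : ℤ) * b + b))]
      fun ω => c * ∑ t ∈ Finset.Ioc ((i : ℤ) * b + m) ((i : ℤ) * b + b), y t ω := by
    intro i
    refine Measurable.const_mul (Finset.measurable_sum _ fun t ht => ?_) _
    refine (hy.measurable t).mono (innovSigma_mono ?_) le_rfl
    intro u hu
    simp only [Set.mem_Ioc, Finset.mem_Ioc] at hu ht ⊢
    constructor <;> linarith [hu.1, hu.2, ht.1, ht.2]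
  rw [← charExp_sum_of_innovSigma hδ hi b hT k]
  congr 1
  ext ω
  rw [bigBlocks, Finset.sum_biUnion (pairwiseDisjoint_bigBlocks k b m), Finset.mul_sum]

lemma rms_sum_le_of_card {Z : ℤ → Ω → ℝ} {c : ℝ} (hc : 0 ≤ c)
    (hκ : ∀ A : Finset ℤ, ∫ ω, ‖∑ t ∈ A, Z t ω‖ ^ 2 ∂P ≤ c ^ 2 * A.card) (A : Finset ℤ) :
    rms P (fun ω => ∑ t ∈ A, Z t ω) ≤ c * Real.sqrt A.card := by
  refine rms_le_of_integral_le (by positivity) ?_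
  rw [mul_pow, Real.sq_sqrt (Nat.cast_nonneg _)]
  exact hκ A

/-- The two sums differ by the approximation error over the whole block and by the `m` discarded
terms of `y`, which accounts for `τ √b` and `(√κ + τ) √m`. -/
lemma abs_integral_sq_bigBlock_sub_le (hx : IsBlockRegular P δ x κ v)
    (hy2 : ∀ t, MemLp (y t) 2 P) (hτ : 0 ≤ τ)
    (hxy : ∀ A : Finset ℤ, ∫ ω, ‖∑ t ∈ A, (x t ω - y t ω)‖ ^ 2 ∂P ≤ τ ^ 2 * A.card)
    {b : ℕ} (hm : m ≤ b) (i : ℤ) :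
    |∫ ω, blockSum b (fun t => x t ω) i ^ 2 ∂P
        - ∫ ω, (∑ t ∈ Finset.Ioc (i + m) (i + b), y t ω) ^ 2 ∂P|
      ≤ (τ * Real.sqrt b + (Real.sqrt κ + τ) * Real.sqrt m)
        * (2 * (Real.sqrt κ + τ) * Real.sqrt b) := by
  have hκy := rms_sum_le_of_approx hx.memLp hy2 hτ hx.sum_sq_le hxy
  set c := Real.sqrt κ + τ with hc
  have hc0 : 0 ≤ c := add_nonneg (Real.sqrt_nonneg _) hτ
  have mS : MemLp (fun ω => blockSum b (fun t => x t ω) i) 2 P := memLp_blockSum hx.memLp b i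
  have mT : MemLp (fun ω => ∑ t ∈ Finset.Ioc (i + m) (i + b), y t ω) 2 P :=
    memLp_finsetSum _ fun t _ => hy2 t
  have mD : MemLp (fun ω => ∑ t ∈ Finset.Ioc i (i + b), (x t ω - y t ω)) 2 P :=
    memLp_finsetSum _ fun t _ => (hx.memLp t).sub (hy2 t)
  have mR : MemLp (fun ω => ∑ t ∈ Finset.Ioc i (i + m), y t ω) 2 P :=
    memLp_finsetSum _ fun t _ => hy2 t
  have e : ∀ ω, blockSum b (fun t => x t ω) i - ∑ t ∈ Finset.Ioc (i + m) (i + b), y t ω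
      = ∑ t ∈ Finset.Ioc i (i + b), (x t ω - y t ω) + ∑ t ∈ Finset.Ioc i (i + m), y t ω := by
    intro ω
    have hu : Finset.Ioc i (i + (b : ℤ)) = Finset.Ioc i (i + (m : ℤ))
        ∪ Finset.Ioc (i + (m : ℤ)) (i + b) :=
      (Finset.Ioc_union_Ioc_eq_Ioc (by omega) (by omega)).symm
    have hs : ∑ t ∈ Finset.Ioc i (i + b), y t ω = ∑ t ∈ Finset.Ioc i (i + m), y t ω
        + ∑ t ∈ Finset.Ioc (i + m) (i + b), y t ω := by
      rw [hu, Finset.sum_union]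
      refine Finset.disjoint_left.2 fun t h1 h2 => ?_
      simp only [Finset.mem_Ioc] at h1 h2
      omega
    rw [blockSum_eq_sum_Ioc, Finset.sum_sub_distrib, hs]
    ring
  have card1 : (Finset.Ioc i (i + (b : ℤ))).card = b := by simp
  have card2 : (Finset.Ioc i (i + (m : ℤ))).card = m := by simp
  have h1 : rms P (fun ω => blockSum b (fun t => x t ω) i
      - ∑ t ∈ Finset.Ioc (i + m) (i + b), y t ω) ≤ τ * Real.sqrt b + c * Real.sqrt m := by
    simp_rw [e]
    refine (rms_add_le mD mR).trans (add_le_add ?_ ?_)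
    · have := rms_sum_le_of_card (Z := fun t ω => x t ω - y t ω) hτ hxy (Finset.Ioc i (i + b))
      rwa [card1] at this
    · have := rms_sum_le_of_card hc0 hκy (Finset.Ioc i (i + m))
      rwa [card2] at this
  have h2 : rms P (fun ω => blockSum b (fun t => x t ω) i) ≤ c * Real.sqrt b :=
    (rms_blockSum_le hx.sum_sq_le b i).trans
      (mul_le_mul_of_nonneg_right (by linarith) (Real.sqrt_nonneg _))
  have h3 : rms P (fun ω => ∑ t ∈ Finset.Ioc (i + m) (i + b), y t ω) ≤ c * Real.sqrt b := by
    refine (rms_sum_le_of_card hc0 hκy _).trans (mul_le_mul_of_nonneg_left ?_ hc0)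
    refine Real.sqrt_le_sqrt (Nat.cast_le.2 ?_)
    rw [Int.card_Ioc]; omega
  rw [← integral_sub mS.integrable_sq mT.integrable_sq]
  refine abs_integral_le_integral_abs.trans ((integral_abs_sq_sub_sq_le mS mT).trans ?_)
  calc _ ≤ (τ * Real.sqrt b + c * Real.sqrt m) * (c * Real.sqrt b + c * Real.sqrt b) :=
        mul_le_mul h1 (add_le_add h2 h3) (add_nonneg (rms_nonneg _) (rms_nonneg _))
          (by positivity)
    _ = _ := by ring

lemma sqrt_smul_sampleMean {E : Type*} [NormedAddCommGroup E] [InnerProductSpace ℝ E]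
    (n : ℕ) (x : ℤ → E) :
    Real.sqrt n • sampleMean n x = (Real.sqrt n)⁻¹ • ∑ t ∈ Finset.Ioc (0 : ℤ) n, x t := by
  have h := blockSum_eq_sum_Ioc n x 0
  rw [zero_add] at h
  rw [← h, sampleMean, smul_smul, blockSum]
  have h1 : Real.sqrt n * (n : ℝ)⁻¹ = (Real.sqrt n)⁻¹ := by
    rcases Nat.eq_zero_or_pos n with rfl | hn
    · simp
    · have hs : (0 : ℝ) < Real.sqrt n := Real.sqrt_pos.2 (by exact_mod_cast hn)
      nth_rewrite 2 [← Real.mul_self_sqrt (Nat.cast_nonneg n)]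
      field_simp
  rw [h1]
  congr 1
  exact Finset.sum_congr rfl fun j _ => by congr 1; ring

/-- The `k m` discarded indices cost `√(k m) / √(k b) = √m / √b`, which vanishes as `b → ∞`. The big
blocks are independent and of size at most `B b / √n`, so their sum is nearly Gaussian with variance
`s`. Finally `s` is compared with `v` through the untruncated block sums of `x`. -/
lemma norm_charExp_mean_sub_le (hδ : ∀ t, Measurable (δ t)) (hi : iIndepFun δ P)
    (hx : IsBlockRegular P δ x κ v) (hy : IsBddMDependent P δ m B y) (hτ : 0 ≤ τ)
    (hxy : ∀ A : Finset ℤ, ∫ ω, ‖∑ t ∈ A, (x t ω - y t ω)‖ ^ 2 ∂P ≤ τ ^ 2 * A.card)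
    {k b : ℕ} (hk : 0 < k) (hb : 0 < b) (hm : m ≤ b)
    (hM : B * (b / Real.sqrt ((k * b : ℕ) : ℝ)) ≤ 1) :
    ‖charExp P (fun ω => Real.sqrt ((k * b : ℕ) : ℝ) • sampleMean (k * b) fun t => x t ω)
        - Complex.exp ((-v / 2 : ℝ))‖
      ≤ τ * (1 + 2 * (Real.sqrt κ + τ))
        + (Real.sqrt κ + τ) * (1 + 2 * (Real.sqrt κ + τ)) * Real.sqrt m * (Real.sqrt b)⁻¹
        + B * (b / Real.sqrt ((k * b : ℕ) : ℝ)) * (Real.sqrt κ + τ) ^ 2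
        + |(b : ℝ)⁻¹ * ∫ ω, blockSum b (fun t => x t ω) 0 ^ 2 ∂P - v| := by
  have hy2 : ∀ t, MemLp (y t) 2 P := fun t => hy.memLp hδ t 2
  have hκy := rms_sum_le_of_approx hx.memLp hy2 hτ hx.sum_sq_le hxy
  have hB0 : 0 ≤ B := by
    obtain ⟨ω⟩ : Nonempty Ω := P.nonempty_of_neZero
    exact (abs_nonneg _).trans (hy.bdd 0 ω)
  simp_rw [sqrt_smul_sampleMean, smul_eq_mul]
  set c := Real.sqrt κ + τ with hc
  have hc0 : 0 ≤ c := add_nonneg (Real.sqrt_nonneg _) hτ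
  set n := k * b with hn
  have hk' : (0 : ℝ) < k := by exact_mod_cast hk
  have hb' : (0 : ℝ) < b := by exact_mod_cast hb
  have hsb : 0 < Real.sqrt b := Real.sqrt_pos.2 hb'
  have hnR : (n : ℝ) = k * b := by rw [hn]; push_cast; rfl
  have hn0 : (0 : ℝ) < n := by rw [hnR]; positivity
  have hsn : 0 < Real.sqrt n := Real.sqrt_pos.2 hn0
  have hsnn : Real.sqrt n * Real.sqrt n = n := Real.mul_self_sqrt hn0.le
  set M := B * (b / Real.sqrt n) with hMdef
  have hM0 : 0 ≤ M := by positivity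
  set T : ℕ → Ω → ℝ := fun i ω => (Real.sqrt n)⁻¹ *
    ∑ t ∈ Finset.Ioc ((i : ℤ) * b + m) ((i : ℤ) * b + b), y t ω with hT
  have mX : MemLp (fun ω => ∑ t ∈ Finset.Ioc (0 : ℤ) n, x t ω) 2 P :=
    memLp_finsetSum _ fun t _ => hx.memLp t
  have mY : MemLp (fun ω => ∑ t ∈ Finset.Ioc (0 : ℤ) n \ bigBlocks k b m, y t ω) 2 P :=
    memLp_finsetSum _ fun t _ => hy2 t
  have mD : MemLp (fun ω => ∑ t ∈ Finset.Ioc (0 : ℤ) n, (x t ω - y t ω)) 2 P :=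
    memLp_finsetSum _ fun t _ => (hx.memLp t).sub (hy2 t)
  have mV : MemLp (fun ω => ∑ t ∈ bigBlocks k b m, y t ω) 2 P :=
    memLp_finsetSum _ fun t _ => hy2 t
  have mT : ∀ i, MemLp (fun ω => ∑ t ∈ Finset.Ioc ((i : ℤ) * b + m) ((i : ℤ) * b + b), y t ω) 2 P :=
    fun i => memLp_finsetSum _ fun t _ => hy2 t
  -- removal of the approximation error and of the small blocks
  have h1 : ‖charExp P (fun ω => (Real.sqrt n)⁻¹ * ∑ t ∈ Finset.Ioc (0 : ℤ) n, x t ω)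
      - charExp P (fun ω => (Real.sqrt n)⁻¹ * ∑ t ∈ bigBlocks k b m, y t ω)‖
      ≤ τ + c * Real.sqrt m * (Real.sqrt b)⁻¹ := by
    refine (norm_charExp_sub_le (mX.const_mul _) (mV.const_mul _)).trans ?_
    have e : ∀ ω, (Real.sqrt n)⁻¹ * ∑ t ∈ Finset.Ioc (0 : ℤ) n, x t ω
        - (Real.sqrt n)⁻¹ * ∑ t ∈ bigBlocks k b m, y t ω
        = (Real.sqrt n)⁻¹ • (∑ t ∈ Finset.Ioc (0 : ℤ) n, (x t ω - y t ω)
          + ∑ t ∈ Finset.Ioc (0 : ℤ) n \ bigBlocks k b m, y t ω) := by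
      intro ω
      have := Finset.sum_sdiff (f := fun t => y t ω) (bigBlocks_subset k b m)
      rw [Finset.sum_sub_distrib, ← this, smul_eq_mul]
      ring
    simp_rw [e]
    rw [rms_const_smul, abs_of_pos (inv_pos.2 hsn)]
    have h2 : rms P (fun ω => ∑ t ∈ Finset.Ioc (0 : ℤ) n, (x t ω - y t ω))
        ≤ τ * Real.sqrt n := by
      have := rms_sum_le_of_card (Z := fun t ω => x t ω - y t ω) hτ hxy (Finset.Ioc (0 : ℤ) n)
      simpa using this
    have h3 : rms P (fun ω => ∑ t ∈ Finset.Ioc (0 : ℤ) n \ bigBlocks k b m, y t ω)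
        ≤ c * (Real.sqrt k * Real.sqrt m) := by
      have := rms_sum_le_of_card hc0 hκy (Finset.Ioc (0 : ℤ) n \ bigBlocks k b m)
      rwa [card_sdiff_bigBlocks hm, show ((k * m : ℕ) : ℝ) = k * m from Nat.cast_mul k m,
        Real.sqrt_mul hk'.le] at this
    have hkb : Real.sqrt n = Real.sqrt k * Real.sqrt b := by
      rw [hnR, Real.sqrt_mul hk'.le]
    have hsk : 0 < Real.sqrt k := Real.sqrt_pos.2 hk'
    calc (Real.sqrt n)⁻¹ * _ ≤ (Real.sqrt n)⁻¹ * (τ * Real.sqrt n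
          + c * (Real.sqrt k * Real.sqrt m)) :=
          mul_le_mul_of_nonneg_left ((rms_add_le mD mY).trans (add_le_add h2 h3))
            (inv_nonneg.2 hsn.le)
      _ = _ := by rw [hkb]; field_simp
  -- Gaussian approximation of the sum over the big blocks
  have hTb : ∀ i ω, |T i ω| ≤ M := fun i ω => by
    rw [hT]
    dsimp only
    rw [abs_mul, abs_of_pos (inv_pos.2 hsn), hMdef]
    have : |∑ t ∈ Finset.Ioc ((i : ℤ) * b + m) ((i : ℤ) * b + b), y t ω| ≤ b * B := by
      refine (Finset.abs_sum_le_sum_abs _ _).trans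
        ((Finset.sum_le_card_nsmul _ _ B fun t _ => hy.bdd t ω).trans ?_)
      rw [nsmul_eq_mul]
      refine mul_le_mul_of_nonneg_right (Nat.cast_le.2 ?_) hB0
      rw [Int.card_Ioc]; omega
    calc (Real.sqrt n)⁻¹ * _ ≤ (Real.sqrt n)⁻¹ * (b * B) :=
          mul_le_mul_of_nonneg_left this (inv_nonneg.2 hsn.le)
      _ = _ := by ring
  have hT0 : ∀ i, ∫ ω, T i ω ∂P = 0 := fun i => by
    rw [hT]
    dsimp only
    rw [integral_const_mul, integral_finsetSum _ fun t _ => (hy2 t).integrable one_le_two]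
    simp [hy.integral_eq_zero]
  have hT2 : ∀ i, ∫ ω, T i ω ^ 2 ∂P = (n : ℝ)⁻¹ *
      ∫ ω, (∑ t ∈ Finset.Ioc ((i : ℤ) * b + m) ((i : ℤ) * b + b), y t ω) ^ 2 ∂P := fun i => by
    simp only [hT, mul_pow]
    rw [integral_const_mul, inv_pow, sq, hsnn]
  have h4 := norm_prod_charExp_sub_gaussian_le (Finset.range k)
    (fun i => ((mT i).const_mul (Real.sqrt n)⁻¹).1) hM hTb hT0
  rw [← hy.charExp_bigBlocks hδ hi k b] at h4
  set s := ∑ i ∈ Finset.range k, ∫ ω, T i ω ^ 2 ∂P with hs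
  have hs0 : 0 ≤ s := Finset.sum_nonneg fun i _ => integral_nonneg fun _ => sq_nonneg _
  have hsc : s ≤ c ^ 2 := by
    calc s ≤ ∑ _i ∈ Finset.range k, (n : ℝ)⁻¹ * (c ^ 2 * b) := by
          refine Finset.sum_le_sum fun i _ => ?_
          rw [hT2]
          refine mul_le_mul_of_nonneg_left ?_ (by positivity)
          have := hκy (Finset.Ioc ((i : ℤ) * b + m) ((i : ℤ) * b + b))
          simp only [Real.norm_eq_abs, sq_abs] at this
          refine this.trans (mul_le_mul_of_nonneg_left (Nat.cast_le.2 ?_) (by positivity))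
          rw [Int.card_Ioc]; omega
      _ = c ^ 2 := by
          rw [Finset.sum_const, Finset.card_range, nsmul_eq_mul, hnR]
          field_simp
  have h5 : |s - v| ≤ 2 * c * (τ + c * Real.sqrt m * (Real.sqrt b)⁻¹)
      + |(b : ℝ)⁻¹ * ∫ ω, blockSum b (fun t => x t ω) 0 ^ 2 ∂P - v| := by
    refine (abs_sub_le _ ((b : ℝ)⁻¹ * ∫ ω, blockSum b (fun t => x t ω) 0 ^ 2 ∂P) _).trans
      (add_le_add ?_ le_rfl)
    -- Block sums have the same second moment at every starting point, so the scaled variance of one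
    -- block is spread over the `k` blocks and compared with `s` term by term.
    have e1 : (b : ℝ)⁻¹ * ∫ ω, blockSum b (fun t => x t ω) 0 ^ 2 ∂P
        = ∑ i ∈ Finset.range k, (n : ℝ)⁻¹ *
          ∫ ω, blockSum b (fun t => x t ω) ((i : ℤ) * b) ^ 2 ∂P := by
      simp_rw [hx.blockSum_sq b]
      rw [Finset.sum_const, Finset.card_range, nsmul_eq_mul, hnR]
      field_simp
    rw [e1, hs, abs_sub_comm, ← Finset.sum_sub_distrib]
    calc _ ≤ ∑ _i ∈ Finset.range k, (n : ℝ)⁻¹ *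
          ((τ * Real.sqrt b + c * Real.sqrt m) * (2 * c * Real.sqrt b)) := by
          refine (Finset.abs_sum_le_sum_abs _ _).trans (Finset.sum_le_sum fun i _ => ?_)
          rw [hT2, ← mul_sub, abs_mul, abs_of_pos (inv_pos.2 hn0)]
          exact mul_le_mul_of_nonneg_left
            (abs_integral_sq_bigBlock_sub_le hx hy2 hτ hxy hm _) (by positivity)
      _ = 2 * c * (τ + c * Real.sqrt m * (Real.sqrt b)⁻¹) := by
          rw [Finset.sum_const, Finset.card_range, nsmul_eq_mul, hnR]
          nth_rewrite 1 [← Real.mul_self_sqrt hb'.le]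
          field_simp
  have h6 := norm_exp_neg_half_sub_le hs0 hx.nonneg
  have h7 : M * s ≤ M * c ^ 2 := mul_le_mul_of_nonneg_left hsc hM0
  refine (norm_sub_le_norm_sub_add_norm_sub _ _ _).trans ((add_le_add h1
      ((norm_sub_le_norm_sub_add_norm_sub _ _ _).trans
        (add_le_add (h4.trans h7) (h6.trans h5)))).trans_eq ?_)
  ring

/-- Central limit theorem for the sample mean, on the level of characteristic functions. -/
lemma IsBlockRegular.tendsto_charExp_mean (hδ : ∀ t, Measurable (δ t)) (hi : iIndepFun δ P)
    (hx : IsBlockRegular P δ x κ v) {k b : ℕ → ℕ}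
    (hn : Tendsto (fun j => k j * b j) atTop atTop) (hb : Tendsto b atTop atTop)
    (hbn : Tendsto (fun j => (b j : ℝ) / Real.sqrt ((k j * b j : ℕ) : ℝ)) atTop (𝓝 0)) :
    Tendsto (fun j => charExp P
      (fun ω => Real.sqrt ((k j * b j : ℕ) : ℝ) • sampleMean (k j * b j) fun t => x t ω))
      atTop (𝓝 (Complex.exp ((-v / 2 : ℝ)))) := by
  rw [tendsto_iff_norm_sub_tendsto_zero, Metric.tendsto_atTop']
  intro η hη
  -- With `τ ≤ 1` this controls the only error term that does not vanish as `j → ∞` for fixed `m`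
  -- and `B`.
  obtain ⟨τ, hτ0, hτ1, hτ⟩ := exists_pos_small (1 + 2 * (Real.sqrt κ + 1)) (half_pos hη)
  obtain ⟨m, B, y, hy, hxy⟩ := hx.approx (τ ^ 2) (by positivity)
  set c := Real.sqrt κ + τ with hc
  have hM : Tendsto (fun j => B * ((b j : ℝ) / Real.sqrt ((k j * b j : ℕ) : ℝ))) atTop
      (𝓝 0) := by simpa using hbn.const_mul B
  have hsb : Tendsto (fun j => (Real.sqrt (b j : ℝ))⁻¹) atTop (𝓝 0) :=
    tendsto_inv_atTop_zero.comp (Real.tendsto_sqrt_atTop.comp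
      (tendsto_natCast_atTop_atTop.comp hb))
  have h3 := ((hx.tendsto.comp hb).sub_const v).abs
  have hR := ((hsb.const_mul (c * (1 + 2 * c) * Real.sqrt m)).add (hM.mul_const (c ^ 2))).add h3
  simp only [mul_zero, zero_mul, sub_self, abs_zero, add_zero] at hR
  have hev : ∀ᶠ j in atTop, dist ‖charExp P (fun ω => Real.sqrt ((k j * b j : ℕ) : ℝ) •
      sampleMean (k j * b j) fun t => x t ω) - Complex.exp ((-v / 2 : ℝ))‖ 0 < η := by
    filter_upwards [hR.eventually (gt_mem_nhds (half_pos hη)), eventually_pos_of_tendsto_mul hn,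
      hM.eventually (gt_mem_nhds one_pos), hb.eventually_ge_atTop m] with j hj ⟨hkj, hbj⟩ hMj hmj
    rw [Real.dist_0_eq_abs, abs_of_nonneg (norm_nonneg _)]
    refine (norm_charExp_mean_sub_le hδ hi hx hy hτ0.le hxy hkj hbj hmj hMj.le).trans_lt ?_
    simp only [Function.comp] at hj
    nlinarith [Real.sqrt_nonneg κ]
  obtain ⟨N, hN⟩ := eventually_atTop.1 hev
  exact ⟨N, fun j hj => hN j hj.le⟩

end MeanCharacteristicFunction

/-! ### One-dimensional projections satisfy the scalar hypotheses. -/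

section BlockRegularity

variable {Ω S E : Type*} [MeasurableSpace Ω] [MeasurableSpace S]
  [NormedAddCommGroup E] [InnerProductSpace ℝ E]

lemma sqrt_natCast_mul_self (n : ℕ) : Real.sqrt n * Real.sqrt n = n :=
  Real.mul_self_sqrt (Nat.cast_nonneg n)

lemma meanCovOp_eq_expTensor (P : Measure Ω) (X : ℤ → Ω → E) (n : ℕ) :
    meanCovOp P X n = expTensor P (fun ω => Real.sqrt n • sampleMean n fun t => X t ω)
      (fun ω => Real.sqrt n • sampleMean n fun t => X t ω) := by
  rw [expTensor_smul_smul, sqrt_natCast_mul_self, meanCovOp]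

lemma bootCovOp_eq_expTensor (k b : ℕ) (x : ℤ → E) :
    bootCovOp k b x = expTensor (blockIndexLaw k b)
      (fun I => Real.sqrt ((k * b : ℕ) : ℝ) • bootCentered k b x I)
      (fun I => Real.sqrt ((k * b : ℕ) : ℝ) • bootCentered k b x I) := by
  rw [expTensor_smul_smul, sqrt_natCast_mul_self, bootCovOp]

variable {P : Measure Ω}

lemma memLp_sampleMean {X : ℤ → Ω → E} (hX : ∀ t, MemLp (X t) 2 P) (n : ℕ) :
    MemLp (fun ω => Real.sqrt n • sampleMean n fun t => X t ω) 2 P := by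
  have h : MemLp (fun ω => ∑ t ∈ Finset.range n, X (t + 1) ω) 2 P :=
    memLp_finsetSum _ fun t _ => hX _
  exact (h.const_smul _).const_smul _

lemma integral_norm_sq_sampleMean_le {X : ℤ → Ω → E} {κ : ℝ}
    (hκ : ∀ A : Finset ℤ, ∫ ω, ‖∑ t ∈ A, X t ω‖ ^ 2 ∂P ≤ κ * A.card) {n : ℕ} (hn : 0 < n) :
    ∫ ω, ‖Real.sqrt n • sampleMean n fun t => X t ω‖ ^ 2 ∂P ≤ κ := by
  have hn' : (0 : ℝ) < n := by exact_mod_cast hn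
  simp_rw [sqrt_smul_sampleMean, norm_smul, mul_pow, norm_inv, inv_pow, Real.norm_eq_abs, sq_abs,
    Real.sq_sqrt hn'.le]
  rw [integral_const_mul, inv_mul_le_iff₀ hn']
  have := hκ (Finset.Ioc (0 : ℤ) n)
  rw [Int.card_Ioc] at this
  simp only [sub_zero, Int.toNat_natCast] at this
  linarith

variable [MeasurableSpace E] [BorelSpace E] [SecondCountableTopology E] [IsProbabilityMeasure P]
  {δ : ℤ → Ω → S} {f : (ℕ → S) → E} [CompleteSpace E]

/-- Reduces the Hilbert space problem to scalar ones. The long-run variance in direction `u` is the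
quadratic form of the long-run covariance operator, obtained by evaluating the operator norm limit
of `meanCovOp` at `u`. -/
lemma IsStronglyL2mApproximable.isBlockRegular_inner
    (h : IsStronglyL2mApproximable P (causalProc δ f) δ f)
    (hmean : ∀ t, ∫ ω, causalProc δ f t ω ∂P = 0) (u : E) :
    IsBlockRegular P δ (fun t ω => inner ℝ u (causalProc δ f t ω))
      (2 * rms P (fun ω => innerSL ℝ u (causalProc δ f 0 ω))
        * (‖innerSL ℝ u‖ * ∑' m, couplingError P (causalProc δ f) δ f 0 m))
      (inner ℝ ((∑' i, autocovOp P (causalProc δ f) i) u) u) where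
  memLp t := ((innerSL ℝ u).comp_memLp' (h.memLp_causalProc t))
  sum_sq_le A := h.integral_norm_sum_clm_sq_le hmean (innerSL ℝ u) A
  approx ε hε := by
    obtain ⟨m, B, y, hy, hxy⟩ := h.exists_bddMDependent hmean (innerSL ℝ u) hε
    refine ⟨m, B, y, hy, fun A => ?_⟩
    simpa [sq_abs] using hxy A
  blockSum_sq b i := by
    have h1 := h.integral_causalProc_shift
      (φ := fun x : ℤ → E => blockSum b (fun t => inner ℝ u (x t)) 0 ^ 2)
      (by unfold blockSum; fun_prop) i
    rw [← h1]
    simp only [blockSum, zero_add, ← add_assoc]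
  tendsto := by
    have hev : Continuous fun T : E →L[ℝ] E => inner ℝ (T u) u := by fun_prop
    refine ((hev.tendsto _).comp (h.tendsto_meanCovOp hmean)).congr fun n => ?_
    have hm := memLp_sampleMean (P := P) (fun t => h.memLp_causalProc t) n
    simp only [Function.comp]
    rw [meanCovOp_eq_expTensor, inner_expTensor hm hm, ← integral_const_mul]
    refine integral_congr_ae (ae_of_all _ fun ω => ?_)
    dsimp only
    rw [sqrt_smul_sampleMean, real_inner_comm, inner_smul_right, blockSum_eq_sum_Ioc, zero_add,
      inner_sum]
    have : ((n : ℝ))⁻¹ = (Real.sqrt n)⁻¹ * (Real.sqrt n)⁻¹ := by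
      rw [← mul_inv, sqrt_natCast_mul_self]
    rw [this]
    ring

end BlockRegularity

/-! ### Tightness, and weak convergence from characteristic functions. -/

section TightSets

variable {E : Type*} [NormedAddCommGroup E] [InnerProductSpace ℝ E] [CompleteSpace E]

lemma norm_sub_starProjection_orthogonal (U : Submodule ℝ E) [U.HasOrthogonalProjection] (x : E) :
    x - U.starProjection x = Uᗮ.starProjection x := by
  rw [sub_eq_iff_eq_add', Submodule.starProjection_add_starProjection_orthogonal]

/-- A bounded closed set which is uniformly close to finite-dimensional subspaces is compact. -/
lemma isCompact_of_close_to_finiteDimensional {U : ℕ → Submodule ℝ E}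
    (hU : ∀ r, FiniteDimensional ℝ (U r)) (R : ℝ) {a : ℕ → ℝ} (ha : Tendsto a atTop (𝓝 0)) :
    IsCompact {x : E | ‖x‖ ≤ R ∧ ∀ r, ‖(U r)ᗮ.starProjection x‖ ≤ a r} := by
  refine TotallyBounded.isCompact_of_isClosed ?_ ?_
  · rw [Metric.totallyBounded_iff]
    intro ε hε
    obtain ⟨r, hr⟩ := (ha.eventually (gt_mem_nhds (half_pos hε))).exists
    have hc : IsCompact ((Subtype.val : U r → E) '' Metric.closedBall 0 R) :=
      (isCompact_closedBall _ _).image continuous_subtype_val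
    obtain ⟨t, ht, hcov⟩ := Metric.totallyBounded_iff.1 hc.totallyBounded _ (half_pos hε)
    refine ⟨t, ht, fun x hx => ?_⟩
    have hmem : (U r).starProjection x ∈ (Subtype.val : U r → E) '' Metric.closedBall 0 R := by
      refine ⟨⟨_, (U r).starProjection_apply_mem x⟩, ?_, rfl⟩
      rw [mem_closedBall_zero_iff]
      exact ((U r).norm_starProjection_apply_le x).trans hx.1
    obtain ⟨y, hy, hxy⟩ := Set.mem_iUnion₂.1 (hcov hmem)
    refine Set.mem_iUnion₂.2 ⟨y, hy, ?_⟩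
    rw [Metric.mem_ball] at hxy ⊢
    calc dist x y ≤ dist x ((U r).starProjection x) + dist ((U r).starProjection x) y :=
          dist_triangle _ _ _
      _ < ε / 2 + ε / 2 := by
          refine add_lt_add_of_le_of_lt ?_ hxy
          rw [dist_eq_norm, norm_sub_starProjection_orthogonal]
          exact (hx.2 r).trans hr.le
      _ = ε := add_halves ε
  · rw [Set.ofPred_and, Set.ofPred_forall]
    exact (isClosed_le continuous_norm continuous_const).inter
      (isClosed_iInter fun r => isClosed_le (by fun_prop) continuous_const)

/-- Approximate `Z` in mean square by a simple function and take the span of its finite range. The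
projection onto the orthogonal complement kills the simple function and contracts the difference. -/
lemma exists_finiteDimensional_rms_le {Ω : Type*} [MeasurableSpace Ω] {P : Measure Ω}
    [IsProbabilityMeasure P] {Z : Ω → E} (hZ : MemLp Z 2 P) {ε : ℝ} (hε : 0 < ε) :
    ∃ U : Submodule ℝ E, FiniteDimensional ℝ U ∧
      rms P (fun ω => Uᗮ.starProjection (Z ω)) ≤ ε := by
  obtain ⟨g, hg, hg2⟩ := hZ.exists_simpleFunc_eLpNorm_sub_lt ENNReal.ofNat_ne_top
    (ε := ENNReal.ofReal ε) (by simpa using hε)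
  refine ⟨Submodule.span ℝ (Set.range g), FiniteDimensional.span_of_finite ℝ g.finite_range, ?_⟩
  set U := Submodule.span ℝ (Set.range g) with hU
  have : FiniteDimensional ℝ U := FiniteDimensional.span_of_finite ℝ g.finite_range
  have h1 : rms P (fun ω => Z ω - g ω) ≤ ε := by
    rw [(hZ.sub hg2).eLpNorm_eq_integral_rpow_norm two_ne_zero ENNReal.ofNat_ne_top,
      ENNReal.ofReal_lt_ofReal_iff hε] at hg
    refine le_trans (le_of_eq ?_) hg.le
    rw [rms, Real.sqrt_eq_rpow]
    simp
  refine le_trans (rms_mono (hZ.sub hg2) (ae_of_all _ fun ω => ?_)) h1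
  have h0 : Uᗮ.starProjection (g ω) = 0 :=
    Uᗮ.starProjection_apply_eq_zero_iff.2 (Submodule.le_orthogonal_orthogonal U
      (Submodule.subset_span (Set.mem_range_self ω)))
  have h2 : Uᗮ.starProjection (Z ω) = Uᗮ.starProjection (Z ω - g ω) := by
    rw [map_sub, h0, sub_zero]
  rw [h2]
  exact Uᗮ.norm_starProjection_apply_le _

variable [MeasurableSpace E] [BorelSpace E]

/-- Probability measures with second moments at most `C` and small mean square distances from the
subspaces `U r`. -/
def tightSet (C : ℝ) (U : ℕ → Submodule ℝ E) : Set (ProbabilityMeasure E) :=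
  {μ | ∫⁻ x, ‖x‖ₑ ^ 2 ∂(μ : Measure E) ≤ ENNReal.ofReal C ∧
    ∀ r, ∫⁻ x, ‖(U r)ᗮ.starProjection x‖ₑ ^ 2 ∂(μ : Measure E) ≤ ENNReal.ofReal ((1 / 8) ^ r)}

lemma enorm_sq_eq_ofReal {F : Type*} [NormedAddCommGroup F] (x : F) :
    ‖x‖ₑ ^ 2 = ENNReal.ofReal (‖x‖ ^ 2) := by
  rw [← ofReal_norm, ENNReal.ofReal_pow (norm_nonneg _)]

lemma measure_norm_sq_gt_le {μ : Measure E} (L : E →L[ℝ] E) {a c : ℝ} (hc : 0 < c)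
    (h : ∫⁻ x, ‖L x‖ₑ ^ 2 ∂μ ≤ ENNReal.ofReal a) :
    μ {x | c < ‖L x‖ ^ 2} ≤ ENNReal.ofReal (a / c) := by
  have hm : AEMeasurable (fun x => ‖L x‖ₑ ^ 2) μ := by
    have := L.continuous.measurable
    fun_prop
  calc μ {x | c < ‖L x‖ ^ 2} ≤ μ {x | ENNReal.ofReal c ≤ ‖L x‖ₑ ^ 2} := by
        refine measure_mono fun x hx => ?_
        simp only [Set.mem_ofPred_eq] at hx ⊢
        rw [enorm_sq_eq_ofReal]
        exact ENNReal.ofReal_le_ofReal hx.le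
    _ ≤ (∫⁻ x, ‖L x‖ₑ ^ 2 ∂μ) / ENNReal.ofReal c :=
        meas_ge_le_lintegral_div hm (by simpa using hc) ENNReal.ofReal_ne_top
    _ ≤ ENNReal.ofReal a / ENNReal.ofReal c := ENNReal.div_le_div_right h _
    _ = _ := (ENNReal.ofReal_div_of_pos hc).symm

lemma tsum_ofReal_half_pow_mul_le {c : ℝ} (hc : 0 ≤ c) :
    ∑' r : ℕ, ENNReal.ofReal (c * (1 / 2) ^ r) = ENNReal.ofReal (2 * c) := by
  rw [← ENNReal.ofReal_tsum_of_nonneg (fun r => by positivity)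
    (summable_geometric_two.mul_left c), tsum_mul_left, tsum_geometric_two, mul_comm]

lemma isTightMeasureSet_tightSet {C : ℝ} (hC : 0 ≤ C) {U : ℕ → Submodule ℝ E}
    (hU : ∀ r, FiniteDimensional ℝ (U r)) :
    IsTightMeasureSet {((μ : ProbabilityMeasure E) : Measure E) | μ ∈ tightSet C U} := by
  rw [isTightMeasureSet_iff_exists_isCompact_measure_compl_le]
  intro ε hε
  obtain ⟨T, hT, hTε⟩ : ∃ T : ℝ, 0 < T ∧ ENNReal.ofReal ((C + 2) / T) ≤ ε := by
    rcases eq_or_ne ε ∞ with rfl | h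
    · exact ⟨1, one_pos, le_top⟩
    · have h0 := ENNReal.toReal_pos hε.ne' h
      refine ⟨(C + 2) / ε.toReal, by positivity, ?_⟩
      rw [div_div_cancel₀ (by positivity), ENNReal.ofReal_toReal h]
  -- Markov's inequality for a second moment `(1 / 8) ^ r` at level `T (1 / 4) ^ r` leaves
  -- probability `(1 / 2) ^ r / T`. These sum to `2 / T`, which explains `C + 2` in the choice of
  -- `T`.
  have ha : Tendsto (fun r : ℕ => Real.sqrt (T * (1 / 4) ^ r)) atTop (𝓝 0) := by
    have h1 : Tendsto (fun r : ℕ => T * (1 / 4 : ℝ) ^ r) atTop (𝓝 0) := by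
      simpa using (tendsto_pow_atTop_nhds_zero_of_lt_one (r := (1 / 4 : ℝ)) (by norm_num)
        (by norm_num)).const_mul T
    have := (Real.continuous_sqrt.tendsto _).comp h1
    simpa [Function.comp_def] using this
  refine ⟨_, isCompact_of_close_to_finiteDimensional hU (Real.sqrt T) ha, ?_⟩
  rintro _ ⟨μ, ⟨hμ, hμU⟩, rfl⟩
  have hsub : {x : E | ‖x‖ ≤ Real.sqrt T ∧
      ∀ r, ‖(U r)ᗮ.starProjection x‖ ≤ Real.sqrt (T * (1 / 4) ^ r)}ᶜ
      ⊆ {x | T < ‖ContinuousLinearMap.id ℝ E x‖ ^ 2}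
        ∪ ⋃ r, {x | T * (1 / 4) ^ r < ‖(U r)ᗮ.starProjection x‖ ^ 2} := by
    intro x hx
    by_contra hcon
    simp only [Set.mem_union, Set.mem_iUnion, Set.mem_ofPred_eq, not_or, not_exists, not_lt,
      ContinuousLinearMap.id_apply] at hcon
    exact hx ⟨Real.le_sqrt_of_sq_le hcon.1, fun r => Real.le_sqrt_of_sq_le (hcon.2 r)⟩
  calc (μ : Measure E) _ ≤ (μ : Measure E) {x | T < ‖ContinuousLinearMap.id ℝ E x‖ ^ 2}
        + ∑' r, (μ : Measure E) {x | T * (1 / 4) ^ r < ‖(U r)ᗮ.starProjection x‖ ^ 2} :=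
        (measure_mono hsub).trans ((measure_union_le _ _).trans
          (add_le_add le_rfl (measure_iUnion_le _)))
    _ ≤ ENNReal.ofReal (C / T) + ∑' r : ℕ, ENNReal.ofReal (1 / T * (1 / 2) ^ r) := by
        refine add_le_add (measure_norm_sq_gt_le _ hT hμ) (ENNReal.tsum_le_tsum fun r => ?_)
        refine (measure_norm_sq_gt_le _ (by positivity) (hμU r)).trans_eq ?_
        congr 1
        rw [div_mul_eq_div_div, mul_comm (1 / T), div_right_comm, ← div_pow]
        norm_num
        ring
    _ = ENNReal.ofReal ((C + 2) / T) := by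
        rw [tsum_ofReal_half_pow_mul_le (by positivity), ← ENNReal.ofReal_add (by positivity)
          (by positivity)]
        congr 1
        ring
    _ ≤ ε := hTε

lemma isCompact_closure_tightSet {C : ℝ} (hC : 0 ≤ C) {U : ℕ → Submodule ℝ E}
    (hU : ∀ r, FiniteDimensional ℝ (U r)) : IsCompact (closure (tightSet C U)) :=
  isCompact_closure_of_isTightMeasureSet (isTightMeasureSet_tightSet hC hU)

/-- Random probability measures are close to a tight set with large probability if their second
moments are. -/
lemma measure_notMem_tightSet_le {Ω : Type*} [MeasurableSpace Ω] {P : Measure Ω}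
    {M : Ω → ProbabilityMeasure E} {C η : ℝ} (hC : 0 < C) (hη : 0 ≤ η) {U : ℕ → Submodule ℝ E}
    {g : Ω → ℝ} {q : ℕ → Ω → ℝ} (hgi : Integrable g P) (hqi : ∀ r, Integrable (q r) P)
    (hg0 : ∀ ω, 0 ≤ g ω) (hq0 : ∀ r ω, 0 ≤ q r ω)
    (hg : ∀ ω, ∫⁻ x, ‖x‖ₑ ^ 2 ∂(M ω : Measure E) ≤ ENNReal.ofReal (g ω))
    (hq : ∀ r ω, ∫⁻ x, ‖(U r)ᗮ.starProjection x‖ₑ ^ 2 ∂(M ω : Measure E)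
      ≤ ENNReal.ofReal (q r ω))
    (hgC : ∫ ω, g ω ∂P ≤ η * C) (hqr : ∀ r, ∫ ω, q r ω ∂P ≤ η * (1 / 16) ^ r) :
    P {ω | M ω ∉ tightSet C U} ≤ ENNReal.ofReal (3 * η) := by
  -- Here Markov's inequality is used over `Ω`: means `η (1 / 16) ^ r` against thresholds `(1 / 8) ^
  -- r` give `η (1 / 2) ^ r`, with sum `2 η`; the total moment contributes one more `η`.
  have hsub : {ω | M ω ∉ tightSet C U} ⊆ {ω | C ≤ |g ω|} ∪ ⋃ r, {ω | (1 / 8) ^ r ≤ |q r ω|} := by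
    intro ω hω
    by_contra hcon
    simp only [Set.mem_union, Set.mem_iUnion, Set.mem_ofPred_eq, not_or, not_exists, not_le,
      abs_of_nonneg (hg0 ω), abs_of_nonneg (hq0 _ ω)] at hcon
    exact hω ⟨(hg ω).trans (ENNReal.ofReal_le_ofReal hcon.1.le),
      fun r => (hq r ω).trans (ENNReal.ofReal_le_ofReal (hcon.2 r).le)⟩
  calc P _ ≤ P {ω | C ≤ |g ω|} + ∑' r, P {ω | (1 / 8) ^ r ≤ |q r ω|} :=
        (measure_mono hsub).trans ((measure_union_le _ _).trans
          (add_le_add le_rfl (measure_iUnion_le _)))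
    _ ≤ ENNReal.ofReal (η * C / C) + ∑' r : ℕ, ENNReal.ofReal (η * (1 / 2) ^ r) := by
        refine add_le_add (measure_le_of_integral_le hgi (fun ω => (abs_of_nonneg (hg0 ω)).le)
          hC hgC) (ENNReal.tsum_le_tsum fun r => ?_)
        refine (measure_le_of_integral_le (hqi r) (fun ω => (abs_of_nonneg (hq0 r ω)).le)
          (by positivity) (hqr r)).trans_eq ?_
        rw [mul_div_assoc, ← div_pow]
        norm_num
    _ = ENNReal.ofReal (3 * η) := by
        rw [tsum_ofReal_half_pow_mul_le hη, mul_div_cancel_right₀ _ hC.ne',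
          ← ENNReal.ofReal_add hη (by positivity)]
        congr 1
        ring

variable [SecondCountableTopology E]

lemma continuous_charFun_probabilityMeasure (u : E) :
    Continuous fun μ : ProbabilityMeasure E => charFun (μ : Measure E) u := by
  refine continuous_iff_continuousAt.2 fun μ => ?_
  simp only [ContinuousAt, charFun_eq_integral_innerProbChar]
  exact (ProbabilityMeasure.tendsto_iff_forall_integral_rclike_tendsto ℂ).1 tendsto_id
    (BoundedContinuousFunction.innerProbChar u)

lemma ProbabilityMeasure.ext_charFun {μ ν : ProbabilityMeasure E}
    (h : ∀ u, charFun (μ : Measure E) u = charFun (ν : Measure E) u) : μ = ν :=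
  Subtype.ext (show (μ : Measure E) = ν from Measure.ext_of_charFun (funext h))

/-- A sequence of probability measures which is eventually in a compact set converges weakly if its
characteristic functions converge pointwise. -/
lemma exists_tendsto_of_tendsto_charFun {μs : ℕ → ProbabilityMeasure E}
    {K : Set (ProbabilityMeasure E)} (hK : IsCompact K) (hmem : ∀ᶠ j in atTop, μs j ∈ K)
    {φ : E → ℂ} (hφ : ∀ u, Tendsto (fun j => charFun (μs j : Measure E) u) atTop (𝓝 (φ u))) :
    ∃ γ : ProbabilityMeasure E, (∀ u, charFun (γ : Measure E) u = φ u) ∧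
      Tendsto μs atTop (𝓝 γ) := by
  -- Compactness supplies a cluster point, and all cluster points have characteristic function `φ`,
  -- hence coincide. No continuity of `φ` has to be checked.
  have hcl : ∀ γ, MapClusterPt γ atTop μs → ∀ u, charFun (γ : Measure E) u = φ u := by
    intro γ hγ u
    have h1 : MapClusterPt (charFun (γ : Measure E) u) atTop
        (fun j => charFun (μs j : Measure E) u) :=
      hγ.continuousAt_comp (continuous_charFun_probabilityMeasure u).continuousAt
    exact eq_of_nhds_neBot (h1.neBot.mono (inf_le_inf_left _ (hφ u)))
  obtain ⟨γ, -, hγ⟩ := hK.exists_mapClusterPt_of_frequently hmem.frequently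
  refine ⟨γ, hcl γ hγ, hK.tendsto_nhds_of_unique_mapClusterPt hmem fun ν _ hν => ?_⟩
  exact ProbabilityMeasure.ext_charFun fun u => (hcl ν hν u).trans (hcl γ hγ u).symm

/-- Convergence in probability of random probability measures, with respect to weak convergence,
follows from tightness and convergence in probability of the characteristic functions. -/
lemma tendsto_measure_notMem_of_charFun {Ω : Type*} [MeasurableSpace Ω] {P : Measure Ω}
    {M : ℕ → Ω → ProbabilityMeasure E} {γ : ProbabilityMeasure E}
    (hK : ∀ η : ℝ≥0∞, 0 < η → ∃ K : Set (ProbabilityMeasure E), IsCompact K ∧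
      ∀ᶠ j in atTop, P {ω | M j ω ∉ K} ≤ η)
    (hφ : ∀ u, ∀ r : ℝ, 0 < r → Tendsto (fun j => P {ω | r ≤
      ‖charFun (M j ω : Measure E) u - charFun (γ : Measure E) u‖}) atTop (𝓝 0))
    {O : Set (ProbabilityMeasure E)} (hO : O ∈ 𝓝 γ) :
    Tendsto (fun j => P {ω | M j ω ∉ O}) atTop (𝓝 0) := by
  rw [ENNReal.tendsto_nhds_zero]
  intro ε hε
  obtain ⟨K, hKc, hKM⟩ := hK (ε / 2) (ENNReal.half_pos hε.ne')
  have hKO : IsCompact (K \ interior O) := hKc.diff isOpen_interior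
  -- Every measure other than `γ` differs from it at some `u` by more than some `1 / (n + 1)`, so
  -- these open sets cover `K \ interior O`. A finite subcover reduces leaving `O` to finitely many
  -- events of small probability.
  set V : E × ℕ → Set (ProbabilityMeasure E) := fun p =>
    {μ | 1 / ((p.2 : ℝ) + 1) < ‖charFun (μ : Measure E) p.1 - charFun (γ : Measure E) p.1‖} with hV
  have hVo : ∀ p, IsOpen (V p) := fun p => isOpen_lt continuous_const
    ((continuous_charFun_probabilityMeasure p.1).sub continuous_const).norm
  have hcov : K \ interior O ⊆ ⋃ p, V p := by
    intro μ hμ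
    have hne : ∃ u, charFun (μ : Measure E) u ≠ charFun (γ : Measure E) u := by
      by_contra hcon
      push Not at hcon
      rw [ProbabilityMeasure.ext_charFun hcon] at hμ
      exact hμ.2 (mem_interior_iff_mem_nhds.2 hO)
    obtain ⟨u, hu⟩ := hne
    obtain ⟨n, hn⟩ := exists_nat_one_div_lt (norm_pos_iff.2 (sub_ne_zero.2 hu))
    exact Set.mem_iUnion.2 ⟨(u, n), hn⟩
  obtain ⟨t, ht⟩ := hKO.elim_finite_subcover V hVo hcov
  have hsum : Tendsto (fun j => ∑ p ∈ t, P {ω | 1 / ((p.2 : ℝ) + 1) ≤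
      ‖charFun (M j ω : Measure E) p.1 - charFun (γ : Measure E) p.1‖}) atTop (𝓝 0) := by
    simpa using tendsto_finsetSum t fun p _ => hφ p.1 (1 / ((p.2 : ℝ) + 1)) (by positivity)
  filter_upwards [hKM, ENNReal.tendsto_nhds_zero.1 hsum (ε / 2) (ENNReal.half_pos hε.ne')]
    with j hj1 hj2
  have hsub : {ω | M j ω ∉ O} ⊆ {ω | M j ω ∉ K} ∪ ⋃ p ∈ t, {ω | 1 / ((p.2 : ℝ) + 1) ≤
      ‖charFun (M j ω : Measure E) p.1 - charFun (γ : Measure E) p.1‖} := by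
    intro ω hω
    by_cases hωK : M j ω ∈ K
    · right
      obtain ⟨p, hp, hpV⟩ := Set.mem_iUnion₂.1
        (ht ⟨hωK, fun h => hω (interior_subset h)⟩)
      refine Set.mem_iUnion₂.2 ⟨p, hp, ?_⟩
      simp only [hV, Set.mem_ofPred_eq] at hpV ⊢
      exact hpV.le
    · exact Or.inl hωK
  calc P {ω | M j ω ∉ O} ≤ ε / 2 + ε / 2 :=
        (measure_mono hsub).trans ((measure_union_le _ _).trans
          (add_le_add hj1 ((measure_biUnion_finset_le _ _).trans hj2)))
    _ = ε := ENNReal.add_halves ε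

/-- The balls of a metric which metrizes weak convergence are neighbourhoods. -/
lemma MetrizesWeakConvergence.mem_nhds {d : ProbabilityMeasure E → ProbabilityMeasure E → ℝ}
    (hd : MetrizesWeakConvergence d) (γ : ProbabilityMeasure E) {ε : ℝ} (hε : 0 < ε) :
    {μ | d μ γ < ε} ∈ 𝓝 γ := by
  by_contra h
  have hfreq : ∃ᶠ μ in 𝓝 γ, ¬ d μ γ < ε := fun h' => h (by
    filter_upwards [h'] with μ hμ using by simpa using hμ)
  -- The hypothesis on `d` speaks of sequences only. Neighbourhood filters of the weak topology are
  -- countably generated, so a failure would be witnessed by a sequence converging to `γ`.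
  obtain ⟨μs, hμs, hlim⟩ := frequently_iff_seq_forall.1 hfreq |>.imp fun _ h => h
  obtain ⟨j, hj⟩ := (((hd.tendsto_iff μs γ).1 hμs).eventually (gt_mem_nhds hε)).exists
  exact hlim j hj

lemma MetrizesWeakConvergence.nonneg {d : ProbabilityMeasure E → ProbabilityMeasure E → ℝ}
    (hd : MetrizesWeakConvergence d) (μ ν : ProbabilityMeasure E) : 0 ≤ d μ ν := by
  have h1 := hd.triangle μ ν μ
  rw [(hd.eq_zero_iff μ μ).2 rfl, hd.symm ν μ] at h1
  linarith

end TightSets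

/-! ### Second moments and characteristic functions of the two laws. -/

section Laws

variable {Ω S E : Type*} [MeasurableSpace Ω] [MeasurableSpace S]
  [NormedAddCommGroup E] [InnerProductSpace ℝ E] [CompleteSpace E] [MeasurableSpace E]
  [BorelSpace E]

lemma lintegral_bootLaw {k b : ℕ} (hk : 0 < k) (hb : 0 < b) (L : E →L[ℝ] E) (x : ℤ → E) :
    ∫⁻ z, ‖L z‖ₑ ^ 2 ∂(bootLaw k b x : Measure E)
      = ENNReal.ofReal (bootVar k b fun t => L (x t)) := by
  have hm : Measurable fun z : E => ‖L z‖ₑ ^ 2 := by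
    have := L.continuous.measurable
    fun_prop
  rw [← integral_norm_sq_bootCentered hk hb, ofReal_integral_eq_lintegral_ofReal
    (integrable_blockIndexLaw k b _) (ae_of_all _ fun _ => by positivity)]
  refine (lintegral_map hm (measurable_of_finite _)).trans (lintegral_congr fun I => ?_)
  rw [enorm_sq_eq_ofReal, map_smul, bootCentered_clm]

lemma charFun_bootLaw (k b : ℕ) (x : ℤ → E) (u : E) :
    charFun (bootLaw k b x : Measure E) u = charExp (blockIndexLaw k b)
      fun I => Real.sqrt ((k * b : ℕ) : ℝ) • bootCentered k b (fun t => inner ℝ u (x t)) I := by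
  rw [charFun_apply, charExp]
  refine (integral_map (measurable_of_finite _).aemeasurable ?_).trans ?_
  · exact Continuous.aestronglyMeasurable (by fun_prop)
  · refine integral_congr_ae (ae_of_all _ fun I => ?_)
    have := bootCentered_clm (innerSL ℝ u) k b x I
    simp only [innerSL_apply_apply] at this
    dsimp only
    rw [this, real_inner_comm, inner_smul_right, smul_eq_mul]

variable [SecondCountableTopology E] {P : Measure Ω} [IsProbabilityMeasure P]

lemma measurable_sampleMean {X : ℤ → Ω → E} (hX : ∀ t, Measurable (X t)) (n : ℕ) :
    Measurable fun ω => Real.sqrt n • sampleMean n fun t => X t ω := by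
  have : Measurable fun ω => ∑ t ∈ Finset.range n, X (t + 1) ω :=
    Finset.measurable_sum _ fun t _ => hX _
  exact (this.const_smul _).const_smul _

lemma lintegral_meanLaw {X : ℤ → Ω → E} (hX : ∀ t, Measurable (X t))
    (hX2 : ∀ t, MemLp (X t) 2 P) (L : E →L[ℝ] E) (n : ℕ) :
    ∫⁻ z, ‖L z‖ₑ ^ 2 ∂(meanLaw P X hX n : Measure E)
      = ENNReal.ofReal (∫ ω, ‖Real.sqrt n • sampleMean n fun t => L (X t ω)‖ ^ 2 ∂P) := by
  have hm : Measurable fun z : E => ‖L z‖ₑ ^ 2 := by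
    have := L.continuous.measurable
    fun_prop
  have hLX : ∀ t, MemLp (fun ω => L (X t ω)) 2 P := fun t => L.comp_memLp' (hX2 t)
  rw [ofReal_integral_eq_lintegral_ofReal (MemLp.integrable_norm_sq (memLp_sampleMean hLX n))
    (ae_of_all _ fun _ => by positivity)]
  refine (lintegral_map hm (measurable_sampleMean hX n)).trans (lintegral_congr fun ω => ?_)
  rw [enorm_sq_eq_ofReal]
  simp [sampleMean]

lemma charFun_meanLaw {X : ℤ → Ω → E} (hX : ∀ t, Measurable (X t)) (n : ℕ) (u : E) :
    charFun (meanLaw P X hX n : Measure E) u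
      = charExp P fun ω => Real.sqrt n • sampleMean n fun t => inner ℝ u (X t ω) := by
  rw [charFun_apply, charExp]
  refine (integral_map (measurable_sampleMean hX n).aemeasurable ?_).trans ?_
  · exact Continuous.aestronglyMeasurable (by fun_prop)
  · refine integral_congr_ae (ae_of_all _ fun ω => ?_)
    dsimp only
    rw [real_inner_comm, inner_smul_right, smul_eq_mul, sampleMean, sampleMean, inner_smul_right,
      inner_sum, smul_eq_mul]

end Laws

/-! ### Tightness and consistency for the distribution. -/

section WeakConvergence

variable {Ω S E : Type*} [MeasurableSpace Ω] [MeasurableSpace S]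
  [NormedAddCommGroup E] [InnerProductSpace ℝ E] [CompleteSpace E] [MeasurableSpace E]
  [BorelSpace E] [SecondCountableTopology E] {P : Measure Ω} [IsProbabilityMeasure P]
  {δ : ℤ → Ω → S} {f : (ℕ → S) → E}

/-- The bound for the long-run variance of the image of the process under a linear map. -/
noncomputable def longRunBound (P : Measure Ω) (δ : ℤ → Ω → S) (f : (ℕ → S) → E)
    (L : E →L[ℝ] E) : ℝ :=
  2 * rms P (fun ω => L (causalProc δ f 0 ω))
    * (‖L‖ * ∑' m, couplingError P (causalProc δ f) δ f 0 m)

/-- Only one factor of the bound has to be made small, the root mean square of the projection of the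
variable at time `0`; projections have norm at most `1`. -/
lemma IsL2mApproximable.exists_longRunBound_le (h : IsL2mApproximable P (causalProc δ f) δ f)
    {ε : ℝ} (hε : 0 < ε) : ∃ U : Submodule ℝ E, FiniteDimensional ℝ U ∧
      longRunBound P δ f Uᗮ.starProjection ≤ ε := by
  set s := ∑' m, couplingError P (causalProc δ f) δ f 0 m with hs
  have hs0 : 0 ≤ s := tsum_nonneg fun m => Real.sqrt_nonneg _
  obtain ⟨U, hU, hr⟩ := exists_finiteDimensional_rms_le (h.memLp_causalProc 0)
    (ε := ε / (2 * (s + 1))) (by positivity)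
  refine ⟨U, hU, ?_⟩
  rw [longRunBound, ← hs]
  calc 2 * rms P (fun ω => Uᗮ.starProjection (causalProc δ f 0 ω)) * (‖Uᗮ.starProjection‖ * s)
      ≤ 2 * (ε / (2 * (s + 1))) * (1 * (s + 1)) := by
        refine mul_le_mul (mul_le_mul_of_nonneg_left hr zero_le_two) ?_ (by positivity)
          (by positivity)
        exact mul_le_mul Uᗮ.starProjection_norm_le (by linarith) hs0 zero_le_one
    _ = ε := by field_simp

lemma longRunBound_nonneg (L : E →L[ℝ] E) : 0 ≤ longRunBound P δ f L :=
  mul_nonneg (mul_nonneg zero_le_two (rms_nonneg _))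
    (mul_nonneg (norm_nonneg _) (tsum_nonneg fun m => Real.sqrt_nonneg _))

lemma IsL2mApproximable.exists_seq_longRunBound_le (h : IsL2mApproximable P (causalProc δ f) δ f)
    {η : ℝ} (hη : 0 < η) : ∃ U : ℕ → Submodule ℝ E, (∀ r, FiniteDimensional ℝ (U r)) ∧
      ∀ r, longRunBound P δ f (U r)ᗮ.starProjection ≤ η * (1 / 16) ^ r := by
  choose U hU hr using fun r : ℕ => h.exists_longRunBound_le (ε := η * (1 / 16) ^ r)
    (by positivity)
  exact ⟨U, hU, hr⟩

lemma IsL2mApproximable.memLp_clm (h : IsL2mApproximable P (causalProc δ f) δ f) (L : E →L[ℝ] E)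
    (t : ℤ) : MemLp (fun ω => L (causalProc δ f t ω)) 2 P :=
  L.comp_memLp' (h.memLp_causalProc t)

lemma IsL2mApproximable.integral_bootVar_clm_le (h : IsL2mApproximable P (causalProc δ f) δ f)
    (hmean : ∀ t, ∫ ω, causalProc δ f t ω ∂P = 0) (L : E →L[ℝ] E) {b : ℕ} (hb : 0 < b) (k : ℕ) :
    ∫ ω, bootVar k b (fun t => L (causalProc δ f t ω)) ∂P ≤ longRunBound P δ f L :=
  integral_bootVar_le (h.integral_norm_sum_clm_sq_le hmean L) (h.memLp_clm L) hb k

/-- Tightness of the bootstrap distributions. -/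
lemma IsL2mApproximable.exists_isCompact_bootLaw (h : IsL2mApproximable P (causalProc δ f) δ f)
    (hmean : ∀ t, ∫ ω, causalProc δ f t ω ∂P = 0) {k b : ℕ → ℕ}
    (hn : Tendsto (fun j => k j * b j) atTop atTop) {η : ℝ≥0∞} (hη : 0 < η) :
    ∃ K : Set (ProbabilityMeasure E), IsCompact K ∧
      ∀ᶠ j in atTop, P {ω | bootLaw (k j) (b j) (fun t => causalProc δ f t ω) ∉ K} ≤ η := by
  obtain ⟨c', hc'0, hc'⟩ := exists_pos_ofReal_le hη
  obtain ⟨c, hc0, hc⟩ : ∃ c : ℝ, 0 < c ∧ ENNReal.ofReal (3 * c) ≤ η :=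
    ⟨c' / 3, by positivity, by rwa [mul_div_cancel₀ _ three_ne_zero]⟩
  obtain ⟨U, hU, hUr⟩ := h.exists_seq_longRunBound_le hc0
  set κ := longRunBound P δ f (ContinuousLinearMap.id ℝ E) with hκ
  have hκ0 : 0 ≤ κ := longRunBound_nonneg _
  -- Chosen so that the mean second moment `κ` is at most `c * C`; the `+ 1` keeps `C` positive if
  -- `κ = 0`.
  set C := (κ + 1) / c with hC
  have hC0 : 0 < C := by positivity
  refine ⟨_, isCompact_closure_tightSet hC0.le hU, ?_⟩
  filter_upwards [eventually_pos_of_tendsto_mul hn] with j ⟨hkj, hbj⟩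
  have hint : ∀ L : E →L[ℝ] E, Integrable
      (fun ω => bootVar (k j) (b j) fun t => L (causalProc δ f t ω)) P := fun L =>
    integrable_bootVar (h.memLp_clm L) _ _
  refine (measure_mono ?_).trans ((measure_notMem_tightSet_le
    (M := fun ω => bootLaw (k j) (b j) (fun t => causalProc δ f t ω)) hC0 hc0.le
    (hint (ContinuousLinearMap.id ℝ E)) (fun r => hint (U r)ᗮ.starProjection)
    (fun ω => bootVar_nonneg _ _ _) (fun r ω => bootVar_nonneg _ _ _)
    (fun ω => (lintegral_bootLaw hkj hbj (ContinuousLinearMap.id ℝ E) _).le)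
    (fun r ω => (lintegral_bootLaw hkj hbj (U r)ᗮ.starProjection _).le)
    ?_ fun r => (h.integral_bootVar_clm_le hmean _ hbj _).trans (hUr r)).trans hc)
  · intro ω hω hω'
    exact hω (subset_closure hω')
  · refine (h.integral_bootVar_clm_le hmean _ hbj _).trans ?_
    rw [hC, mul_div_cancel₀ _ hc0.ne']
    linarith

/-- Tightness of the laws of the scaled sample means. -/
lemma IsL2mApproximable.exists_isCompact_meanLaw (h : IsL2mApproximable P (causalProc δ f) δ f)
    (hmean : ∀ t, ∫ ω, causalProc δ f t ω ∂P = 0) (hX : ∀ t, Measurable (causalProc δ f t)) :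
    ∃ K : Set (ProbabilityMeasure E), IsCompact K ∧
      ∀ n, 0 < n → meanLaw P (causalProc δ f) hX n ∈ K := by
  obtain ⟨U, hU, hUr⟩ := h.exists_seq_longRunBound_le one_pos
  refine ⟨_, isCompact_closure_tightSet (longRunBound_nonneg (P := P) (δ := δ) (f := f)
    (ContinuousLinearMap.id ℝ E)) hU, fun n hn => subset_closure ⟨?_, fun r => ?_⟩⟩
  · refine (lintegral_meanLaw hX h.memLp_causalProc (ContinuousLinearMap.id ℝ E) n).trans_le
      (ENNReal.ofReal_le_ofReal ?_)
    exact integral_norm_sq_sampleMean_le (h.integral_norm_sum_clm_sq_le hmean _) hn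
  · refine (lintegral_meanLaw hX h.memLp_causalProc _ n).trans_le (ENNReal.ofReal_le_ofReal ?_)
    refine (integral_norm_sq_sampleMean_le (h.integral_norm_sum_clm_sq_le hmean _) hn).trans
      ((hUr r).trans ?_)
    rw [one_mul]
    exact pow_le_pow_left₀ (by norm_num) (by norm_num) r

/-- Consistency of the moving block bootstrap for the distribution of the sample mean. -/
theorem IsStronglyL2mApproximable.tendstoInMeasure_bootLaw
    (h : IsStronglyL2mApproximable P (causalProc δ f) δ f)
    (hmean : ∀ t, ∫ ω, causalProc δ f t ω ∂P = 0) (hX : ∀ t, Measurable (causalProc δ f t))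
    {k b : ℕ → ℕ} (hn : Tendsto (fun j => k j * b j) atTop atTop) (hb : Tendsto b atTop atTop)
    (hbn : Tendsto (fun j => (b j : ℝ) / Real.sqrt ((k j * b j : ℕ) : ℝ)) atTop (𝓝 0))
    {d : ProbabilityMeasure E → ProbabilityMeasure E → ℝ} (hd : MetrizesWeakConvergence d) :
    TendstoInMeasure P
      (fun j ω => d (bootLaw (k j) (b j) fun t => causalProc δ f t ω)
        (meanLaw P (causalProc δ f) hX (k j * b j))) atTop (fun _ => 0) := by
  have hδ := h.measurable_innovation
  have hi := h.iIndep_innovation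
  obtain ⟨K, hK, hKmem⟩ := h.exists_isCompact_meanLaw hmean hX
  have hmem : ∀ᶠ j in atTop, meanLaw P (causalProc δ f) hX (k j * b j) ∈ K := by
    filter_upwards [eventually_pos_of_tendsto_mul hn] with j ⟨h1, h2⟩
    exact hKmem _ (Nat.mul_pos h1 h2)
  -- The Gaussian limit is not constructed beforehand: it arises as the weak limit of the laws of
  -- the sample mean, with characteristic function `exp (-v / 2)` in each direction. It then serves
  -- as the intermediate point in the triangle inequality for `d`.
  obtain ⟨γ, hγ, hlim⟩ := exists_tendsto_of_tendsto_charFun hK hmem fun u => by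
    simp_rw [charFun_meanLaw]
    exact (h.isBlockRegular_inner hmean u).tendsto_charExp_mean hδ hi hn hb hbn
  have hboot : ∀ O ∈ 𝓝 γ, Tendsto (fun j => P {ω | bootLaw (k j) (b j)
      (fun t => causalProc δ f t ω) ∉ O}) atTop (𝓝 0) := fun O hO => by
    refine tendsto_measure_notMem_of_charFun
      (fun η hη => h.exists_isCompact_bootLaw hmean hn hη) (fun u r hr => ?_) hO
    simp_rw [charFun_bootLaw, hγ]
    have := ((h.isBlockRegular_inner hmean u).vanishesInMean_charExp_bootCentered_sub hδ hi hn hb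
      hbn).tendsto_measure hr
    simpa only [abs_norm] using this
  intro ε hε
  obtain ⟨c, hc0, hc⟩ := exists_pos_ofReal_le hε
  refine tendsto_of_tendsto_of_tendsto_of_le_of_le' tendsto_const_nhds
    (hboot _ (hd.mem_nhds γ (half_pos hc0))) (Eventually.of_forall fun _ => zero_le) ?_
  filter_upwards [((hd.tendsto_iff _ γ).1 hlim).eventually (gt_mem_nhds (half_pos hc0))] with j hj
  refine measure_mono fun ω hω hω' => ?_
  simp only [Set.mem_ofPred_eq] at hω hω'
  have h1 := hd.triangle (bootLaw (k j) (b j) fun t => causalProc δ f t ω) γ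
    (meanLaw P (causalProc δ f) hX (k j * b j))
  rw [hd.symm γ] at h1
  have h2 : edist (d (bootLaw (k j) (b j) fun t => causalProc δ f t ω)
      (meanLaw P (causalProc δ f) hX (k j * b j))) 0 < ENNReal.ofReal c := by
    rw [edist_dist, Real.dist_0_eq_abs, abs_of_nonneg (hd.nonneg _ _)]
    exact (ENNReal.ofReal_lt_ofReal_iff hc0).2 (by linarith)
  exact absurd hω (not_le.2 (h2.trans_le hc))

end WeakConvergence

/-! ### Hilbert-Schmidt estimates and finite-dimensional compression. -/

section HilbertSchmidt

variable {Ω E ι : Type*} [MeasurableSpace Ω] [NormedAddCommGroup E] [InnerProductSpace ℝ E]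

/-- The squared Hilbert-Schmidt norm. -/
noncomputable def hsSq (e : HilbertBasis ι ℝ E) (T : E →L[ℝ] E) : ℝ≥0∞ := ∑' i, ‖T (e i)‖ₑ ^ 2

lemma le_hsNorm_iff (e : HilbertBasis ι ℝ E) (T : E →L[ℝ] E) (ε : ℝ≥0∞) :
    ε ≤ hsNorm e T ↔ ε ^ 2 ≤ hsSq e T := by
  have h : hsNorm e T ^ 2 = hsSq e T := by
    rw [hsNorm, ← ENNReal.rpow_natCast, ← ENNReal.rpow_mul]
    norm_num
    rfl
  rw [← h]
  exact (ENNReal.pow_le_pow_left_iff two_ne_zero).symm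

lemma hsSq_le_of_sum_le {e : HilbertBasis ι ℝ E} {T : E →L[ℝ] E} {c : ℝ}
    (h : ∀ s : Finset ι, ∑ i ∈ s, ‖T (e i)‖ ^ 2 ≤ c) : hsSq e T ≤ ENNReal.ofReal c := by
  refine ENNReal.summable.tsum_le_of_sum_le fun s => ?_
  simp_rw [enorm_sq_eq_ofReal]
  rw [← ENNReal.ofReal_sum_of_nonneg fun i _ => by positivity]
  exact ENNReal.ofReal_le_ofReal (h s)

lemma hsSq_add_le (e : HilbertBasis ι ℝ E) (A B : E →L[ℝ] E) :
    hsSq e (A + B) ≤ 2 * hsSq e A + 2 * hsSq e B := by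
  rw [hsSq, hsSq, hsSq, ← ENNReal.tsum_mul_left, ← ENNReal.tsum_mul_left, ← ENNReal.tsum_add]
  refine ENNReal.tsum_le_tsum fun i => ?_
  simp_rw [enorm_sq_eq_ofReal]
  rw [← ENNReal.ofReal_ofNat 2, ← ENNReal.ofReal_mul zero_le_two, ← ENNReal.ofReal_mul zero_le_two,
    ← ENNReal.ofReal_add (by positivity) (by positivity)]
  refine ENNReal.ofReal_le_ofReal ?_
  rw [add_apply]
  have h := norm_add_le (A (e i)) (B (e i))
  nlinarith [sq_nonneg (‖A (e i)‖ - ‖B (e i)‖), norm_nonneg (A (e i) + B (e i)),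
    norm_nonneg (A (e i)), norm_nonneg (B (e i))]

lemma hsSq_add_le_of_le {e : HilbertBasis ι ℝ E} {A B : E →L[ℝ] E} {a c : ℝ} (ha : 0 ≤ a)
    (hc : 0 ≤ c) (hA : hsSq e A ≤ ENNReal.ofReal a) (hB : hsSq e B ≤ ENNReal.ofReal c) :
    hsSq e (A + B) ≤ ENNReal.ofReal (2 * a + 2 * c) := by
  refine (hsSq_add_le e A B).trans ((add_le_add (mul_le_mul' le_rfl hA)
    (mul_le_mul' le_rfl hB)).trans_eq ?_)
  rw [← ENNReal.ofReal_ofNat 2, ← ENNReal.ofReal_mul zero_le_two, ← ENNReal.ofReal_mul zero_le_two,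
    ← ENNReal.ofReal_add (by positivity) (by positivity)]

lemma hsSq_neg (e : HilbertBasis ι ℝ E) (A : E →L[ℝ] E) : hsSq e (-A) = hsSq e A := by
  simp [hsSq]

lemma sum_inner_sq_le (e : HilbertBasis ι ℝ E) (s : Finset ι) (x : E) :
    ∑ i ∈ s, inner ℝ x (e i) ^ 2 ≤ ‖x‖ ^ 2 := by
  have h := e.orthonormal.sum_inner_products_le (s := s) x
  simpa [real_inner_comm, sq_abs] using h

/-- Pairing of the restriction of `T` to finitely many basis vectors with a rank one operator. -/
lemma abs_sum_inner_mul_inner_le (e : HilbertBasis ι ℝ E) (T : E →L[ℝ] E) (s : Finset ι)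
    (x z : E) : |∑ i ∈ s, inner ℝ x (e i) * inner ℝ z (T (e i))|
      ≤ ‖x‖ * ‖z‖ * Real.sqrt (∑ i ∈ s, ‖T (e i)‖ ^ 2) := by
  refine Real.abs_le_sqrt (Finset.sum_mul_sq_le_sq_mul_sq _ _ _) |>.trans ?_
  have h1 := sum_inner_sq_le e s x
  have h2 : ∑ i ∈ s, inner ℝ z (T (e i)) ^ 2 ≤ ‖z‖ ^ 2 * ∑ i ∈ s, ‖T (e i)‖ ^ 2 := by
    rw [Finset.mul_sum]
    refine Finset.sum_le_sum fun i _ => ?_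
    rw [← mul_pow, ← sq_abs]
    exact pow_le_pow_left₀ (abs_nonneg _) (abs_real_inner_le_norm _ _) 2
  calc _ ≤ Real.sqrt (‖x‖ ^ 2 * (‖z‖ ^ 2 * ∑ i ∈ s, ‖T (e i)‖ ^ 2)) := by
        refine Real.sqrt_le_sqrt (mul_le_mul h1 h2 ?_ (by positivity))
        exact Finset.sum_nonneg fun i _ => sq_nonneg _
    _ = _ := by
        rw [← mul_assoc, ← mul_pow, Real.sqrt_mul (by positivity), Real.sqrt_sq (by positivity)]

/-- Closes the duality arguments below, where a finite partial sum of a squared Hilbert-Schmidt norm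
is bounded by its own square root. -/
lemma sum_le_sq_of_le_mul_sqrt {S M : ℝ} (hS : 0 ≤ S) (h : S ≤ M * Real.sqrt S) : S ≤ M ^ 2 := by
  rcases hS.eq_or_lt with rfl | hS'
  · positivity
  · have h1 := Real.sqrt_pos.2 hS'
    have h2 := Real.mul_self_sqrt hS
    have h3 : Real.sqrt S ≤ M := by
      by_contra hcon
      push Not at hcon
      nlinarith
    nlinarith

variable [CompleteSpace E] {P : Measure Ω}

/-- Duality: a partial sum `S` of the squared norm of `T = E (Y ⊗ Z)` is the mean pairing of `Y ⊗ Z`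
with `T` on finitely many basis vectors. By Cauchy-Schwarz and Bessel it is at most `E (‖Y‖ ‖Z‖)
√S`. -/
lemma hsSq_expTensor_le (e : HilbertBasis ι ℝ E) {Y Z : Ω → E} (hY : MemLp Y 2 P)
    (hZ : MemLp Z 2 P) : hsSq e (expTensor P Y Z) ≤ ENNReal.ofReal ((rms P Y * rms P Z) ^ 2) := by
  refine hsSq_le_of_sum_le fun s => ?_
  set T := expTensor P Y Z with hT
  set S := ∑ i ∈ s, ‖T (e i)‖ ^ 2 with hS
  refine sum_le_sq_of_le_mul_sqrt (Finset.sum_nonneg fun i _ => by positivity) ?_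
  have hi : ∀ i ∈ s, Integrable (fun ω => inner ℝ (Y ω) (e i) * inner ℝ (Z ω) (T (e i))) P :=
    fun i _ => (hY.inner_const (e i)).integrable_mul (hZ.inner_const (T (e i)))
  have h1 : S = ∫ ω, ∑ i ∈ s, inner ℝ (Y ω) (e i) * inner ℝ (Z ω) (T (e i)) ∂P := by
    rw [integral_finsetSum _ hi, hS]
    refine Finset.sum_congr rfl fun i _ => ?_
    rw [← inner_expTensor hY hZ, ← hT, real_inner_self_eq_norm_sq]
  calc S ≤ ∫ ω, ‖Y ω‖ * ‖Z ω‖ * Real.sqrt S ∂P := by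
        refine h1.trans_le ?_
        refine integral_mono (integrable_finsetSum _ hi)
          ((MemLp.integrable_norm_mul hY hZ).mul_const _) fun ω => ?_
        exact (le_abs_self _).trans (abs_sum_inner_mul_inner_le e T s (Y ω) (Z ω))
    _ = (∫ ω, ‖Y ω‖ * ‖Z ω‖ ∂P) * Real.sqrt S := integral_mul_const _ _
    _ ≤ rms P Y * rms P Z * Real.sqrt S :=
        mul_le_mul_of_nonneg_right (integral_norm_mul_le hY hZ) (Real.sqrt_nonneg _)

/-- The compression of an operator to a subspace. -/
noncomputable def compress (U : Submodule ℝ E) [U.HasOrthogonalProjection] (A : E →L[ℝ] E) :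
    E →L[ℝ] E :=
  U.starProjection ∘L A ∘L U.starProjection

lemma compress_sub (U : Submodule ℝ E) [U.HasOrthogonalProjection] (A B : E →L[ℝ] E) :
    compress U (A - B) = compress U A - compress U B := by
  ext x
  simp [compress]

lemma continuous_compress (U : Submodule ℝ E) [U.HasOrthogonalProjection] :
    Continuous (compress U) :=
  continuous_const.clm_comp (continuous_id.clm_comp continuous_const)

/-- With `p` and `q` the projections onto `U` and its complement, `Y ⊗ Y - pY ⊗ pY = qY ⊗ Y + pY ⊗
qY`. Each term contains a factor `qY`, the small quantity. -/
lemma expTensor_sub_compress (U : Submodule ℝ E) [U.HasOrthogonalProjection] {Y : Ω → E}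
    (hY : MemLp Y 2 P) : expTensor P Y Y - compress U (expTensor P Y Y)
      = expTensor P (fun ω => Uᗮ.starProjection (Y ω)) Y
        + expTensor P (fun ω => U.starProjection (Y ω)) (fun ω => Uᗮ.starProjection (Y ω)) := by
  have hP : MemLp (fun ω => U.starProjection (Y ω)) 2 P := U.starProjection.comp_memLp' hY
  have hQ : MemLp (fun ω => Uᗮ.starProjection (Y ω)) 2 P := Uᗮ.starProjection.comp_memLp' hY
  refine ContinuousLinearMap.ext fun u => ext_inner_right ℝ fun v => ?_
  rw [sub_apply, add_apply, inner_sub_left, inner_add_left, compress,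
    ContinuousLinearMap.comp_apply, ContinuousLinearMap.comp_apply,
    Submodule.inner_starProjection_left_eq_right, inner_expTensor hY hY, inner_expTensor hY hY,
    inner_expTensor hQ hY, inner_expTensor hP hQ]
  have i1 : Integrable (fun ω => inner ℝ (Y ω) u * inner ℝ (Y ω) v) P :=
    (hY.inner_const u).integrable_mul (hY.inner_const v)
  have i2 : Integrable (fun ω => inner ℝ (Y ω) (U.starProjection u)
      * inner ℝ (Y ω) (U.starProjection v)) P :=
    (hY.inner_const _).integrable_mul (hY.inner_const _)
  have i3 : Integrable (fun ω => inner ℝ (Uᗮ.starProjection (Y ω)) u * inner ℝ (Y ω) v) P :=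
    (hQ.inner_const u).integrable_mul (hY.inner_const v)
  have i4 : Integrable (fun ω => inner ℝ (U.starProjection (Y ω)) u
      * inner ℝ (Uᗮ.starProjection (Y ω)) v) P :=
    (hP.inner_const u).integrable_mul (hQ.inner_const v)
  rw [← integral_sub i1 i2, ← integral_add i3 i4]
  refine integral_congr_ae (ae_of_all _ fun ω => ?_)
  have hd : ∀ w, inner ℝ (Y ω) w
      = inner ℝ (U.starProjection (Y ω)) w + inner ℝ (Uᗮ.starProjection (Y ω)) w := fun w => by
    rw [← inner_add_left, Submodule.starProjection_add_starProjection_orthogonal]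
  dsimp only
  rw [← Submodule.inner_starProjection_left_eq_right,
    ← Submodule.inner_starProjection_left_eq_right, hd u, hd v]
  ring

lemma hsSq_expTensor_sub_compress_le [IsProbabilityMeasure P] (e : HilbertBasis ι ℝ E)
    (U : Submodule ℝ E) [U.HasOrthogonalProjection] {Y : Ω → E} (hY : MemLp Y 2 P) :
    hsSq e (expTensor P Y Y - compress U (expTensor P Y Y))
      ≤ ENNReal.ofReal (4 * (∫ ω, ‖Y ω‖ ^ 2 ∂P) * ∫ ω, ‖Uᗮ.starProjection (Y ω)‖ ^ 2 ∂P) := by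
  have hP : MemLp (fun ω => U.starProjection (Y ω)) 2 P := U.starProjection.comp_memLp' hY
  have hQ : MemLp (fun ω => Uᗮ.starProjection (Y ω)) 2 P := Uᗮ.starProjection.comp_memLp' hY
  have hPY : rms P (fun ω => U.starProjection (Y ω)) ≤ rms P Y :=
    rms_mono hY (ae_of_all _ fun ω => U.norm_starProjection_apply_le _)
  rw [expTensor_sub_compress U hY]
  refine (hsSq_add_le_of_le (sq_nonneg _) (sq_nonneg _) (hsSq_expTensor_le e hQ hY)
    (hsSq_expTensor_le e hP hQ)).trans (ENNReal.ofReal_le_ofReal ?_)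
  rw [← rms_sq, ← rms_sq]
  have h1 : (rms P (fun ω => U.starProjection (Y ω)) * rms P fun ω => Uᗮ.starProjection (Y ω)) ^ 2
      ≤ (rms P Y * rms P fun ω => Uᗮ.starProjection (Y ω)) ^ 2 :=
    pow_le_pow_left₀ (mul_nonneg (rms_nonneg _) (rms_nonneg _))
      (mul_le_mul_of_nonneg_right hPY (rms_nonneg _)) 2
  nlinarith

/-- The Hilbert-Schmidt norm of the compression to a finite-dimensional subspace in terms of its
matrix entries. -/
lemma hsSq_compress_le (e : HilbertBasis ι ℝ E) (U : Submodule ℝ E) [FiniteDimensional ℝ U]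
    (A : E →L[ℝ] E) {κ : Type*} [Fintype κ] (u : OrthonormalBasis κ ℝ U) :
    hsSq e (compress U A)
      ≤ ENNReal.ofReal ((∑ p : κ × κ, |inner ℝ (A (u p.2 : E)) (u p.1 : E)|) ^ 2) := by
  refine hsSq_le_of_sum_le fun s => ?_
  set T := compress U A with hT
  set S := ∑ i ∈ s, ‖T (e i)‖ ^ 2 with hS
  have hproj : ∀ x : E, U.starProjection x = ∑ a, inner ℝ (u a : E) x • (u a : E) := fun x => by
    rw [Submodule.starProjection_apply, u.orthogonalProjectionOnto_apply_eq_sum]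
    simp
  have hTx : ∀ x : E, T x = ∑ p : κ × κ,
      (inner ℝ (A (u p.2 : E)) (u p.1 : E) * inner ℝ (u p.2 : E) x) • (u p.1 : E) := fun x => by
    rw [hT, compress, ContinuousLinearMap.comp_apply, ContinuousLinearMap.comp_apply, hproj,
      Fintype.sum_prod_type]
    refine Finset.sum_congr rfl fun a _ => ?_
    dsimp only
    rw [← Finset.sum_smul, hproj x, map_sum, inner_sum]
    congr 1
    refine Finset.sum_congr rfl fun c _ => ?_
    rw [map_smul, inner_smul_right, real_inner_comm (A (u c : E)) (u a : E), mul_comm]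
  have hnorm : ∀ a, ‖(u a : E)‖ = 1 := fun a =>
    u.orthonormal.1 a
  refine sum_le_sq_of_le_mul_sqrt (Finset.sum_nonneg fun i _ => by positivity) ?_
  calc S = ∑ p : κ × κ, inner ℝ (A (u p.2 : E)) (u p.1 : E)
        * ∑ i ∈ s, inner ℝ (u p.2 : E) (e i) * inner ℝ (u p.1 : E) (T (e i)) := by
        simp_rw [Finset.mul_sum]
        rw [Finset.sum_comm, hS]
        refine Finset.sum_congr rfl fun i _ => ?_
        rw [← real_inner_self_eq_norm_sq]
        nth_rewrite 1 [hTx]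
        rw [sum_inner]
        refine Finset.sum_congr rfl fun p _ => ?_
        rw [inner_smul_left]
        simp [mul_assoc]
    _ ≤ ∑ p : κ × κ, |inner ℝ (A (u p.2 : E)) (u p.1 : E)| * Real.sqrt S := by
        refine Finset.sum_le_sum fun p _ => ?_
        refine (le_abs_self _).trans ?_
        rw [abs_mul]
        refine mul_le_mul_of_nonneg_left ?_ (abs_nonneg _)
        refine (abs_sum_inner_mul_inner_le e T s _ _).trans_eq ?_
        rw [hnorm, hnorm, one_mul, one_mul]
    _ = _ := (Finset.sum_mul _ _ _).symm

/-- Lower semicontinuity of the Hilbert-Schmidt norm under operator norm convergence: finite partial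
sums are continuous. -/
lemma hsSq_le_of_tendsto {e : HilbertBasis ι ℝ E} {T : ℕ → E →L[ℝ] E} {A : E →L[ℝ] E}
    (hT : Tendsto T atTop (𝓝 A)) {c : ℝ} (hc : 0 ≤ c)
    (h : ∀ᶠ n in atTop, hsSq e (T n) ≤ ENNReal.ofReal c) : hsSq e A ≤ ENNReal.ofReal c := by
  refine hsSq_le_of_sum_le fun s => ?_
  have hcont : Continuous fun B : E →L[ℝ] E => ∑ i ∈ s, ‖B (e i)‖ ^ 2 := by fun_prop
  refine le_of_tendsto ((hcont.tendsto _).comp hT) ?_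
  filter_upwards [h] with n hn
  have h1 := (ENNReal.sum_le_tsum s).trans hn
  simp_rw [enorm_sq_eq_ofReal] at h1
  rwa [← ENNReal.ofReal_sum_of_nonneg fun i _ => by positivity,
    ENNReal.ofReal_le_ofReal_iff hc] at h1

end HilbertSchmidt

/-! ### Consistency of the bootstrap covariance operator. -/

section CovarianceConsistency

variable {Ω S E : Type*} [MeasurableSpace Ω] [MeasurableSpace S]
  [NormedAddCommGroup E] [InnerProductSpace ℝ E]

lemma VanishesInMean.congr {P : Measure Ω} {u w : ℕ → Ω → ℝ} (hu : VanishesInMean P u)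
    (h : ∀ᶠ j in atTop, ∀ ω, w j ω = u j ω) : VanishesInMean P w := fun η hη => by
  filter_upwards [hu η hη, h] with j ⟨G, hG, hle, hi⟩ hj
  exact ⟨G, hG, fun ω => (hj ω).symm ▸ hle ω, hi⟩

/-- Reduces matrix entries to quadratic forms, which for the bootstrap covariance operator are the
variances `bootVar` of scalar data. -/
lemma inner_polarization {A : E →L[ℝ] E} (hA : ∀ u v, inner ℝ (A u) v = inner ℝ (A v) u)
    (u v : E) : inner ℝ (A u) v
      = 4⁻¹ * (inner ℝ (A (u + v)) (u + v) - inner ℝ (A (u - v)) (u - v)) := by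
  simp only [map_add, map_sub, inner_add_left, inner_add_right, inner_sub_left, inner_sub_right]
  rw [hA v u]
  ring

variable [CompleteSpace E]

lemma inner_expTensor_self_comm {P : Measure Ω} {Y : Ω → E} (hY : MemLp Y 2 P) (u v : E) :
    inner ℝ (expTensor P Y Y u) v = inner ℝ (expTensor P Y Y v) u := by
  rw [inner_expTensor hY hY, inner_expTensor hY hY]
  simp_rw [mul_comm]

lemma inner_bootCovOp_comm (k b : ℕ) (x : ℤ → E) (u v : E) :
    inner ℝ (bootCovOp k b x u) v = inner ℝ (bootCovOp k b x v) u := by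
  rw [bootCovOp_eq_expTensor]
  exact inner_expTensor_self_comm (memLp_blockIndexLaw k b _) u v

lemma inner_bootCovOp_self {k b : ℕ} (hk : 0 < k) (hb : 0 < b) (x : ℤ → E) (u : E) :
    inner ℝ (bootCovOp k b x u) u = bootVar k b fun t => inner ℝ u (x t) := by
  rw [bootCovOp_eq_expTensor, inner_expTensor (memLp_blockIndexLaw k b _)
    (memLp_blockIndexLaw k b _), ← integral_norm_sq_bootCentered hk hb]
  refine integral_congr_ae (ae_of_all _ fun I => ?_)
  have := bootCentered_clm (innerSL ℝ u) k b x I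
  simp only [innerSL_apply_apply] at this
  dsimp only
  rw [this, real_inner_comm, inner_smul_right, smul_eq_mul, Real.norm_eq_abs, sq_abs, sq]

/-- Truncation error of the bootstrap covariance operator. -/
lemma hsSq_bootCovOp_sub_compress_le {ι : Type*} (e : HilbertBasis ι ℝ E) (U : Submodule ℝ E)
    [U.HasOrthogonalProjection] {k b : ℕ} (hk : 0 < k) (hb : 0 < b) (x : ℤ → E) :
    hsSq e (bootCovOp k b x - compress U (bootCovOp k b x))
      ≤ ENNReal.ofReal (4 * bootVar k b x * bootVar k b fun t => Uᗮ.starProjection (x t)) := by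
  rw [bootCovOp_eq_expTensor]
  refine (hsSq_expTensor_sub_compress_le e U (memLp_blockIndexLaw k b _)).trans_eq ?_
  simp_rw [map_smul, ← bootCentered_clm]
  rw [integral_norm_sq_bootCentered hk hb, integral_norm_sq_bootCentered hk hb]

variable [MeasurableSpace E] [BorelSpace E] [SecondCountableTopology E] {P : Measure Ω}
  [IsProbabilityMeasure P] {δ : ℤ → Ω → S} {f : (ℕ → S) → E} {ι : Type*}

/-- Truncation error of the covariance operators of the sample means. -/
lemma IsL2mApproximable.hsSq_meanCovOp_sub_compress_le
    (h : IsL2mApproximable P (causalProc δ f) δ f)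
    (hmean : ∀ t, ∫ ω, causalProc δ f t ω ∂P = 0) (e : HilbertBasis ι ℝ E) (U : Submodule ℝ E)
    [U.HasOrthogonalProjection] {n : ℕ} (hn : 0 < n) :
    hsSq e (meanCovOp P (causalProc δ f) n - compress U (meanCovOp P (causalProc δ f) n))
      ≤ ENNReal.ofReal (4 * longRunBound P δ f (ContinuousLinearMap.id ℝ E)
        * longRunBound P δ f Uᗮ.starProjection) := by
  rw [meanCovOp_eq_expTensor]
  have hm := memLp_sampleMean (P := P) (fun t => h.memLp_causalProc t) n
  refine (hsSq_expTensor_sub_compress_le e U hm).trans (ENNReal.ofReal_le_ofReal ?_)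
  have h1 : ∫ ω, ‖Real.sqrt n • sampleMean n fun t => causalProc δ f t ω‖ ^ 2 ∂P
      ≤ longRunBound P δ f (ContinuousLinearMap.id ℝ E) :=
    integral_norm_sq_sampleMean_le
      (h.integral_norm_sum_clm_sq_le hmean (ContinuousLinearMap.id ℝ E)) hn
  have h2 : ∫ ω, ‖Uᗮ.starProjection
      (Real.sqrt n • sampleMean n fun t => causalProc δ f t ω)‖ ^ 2 ∂P
      ≤ longRunBound P δ f Uᗮ.starProjection := by
    have := integral_norm_sq_sampleMean_le (h.integral_norm_sum_clm_sq_le hmean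
      Uᗮ.starProjection) hn
    simpa [sampleMean, longRunBound] using this
  have h3 : 0 ≤ ∫ ω, ‖Uᗮ.starProjection
      (Real.sqrt n • sampleMean n fun t => causalProc δ f t ω)‖ ^ 2 ∂P :=
    integral_nonneg fun _ => by positivity
  have h4 := longRunBound_nonneg (P := P) (δ := δ) (f := f) (ContinuousLinearMap.id ℝ E)
  exact mul_le_mul (mul_le_mul_of_nonneg_left h1 (by norm_num)) h2 h3 (by positivity)

/-- The long-run covariance operator is an operator norm limit of covariance operators of sample
means, and the truncation bound passes to the limit by lower semicontinuity. -/
lemma IsL2mApproximable.hsSq_tsum_autocovOp_sub_compress_le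
    (h : IsL2mApproximable P (causalProc δ f) δ f)
    (hmean : ∀ t, ∫ ω, causalProc δ f t ω ∂P = 0) (e : HilbertBasis ι ℝ E) (U : Submodule ℝ E)
    [U.HasOrthogonalProjection] :
    hsSq e ((∑' i, autocovOp P (causalProc δ f) i)
        - compress U (∑' i, autocovOp P (causalProc δ f) i))
      ≤ ENNReal.ofReal (4 * longRunBound P δ f (ContinuousLinearMap.id ℝ E)
        * longRunBound P δ f Uᗮ.starProjection) := by
  have ht := h.tendsto_meanCovOp hmean
  refine hsSq_le_of_tendsto (ht.sub (((continuous_compress U).tendsto _).comp ht))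
    (mul_nonneg (mul_nonneg (by norm_num) (longRunBound_nonneg _)) (longRunBound_nonneg _)) ?_
  filter_upwards [eventually_gt_atTop 0] with n hn
  exact h.hsSq_meanCovOp_sub_compress_le hmean e U hn

lemma IsL2mApproximable.inner_tsum_autocovOp_comm (h : IsL2mApproximable P (causalProc δ f) δ f)
    (hmean : ∀ t, ∫ ω, causalProc δ f t ω ∂P = 0) (u v : E) :
    inner ℝ ((∑' i, autocovOp P (causalProc δ f) i) u) v
      = inner ℝ ((∑' i, autocovOp P (causalProc δ f) i) v) u := by
  have hc : ∀ u v : E, Continuous fun T : E →L[ℝ] E => inner ℝ (T u) v := fun u v => by fun_prop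
  have h1 := ((hc u v).tendsto _).comp (h.tendsto_meanCovOp hmean)
  have h2 := ((hc v u).tendsto _).comp (h.tendsto_meanCovOp hmean)
  refine tendsto_nhds_unique h1 (h2.congr fun n => ?_)
  simp only [Function.comp]
  rw [meanCovOp_eq_expTensor]
  exact inner_expTensor_self_comm (memLp_sampleMean (fun t => h.memLp_causalProc t) n) v u

variable {k b : ℕ → ℕ}

/-- Consistency of the entries of the bootstrap covariance operator. -/
lemma IsStronglyL2mApproximable.vanishesInMean_inner_bootCovOp_sub
    (h : IsStronglyL2mApproximable P (causalProc δ f) δ f)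
    (hmean : ∀ t, ∫ ω, causalProc δ f t ω ∂P = 0)
    (hn : Tendsto (fun j => k j * b j) atTop atTop) (hb : Tendsto b atTop atTop)
    (hbn : Tendsto (fun j => (b j : ℝ) / Real.sqrt ((k j * b j : ℕ) : ℝ)) atTop (𝓝 0))
    {T : ℕ → E →L[ℝ] E} (hT : Tendsto T atTop (𝓝 (∑' i, autocovOp P (causalProc δ f) i)))
    (u v : E) :
    VanishesInMean P fun j ω =>
      inner ℝ ((bootCovOp (k j) (b j) (fun t => causalProc δ f t ω) - T j) u) v := by
  set C := ∑' i, autocovOp P (causalProc δ f) i with hC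
  have hq := fun w => (h.isBlockRegular_inner hmean w).vanishesInMean_bootVar_sub
    h.measurable_innovation h.iIndep_innovation hn hb hbn
  have hc : Continuous fun A : E →L[ℝ] E => inner ℝ ((C - A) u) v := by fun_prop
  have hd : Tendsto (fun j => inner ℝ ((C - T j) u) v) atTop (𝓝 0) := by
    simpa [Function.comp_def] using (hc.tendsto C).comp hT
  refine ((((hq (u + v)).add ((hq (u - v)).const_mul (-1))).const_mul 4⁻¹).add
    (VanishesInMean.of_tendsto hd)).congr ?_
  filter_upwards [eventually_pos_of_tendsto_mul hn] with j ⟨hk, hb⟩ ω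
  have h1 := inner_polarization (inner_bootCovOp_comm (k j) (b j) fun t => causalProc δ f t ω) u v
  rw [inner_bootCovOp_self hk hb, inner_bootCovOp_self hk hb] at h1
  have h2 := inner_polarization (h.inner_tsum_autocovOp_comm hmean) u v
  rw [← hC] at h2
  rw [sub_apply, sub_apply, inner_sub_left, inner_sub_left, h1, h2]
  ring

/-- Consistency of the bootstrap covariance operator in the Hilbert-Schmidt norm. -/
lemma IsStronglyL2mApproximable.tendsto_measure_le_hsNorm
    (h : IsStronglyL2mApproximable P (causalProc δ f) δ f)
    (hmean : ∀ t, ∫ ω, causalProc δ f t ω ∂P = 0)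
    (hn : Tendsto (fun j => k j * b j) atTop atTop) (hb : Tendsto b atTop atTop)
    (hbn : Tendsto (fun j => (b j : ℝ) / Real.sqrt ((k j * b j : ℕ) : ℝ)) atTop (𝓝 0))
    (e : HilbertBasis ι ℝ E) {T : ℕ → E →L[ℝ] E}
    (hT : Tendsto T atTop (𝓝 (∑' i, autocovOp P (causalProc δ f) i)))
    (hTU : ∀ (U : Submodule ℝ E) [U.HasOrthogonalProjection], ∀ᶠ j in atTop,
      hsSq e (T j - compress U (T j)) ≤ ENNReal.ofReal
        (4 * longRunBound P δ f (ContinuousLinearMap.id ℝ E)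
          * longRunBound P δ f Uᗮ.starProjection))
    {ε : ℝ≥0∞} (hε : 0 < ε) :
    Tendsto (fun j => P {ω | ε ≤ hsNorm e
      (bootCovOp (k j) (b j) (fun t => causalProc δ f t ω) - T j)}) atTop (𝓝 0) := by
  rw [ENNReal.tendsto_nhds_zero]
  intro η₀ hη₀
  obtain ⟨η, hη, hηle⟩ := exists_pos_ofReal_le hη₀
  -- `c` is the threshold for the squared norm. The three pieces will be bounded by `c / 8`, `c /
  -- 16` and `c / 16`, and two uses of the doubled triangle inequality give `2 (c / 8) + 2 (c / 8 +
  -- c / 8) = 3 c / 4 < c`.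
  obtain ⟨c, hc, hcle⟩ := exists_pos_ofReal_le (ENNReal.pow_pos hε 2)
  set κ := longRunBound P δ f (ContinuousLinearMap.id ℝ E) with hκ
  have hκ0 : 0 ≤ κ := longRunBound_nonneg _
  set c' := Real.sqrt (c / 8) with hc'
  have hc'0 : 0 < c' := Real.sqrt_pos.2 (by positivity)
  -- The order of choices matters: `t` is small relative to the full bound `κ`, and `U` is then
  -- chosen so that its bound is small even after division by `t`.
  obtain ⟨t, ht0, -, ht⟩ := exists_pos_small κ (η := η * c' / 4) (by positivity)
  obtain ⟨U, hU, hUle⟩ := h.exists_longRunBound_le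
    (ε := min (t * (η * c' / 4)) (c / (64 * (κ + 1)))) (by positivity)
  set κU := longRunBound P δ f Uᗮ.starProjection with hκU
  have hκU0 : 0 ≤ κU := longRunBound_nonneg _
  have hU1 : κU / t ≤ η * c' / 4 := by
    rw [div_le_iff₀ ht0, mul_comm]
    exact hUle.trans (min_le_left _ _)
  have hU2 : 4 * κ * κU ≤ c / 16 := by
    have h1 := hUle.trans (min_le_right _ _)
    rw [le_div_iff₀ (by positivity)] at h1
    nlinarith
  set u := stdOrthonormalBasis ℝ U with hu
  set H : ℕ → Ω → ℝ := fun j ω => ∑ p : _ × _,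
    |inner ℝ ((bootCovOp (k j) (b j) (fun t => causalProc δ f t ω) - T j) (u p.2 : E))
      (u p.1 : E)| with hH
  have hHv : VanishesInMean P H := VanishesInMean.sum _ fun p =>
    (h.vanishesInMean_inner_bootCovOp_sub hmean hn hb hbn hT (u p.2 : E) (u p.1 : E)).mono
      fun j ω => (abs_abs _).le
  have hH0 : ∀ j ω, 0 ≤ H j ω := fun j ω => Finset.sum_nonneg fun _ _ => abs_nonneg _
  have hc''0 : 0 < Real.sqrt (c / 16) := Real.sqrt_pos.2 (by positivity)
  filter_upwards [hTU U, eventually_pos_of_tendsto_mul hn, ENNReal.tendsto_nhds_zero.1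
    (hHv.tendsto_measure hc''0) (ENNReal.ofReal (η / 2)) (by simpa using hη)]
    with j hj ⟨hkj, hbj⟩ hjH
  set V : Ω → ℝ := fun ω => bootVar (k j) (b j) fun t => causalProc δ f t ω with hV
  set W : Ω → ℝ := fun ω => bootVar (k j) (b j) fun t => Uᗮ.starProjection (causalProc δ f t ω)
    with hW
  have hV0 : ∀ ω, 0 ≤ V ω := fun ω => bootVar_nonneg _ _ _
  have hW0 : ∀ ω, 0 ≤ W ω := fun ω => bootVar_nonneg _ _ _
  have iV : Integrable V P := integrable_bootVar h.memLp_causalProc _ _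
  have iW : Integrable W P := integrable_bootVar (h.memLp_clm Uᗮ.starProjection) _ _
  -- The truncation error is governed by the product `V W`, of which only the means of the factors
  -- are controlled. The inequality `4 V W ≤ (t V + W / t)²` linearizes it.
  set G : Ω → ℝ := fun ω => t * V ω + W ω / t with hG
  have hG0 : ∀ ω, 0 ≤ G ω := fun ω =>
    add_nonneg (mul_nonneg ht0.le (hV0 ω)) (div_nonneg (hW0 ω) ht0.le)
  have hGi : ∫ ω, G ω ∂P ≤ η / 2 * c' := by
    rw [hG, integral_add (iV.const_mul t) (iW.div_const t), integral_const_mul, integral_div]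
    have h1 : ∫ ω, V ω ∂P ≤ κ :=
      h.integral_bootVar_clm_le hmean (ContinuousLinearMap.id ℝ E) hbj (k j)
    have h2 : ∫ ω, W ω ∂P ≤ κU := h.integral_bootVar_clm_le hmean Uᗮ.starProjection hbj (k j)
    have h3 := mul_le_mul_of_nonneg_left h1 ht0.le
    have h4 := div_le_div_of_nonneg_right h2 ht0.le
    linarith
  have hGP : P {ω | c' ≤ |G ω|} ≤ ENNReal.ofReal (η / 2) := by
    have := measure_le_of_integral_le ((iV.const_mul t).add (iW.div_const t))
      (u := G) (fun ω => (abs_of_nonneg (hG0 ω)).le) hc'0 hGi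
    rwa [mul_div_cancel_right₀ _ hc'0.ne'] at this
  have hsub : {ω | ε ≤ hsNorm e (bootCovOp (k j) (b j) (fun t => causalProc δ f t ω) - T j)}
      ⊆ {ω | c' ≤ |G ω|} ∪ {ω | Real.sqrt (c / 16) ≤ |H j ω|} := by
    intro ω hω
    by_contra hcon
    simp only [Set.mem_union, Set.mem_ofPred_eq, not_or, not_le, abs_of_nonneg (hG0 ω),
      abs_of_nonneg (hH0 j ω)] at hcon hω
    set A := bootCovOp (k j) (b j) (fun t => causalProc δ f t ω) with hA
    have hG2 : G ω ^ 2 ≤ c / 8 := by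
      rw [← Real.sq_sqrt (show 0 ≤ c / 8 by positivity)]
      exact pow_le_pow_left₀ (hG0 ω) hcon.1.le 2
    have hH2 : H j ω ^ 2 ≤ c / 16 := by
      rw [← Real.sq_sqrt (show 0 ≤ c / 16 by positivity)]
      exact pow_le_pow_left₀ (hH0 j ω) hcon.2.le 2
    have hVW : 4 * V ω * W ω ≤ G ω ^ 2 := by
      have : t * V ω * (W ω / t) = V ω * W ω := by field_simp
      have h1 := sq_nonneg (t * V ω - W ω / t)
      simp only [hG]
      nlinarith
    have h1 : hsSq e (A - compress U A) ≤ ENNReal.ofReal (c / 8) :=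
      (hsSq_bootCovOp_sub_compress_le e U hkj hbj _).trans
        (ENNReal.ofReal_le_ofReal (hVW.trans hG2))
    have h2 : hsSq e (compress U (A - T j)) ≤ ENNReal.ofReal (c / 16) :=
      (hsSq_compress_le e U (A - T j) u).trans (ENNReal.ofReal_le_ofReal hH2)
    have h3 : hsSq e (-(T j - compress U (T j))) ≤ ENNReal.ofReal (c / 16) := by
      rw [hsSq_neg]
      exact hj.trans (ENNReal.ofReal_le_ofReal hU2)
    have h4 := hsSq_add_le_of_le (by positivity) (by positivity) h1
      (hsSq_add_le_of_le (by positivity) (by positivity) h2 h3)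
    have e1 : A - compress U A + (compress U (A - T j) + -(T j - compress U (T j))) = A - T j := by
      rw [compress_sub]; abel
    rw [e1] at h4
    have h5 := hcle.trans (((le_hsNorm_iff e _ ε).1 hω).trans h4)
    rw [ENNReal.ofReal_le_ofReal_iff (by positivity)] at h5
    linarith
  calc P _ ≤ ENNReal.ofReal (η / 2) + ENNReal.ofReal (η / 2) :=
        (measure_mono hsub).trans ((measure_union_le _ _).trans (add_le_add hGP hjH))
    _ = ENNReal.ofReal η := by
        rw [← ENNReal.ofReal_add (by positivity) (by positivity), add_halves]
    _ ≤ η₀ := hηle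

end CovarianceConsistency

/-! ### Replacing the process by its causal representation. -/

section Representation

variable {Ω S E : Type*} [MeasurableSpace Ω] [MeasurableSpace S]
  [NormedAddCommGroup E] [InnerProductSpace ℝ E] {P : Measure Ω}

lemma expTensor_congr {Y Y' Z Z' : Ω → E} (hY : Y =ᵐ[P] Y') (hZ : Z =ᵐ[P] Z') :
    expTensor P Y Z = expTensor P Y' Z' := by
  refine integral_congr_ae ?_
  filter_upwards [hY, hZ] with ω h1 h2
  rw [h1, h2]

lemma sampleMean_congr {X X' : ℤ → Ω → E} (h : ∀ᵐ ω ∂P, ∀ t, X t ω = X' t ω) (n : ℕ) :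
    (fun ω => sampleMean n fun t => X t ω) =ᵐ[P] fun ω => sampleMean n fun t => X' t ω := by
  filter_upwards [h] with ω hω
  simp [hω]

lemma meanCovOp_congr {X X' : ℤ → Ω → E} (h : ∀ᵐ ω ∂P, ∀ t, X t ω = X' t ω) :
    meanCovOp P X = meanCovOp P X' := by
  ext1 n
  rw [meanCovOp, meanCovOp, expTensor_congr (sampleMean_congr h n) (sampleMean_congr h n)]

variable [MeasurableSpace E]

lemma meanLaw_congr [BorelSpace E] [SecondCountableTopology E] [IsProbabilityMeasure P]
    {X X' : ℤ → Ω → E} (hX : ∀ t, Measurable (X t)) (hX' : ∀ t, Measurable (X' t))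
    (h : ∀ᵐ ω ∂P, ∀ t, X t ω = X' t ω) (n : ℕ) : meanLaw P X hX n = meanLaw P X' hX' n := by
  refine Subtype.ext (Measure.map_congr ?_)
  filter_upwards [sampleMean_congr h n] with ω hω
  exact congrArg (Real.sqrt n • ·) hω

lemma couplingError_congr [SFinite P] {X X' : ℤ → Ω → E} {δ : ℤ → Ω → S} {f : (ℕ → S) → E}
    (h : ∀ t, X t =ᵐ[P] X' t) : couplingError P X δ f = couplingError P X' δ f := by
  ext t m
  refine congrArg Real.sqrt (integral_congr_ae ?_)
  have h1 := (Measure.quasiMeasurePreserving_fst (μ := P) (ν := P)).ae_eq_comp (h t)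
  filter_upwards [h1] with p hp
  simp only [Function.comp] at hp
  rw [hp]

variable {X : ℤ → Ω → E} {δ : ℤ → Ω → S} {f : (ℕ → S) → E}

lemma IsL2mApproximable.ae_eq_causalProc (h : IsL2mApproximable P X δ f) :
    ∀ᵐ ω ∂P, ∀ t, X t ω = causalProc δ f t ω :=
  ae_all_iff.2 h.representation

/-- The coupling error sees the process only up to null sets, so everything may be proved for the
exact causal process, which is measurable with respect to the past innovations. -/
lemma IsStronglyL2mApproximable.to_causalProc [SFinite P] (h : IsStronglyL2mApproximable P X δ f) :
    IsStronglyL2mApproximable P (causalProc δ f) δ f where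
  toIsL2mApproximable :=
    { h.toIsL2mApproximable with
      representation := fun _ => EventuallyEq.rfl
      memLp := h.memLp.ae_eq (h.representation 0)
      summable_couplingError := by
        rw [← couplingError_congr (X' := causalProc δ f) h.representation]
        exact h.summable_couplingError }
  tendsto_couplingError := by
    rw [← couplingError_congr (X' := causalProc δ f) h.representation]
    exact h.tendsto_couplingError

end Representation

/-! ### The main theorem. -/

theorem theorem2p1 {Ω S : Type*} [MeasurableSpace Ω] [MeasurableSpace S]
    (P : Measure Ω) [IsProbabilityMeasure P]
    (X : ℤ → Ω → L2) (hX : ∀ t, Measurable (X t))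
    (δ : ℤ → Ω → S) (f : (ℕ → S) → L2)
    (happrox : IsStronglyL2mApproximable P X δ f)
    (hmean : ∀ t, ∫ ω, X t ω ∂P = 0)
    (k b : ℕ → ℕ)
    (hn : Tendsto (fun j => k j * b j) atTop atTop)
    (hb : Tendsto b atTop atTop)
    (hbn : Tendsto (fun j => (b j : ℝ) / Real.sqrt ((k j * b j : ℕ) : ℝ)) atTop (𝓝 0)) :
    (∀ d : ProbabilityMeasure L2 → ProbabilityMeasure L2 → ℝ, MetrizesWeakConvergence d →
      TendstoInMeasure P
        (fun j ω => d (bootLaw (k j) (b j) fun t => X t ω) (meanLaw P X hX (k j * b j)))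
        atTop (fun _ => 0)) ∧
    (∀ {ι : Type} (e : HilbertBasis ι ℝ L2) (ε : ℝ≥0∞), 0 < ε →
      Tendsto (fun j => P {ω | ε ≤ hsNorm e
        (bootCovOp (k j) (b j) (fun t => X t ω) - meanCovOp P X (k j * b j))}) atTop (𝓝 0)) ∧
    Summable (autocovOp P X) ∧
    (∀ {ι : Type} (e : HilbertBasis ι ℝ L2) (ε : ℝ≥0∞), 0 < ε →
      Tendsto (fun j => P {ω | ε ≤ hsNorm e
        (bootCovOp (k j) (b j) (fun t => X t ω) -
          (2 * Real.pi) • spectralDensityOpZero P X)}) atTop (𝓝 0)) := by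
  have h := happrox.to_causalProc
  have hae := happrox.ae_eq_causalProc
  have hX' : ∀ t, Measurable (causalProc δ f t) := fun t =>
    happrox.measurable_fun.comp (h.measurable_past t)
  have hmean' : ∀ t, ∫ ω, causalProc δ f t ω ∂P = 0 := fun t =>
    (integral_congr_ae (happrox.representation t)).symm.trans (hmean t)
  have hac : autocovOp P X = autocovOp P (causalProc δ f) := funext fun i =>
    expTensor_congr (happrox.representation 0) (happrox.representation i)
  -- Off one null set the two trajectories agree at all times, so the two events agree almost
  -- everywhere; their measurability is not needed for this.
  have hset : ∀ (ι : Type) (e : HilbertBasis ι ℝ L2) (ε : ℝ≥0∞) (j : ℕ) (T : L2 →L[ℝ] L2),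
      P {ω | ε ≤ hsNorm e (bootCovOp (k j) (b j) (fun t => X t ω) - T)}
        = P {ω | ε ≤ hsNorm e (bootCovOp (k j) (b j) (fun t => causalProc δ f t ω) - T)} := by
    intro ι e ε j T
    refine measure_congr ?_
    filter_upwards [hae] with ω hω
    have : (fun t => X t ω) = fun t => causalProc δ f t ω := funext hω
    apply propext
    change ε ≤ hsNorm e (bootCovOp (k j) (b j) (fun t => X t ω) - T)
      ↔ ε ≤ hsNorm e (bootCovOp (k j) (b j) (fun t => causalProc δ f t ω) - T)
    rw [this]
  refine ⟨fun d hd => ?_, fun {ι} e ε hε => ?_, ?_, fun {ι} e ε hε => ?_⟩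
  · refine (h.tendstoInMeasure_bootLaw hmean' hX' hn hb hbn hd).congr_left fun j => ?_
    filter_upwards [hae] with ω hω
    rw [meanLaw_congr hX hX' hae, show (fun t => X t ω) = fun t => causalProc δ f t ω
      from funext hω]
  · simp_rw [hset, meanCovOp_congr hae]
    refine h.tendsto_measure_le_hsNorm hmean' hn hb hbn e
      ((h.tendsto_meanCovOp hmean').comp hn) (fun U _ => ?_) hε
    filter_upwards [hn.eventually_gt_atTop 0] with j hj
    exact h.hsSq_meanCovOp_sub_compress_le hmean' e U hj
  · rw [hac]
    exact h.summable_autocovOp hmean'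
  · have hC : (2 * Real.pi) • spectralDensityOpZero P X = ∑' i, autocovOp P (causalProc δ f) i := by
      rw [spectralDensityOpZero, hac, smul_inv_smul₀ (by positivity)]
    simp_rw [hset, hC]
    exact h.tendsto_measure_le_hsNorm hmean' hn hb hbn e tendsto_const_nhds
      (fun U _ => Eventually.of_forall fun _ =>
        h.hsSq_tsum_autocovOp_sub_compress_le hmean' e U) hε
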